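/- Let $b>0$, $A_0=(A_{0,1},A_{0,2})=\frac b2(-x_2,x_1)$ and $\Pi_j=-i\,\partial_{x_j}-A_{0,j}$, $j=1,2$, acting in $L^2(\mathbb R^2)$ in the sense of distributions. Let $H_0=\Pi_1^2+\Pi_2^2$ be the (self-adjoint) Landau Hamiltonian, with eigenvalues $\Lambda_q=b(2q+1)$, $q\in\mathbb Z_+=\{0,1,2,\dots\}$, put $\Lambda_{-1}=-\infty$, and let $P_q$ be the orthogonal projection onto $\operatorname{Ker}(H_0-\Lambda_q)$. Let $m(x)=\{m_{jk}(x)\}_{j,k=1,2}$, $x\in\mathbb R^2$, be a Hermitian matrix with $m(x)\ge 0$ for all $x$, whose entries $m_{jk}\in C^\infty(\mathbb R^2)$ are bounded together with all their derivatives and satisfy $\lim_{|x|\to\infty}m_{jk}(x)=0$. Set $W=\sum_{j,k=1,2}\Pi_j m_{jk}\Pi_k$ and $H_\pm=H_0\pm W$ on $\operatorname{Dom}H_0$; in all assertions concerning $H_-$ assume in addition that $\sup_{x\in\mathbb R^2}|m(x)|<1$, where $|\cdot|$ is the operator norm. For $\lambda>0$ let $\mathcal N_q^+(\lambda)$ be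 the number of eigenvalues $\mu\in(\Lambda_q,\Lambda_{q+1})$ of $H_+$ with $\mu-\Lambda_q>\lambda$, and let $\mathcal N_q^-(\lambda)$ be the number of eigenvalues $\mu\in(\Lambda_{q-1},\Lambda_q)$ of $H_-$ with $\Lambda_q-\mu>\lambda$, both counted with multiplicities. For a compact self-adjoint operator $T$ and $s>0$ let $n_+(s;T)$ be the number of eigenvalues of $T$ larger than $s$, counted with multiplicities. Then, for each $q\in\mathbb Z_+$ and each choice of the sign $\pm$, the operator $$T_q^\pm := P_qWP_q\mp P_qWH_\pm^{-1}WP_q$$ is everywhere defined, bounded, self-adjoint and compact in $L^2(\mathbb R^2)$, and for each $\varepsilon\in(0,1)$ $$n_+\big((1+\varepsilon)\lambda;\,T_q^\pm\big)+O(1)\;\le\;\mathcal N_q^\pm(\lambda)\;\le\; n_+\big((1-\varepsilon)\lambda;\,T_q^\pm\big)+O(1),\qquad \lambda\downarrow 0 .$$ Here $O(1)$ means: there are a finite constant $C$ and $\lambda_0>0$ (which may depend on $b,m,q,\varepsilon$) such that for all $\lambda\in(0,\lambda_0)$ the left inequality holds with $O(1)$ replaced by $-C$ and the right one with $O(1)$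 replaced by $C$. -/

import Mathlib

open MeasureTheory Set Filter Topology
open scoped ContDiff ComplexOrder ComplexConjugate

noncomputable section

namespace Landau

/-- The plane `ℝ²` with its Euclidean norm. -/
abbrev Plane : Type := EuclideanSpace ℝ (Fin 2)

/-- The Hilbert space `L²(ℝ²)` of complex-valued functions. -/
abbrev L2 : Type := Lp ℂ 2 (volume : Measure Plane)

/-! ### Generalities on unbounded operators -/

/-- The product `g f` of two unbounded operators, on its natural domain
`{x ∈ Dom f | f x ∈ Dom g}`. -/
def opComp (g f : L2 →ₗ.[ℂ] L2) : L2 →ₗ.[ℂ] L2 :=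
  g.comp (f.domRestrict ((g.domain.comap f.toFun).map f.domain.subtype)) (by
    rintro ⟨x, hx⟩
    obtain ⟨y, hy, hyx⟩ := hx.1
    have h : f.domRestrict ((g.domain.comap f.toFun).map f.domain.subtype) ⟨x, hx⟩ = f y :=
      LinearPMap.domRestrict_apply hyx.symm
    rw [h]
    exact hy)

/-- An everywhere defined bounded operator, seen as an unbounded operator with domain `L²`. -/
def ofBounded (T : L2 →L[ℂ] L2) : L2 →ₗ.[ℂ] L2 :=
  (T : L2 →ₗ[ℂ] L2).toPMap ⊤

/-- The kernel `Ker (T - μ)` of an unbounded operator `T`. -/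
def eigenspace (T : L2 →ₗ.[ℂ] L2) (μ : ℂ) : Submodule ℂ L2 :=
  (LinearMap.ker (T.toFun - μ • T.domain.subtype)).map T.domain.subtype

/-- The number (possibly `∞`) of eigenvalues of `T` in `I`, counted with multiplicities: the
dimension of the span of all eigenvectors of `T` with eigenvalue in `I`. As eigenspaces for
different eigenvalues are linearly independent, it is the sum over `μ ∈ I` of the dimensions
of `Ker (T - μ)`. -/
def eigenCount (T : L2 →ₗ.[ℂ] L2) (I : Set ℝ) : ℕ∞ :=
  Cardinal.toENat (Module.rank ℂ (⨆ μ ∈ I, eigenspace T (μ : ℂ) : Submodule ℂ L2))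

/-- `n₊(s; T)`: the number of eigenvalues of `T` larger than `s`, counted with
multiplicities. -/
def nPlus (s : ℝ) (T : L2 →ₗ.[ℂ] L2) : ℕ∞ :=
  eigenCount T (Ioi s)

/-! ### The magnetic derivatives `Π_j` -/

/-- The components of the magnetic potential `A₀ = (b/2) (-x₂, x₁)`. -/
def A0 (b : ℝ) (j : Fin 2) (x : Plane) : ℝ :=
  ![-(b / 2) * x 1, (b / 2) * x 0] j

/-- The differential expression `Π_j φ = -i ∂φ/∂x_j - A_{0,j} φ` for differentiable `φ`. -/
def piExpr (b : ℝ) (j : Fin 2) (φ : Plane → ℂ) (x : Plane) : ℂ :=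
  -Complex.I * fderiv ℝ φ x (EuclideanSpace.single j 1) - (A0 b j x : ℂ) * φ x

/-- `φ ∈ C₀^∞(ℝ²)`. -/
structure IsTest (φ : Plane → ℂ) : Prop where
  smooth : ContDiff ℝ ∞ φ
  compact : HasCompactSupport φ

lemma IsTest.memLp {φ : Plane → ℂ} (h : IsTest φ) : MemLp φ 2 volume :=
  h.smooth.continuous.memLp_of_hasCompactSupport h.compact

lemma continuous_A0 (b : ℝ) (j : Fin 2) : Continuous (A0 b j) := by
  unfold A0
  fin_cases j <;> simp <;> fun_prop

lemma IsTest.memLp_piExpr {φ : Plane → ℂ} (h : IsTest φ) (b : ℝ) (j : Fin 2) :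
    MemLp (piExpr b j φ) 2 volume := by
  have hc : Continuous (piExpr b j φ) := by
    have h1 : Continuous (fun x => fderiv ℝ φ x (EuclideanSpace.single j (1 : ℝ))) :=
      (h.smooth.continuous_fderiv (by simp)).clm_apply continuous_const
    exact (continuous_const.mul h1).sub
      ((Complex.continuous_ofReal.comp (continuous_A0 b j)).mul h.smooth.continuous)
  refine hc.memLp_of_hasCompactSupport ?_
  have h2 : HasCompactSupport (fun x => fderiv ℝ φ x (EuclideanSpace.single j (1 : ℝ))) :=
    h.compact.fderiv_apply ℝ _
  exact (h2.mul_left (f := fun _ => -Complex.I)).sub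
    (h.compact.mul_left (f := fun x => (A0 b j x : ℂ)))

/-- The graph of `Π_j` in `L²(ℝ²)`: all pairs `(u, f)` such that `Π_j u = f` in the sense of
distributions, that is, `⟨Π_j φ, u⟩ = ⟨φ, f⟩` for all `φ ∈ C₀^∞(ℝ²)`. -/
def piGraph (b : ℝ) (j : Fin 2) : Submodule ℂ (L2 × L2) where
  carrier := {p | ∀ (φ : Plane → ℂ) (h : IsTest φ),
    inner ℂ ((h.memLp_piExpr b j).toLp _) p.1 = inner ℂ (h.memLp.toLp φ) p.2}
  add_mem' := by
    intro p r hp hr φ h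
    simp only [Prod.fst_add, Prod.snd_add, inner_add_right, hp φ h, hr φ h]
  zero_mem' := by
    intro φ h
    simp
  smul_mem' := by
    intro c p hp φ h
    simp only [Prod.smul_fst, Prod.smul_snd, inner_smul_right, hp φ h]

lemma piGraph_functional (b : ℝ) (j : Fin 2) :
    ∀ p ∈ piGraph b j, p.1 = 0 → p.2 = 0 := by
  rintro ⟨u, f⟩ hp rfl
  have hd := MeasureTheory.Lp.dense_hasCompactSupport_contDiff (F := ℂ) (p := 2)
    (μ := (volume : Measure Plane)) (by simp)
  refine hd.eq_zero_of_inner_right ℂ ?_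
  rintro v ⟨g, hvg, hc, hs⟩
  have ht : IsTest g := ⟨hs, hc⟩
  have hv : v = ht.memLp.toLp g :=
    Lp.ext (hvg.trans ht.memLp.coeFn_toLp.symm)
  have := hp g ht
  rw [hv]
  simpa using this.symm

/-- The operator `Π_j` in `L²(ℝ²)`, with domain `{u ∈ L² | Π_j u ∈ L²}` (derivatives in the
sense of distributions). -/
def piOp (b : ℝ) (j : Fin 2) : L2 →ₗ.[ℂ] L2 :=
  (piGraph b j).toLinearPMap

/-- The graph of the multiplication by `a : ℝ² → ℂ` in `L²(ℝ²)`: all pairs `(u, f)` such that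
`f = a u` almost everywhere. -/
def mulGraph (a : Plane → ℂ) : Submodule ℂ (L2 × L2) where
  carrier := {p | ∀ᵐ x, p.2 x = a x * p.1 x}
  add_mem' := by
    rintro ⟨u, f⟩ ⟨v, g⟩ hu hv
    filter_upwards [hu, hv, Lp.coeFn_add u v, Lp.coeFn_add f g] with x h1 h2 h3 h4
    simp only [Prod.mk_add_mk] at h1 h2 ⊢
    rw [h3, h4, Pi.add_apply, Pi.add_apply, h1, h2, mul_add]
  zero_mem' := by
    filter_upwards [Lp.coeFn_zero ℂ 2 (volume : Measure Plane)] with x hx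
    simp only [Prod.fst_zero, Prod.snd_zero]
    rw [hx, Pi.zero_apply, mul_zero]
  smul_mem' := by
    rintro c ⟨u, f⟩ hu
    filter_upwards [hu, Lp.coeFn_smul c u, Lp.coeFn_smul c f] with x h1 h2 h3
    simp only [Prod.smul_mk] at h1 ⊢
    rw [h2, h3, Pi.smul_apply, Pi.smul_apply, h1, mul_smul_comm]

lemma mulGraph_functional (a : Plane → ℂ) : ∀ p ∈ mulGraph a, p.1 = 0 → p.2 = 0 := by
  rintro ⟨u, f⟩ hp rfl
  refine Lp.ext ?_
  filter_upwards [hp, Lp.coeFn_zero ℂ 2 (volume : Measure Plane)] with x h1 h2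
  rw [h1, h2, Pi.zero_apply, mul_zero]

/-- Multiplication by a function `a : ℝ² → ℂ`, with domain `{u ∈ L² | a u ∈ L²}`. -/
def mulOp (a : Plane → ℂ) : L2 →ₗ.[ℂ] L2 :=
  (mulGraph a).toLinearPMap

/-! ### The operators `H₀`, `W`, `H_±` -/

/-- The Landau Hamiltonian `H₀ = Π₁² + Π₂²`. -/
def H0 (b : ℝ) : L2 →ₗ.[ℂ] L2 :=
  ∑ j : Fin 2, opComp (piOp b j) (piOp b j)

/-- The perturbation `W = ∑_{j,k} Π_j m_{jk} Π_k`. -/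
def W (b : ℝ) (m : Plane → Matrix (Fin 2) (Fin 2) ℂ) : L2 →ₗ.[ℂ] L2 :=
  ∑ j : Fin 2, ∑ k : Fin 2,
    opComp (piOp b j) (opComp (mulOp fun x => m x j k) (piOp b k))

/-- `H₊ = H₀ + W`. -/
def Hplus (b : ℝ) (m : Plane → Matrix (Fin 2) (Fin 2) ℂ) : L2 →ₗ.[ℂ] L2 :=
  H0 b + W b m

/-- `H₋ = H₀ - W`. -/
def Hminus (b : ℝ) (m : Plane → Matrix (Fin 2) (Fin 2) ℂ) : L2 →ₗ.[ℂ] L2 :=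
  H0 b - W b m

/-- The Landau level `Λ_q = b (2q + 1)`. -/
def level (b : ℝ) (q : ℕ) : ℝ :=
  b * (2 * q + 1)

/-- `P_q`, the orthogonal projection onto `Ker (H₀ - Λ_q)`. (This kernel is closed; the closure
is written because orthogonal projections are defined for closed subspaces.) -/
def P (b : ℝ) (q : ℕ) : L2 →L[ℂ] L2 :=
  (eigenspace (H0 b) (level b q : ℂ)).topologicalClosure.starProjection

/-- `P_q W P_q`, on its natural domain. -/
def PWP (b : ℝ) (m : Plane → Matrix (Fin 2) (Fin 2) ℂ) (q : ℕ) : L2 →ₗ.[ℂ] L2 :=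
  opComp (ofBounded (P b q)) (opComp (W b m) (ofBounded (P b q)))

/-- `P_q W H⁻¹ W P_q`, on its natural domain. -/
def PWinvWP (b : ℝ) (m : Plane → Matrix (Fin 2) (Fin 2) ℂ) (q : ℕ) (H : L2 →ₗ.[ℂ] L2) :
    L2 →ₗ.[ℂ] L2 :=
  opComp (ofBounded (P b q)) (opComp (W b m) (opComp H.inverse
    (opComp (W b m) (ofBounded (P b q)))))

/-- `P_q W P_q - P_q W H₊⁻¹ W P_q`. -/
def toeplitzPlus (b : ℝ) (m : Plane → Matrix (Fin 2) (Fin 2) ℂ) (q : ℕ) : L2 →ₗ.[ℂ] L2 :=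
  PWP b m q - PWinvWP b m q (Hplus b m)

/-- `P_q W P_q + P_q W H₋⁻¹ W P_q`. -/
def toeplitzMinus (b : ℝ) (m : Plane → Matrix (Fin 2) (Fin 2) ℂ) (q : ℕ) : L2 →ₗ.[ℂ] L2 :=
  PWP b m q + PWinvWP b m q (Hminus b m)

/-! ### The counting functions `𝒩_q^±` -/

/-- `𝒩_q^+(λ)`: the number of eigenvalues `μ` of `H₊` in `(Λ_q, Λ_{q+1})` with `μ - Λ_q > λ`,
counted with multiplicities. -/
def Nplus (b : ℝ) (m : Plane → Matrix (Fin 2) (Fin 2) ℂ) (q : ℕ) (lam : ℝ) : ℕ∞ :=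
  eigenCount (Hplus b m) {μ | μ ∈ Ioo (level b q) (level b (q + 1)) ∧ μ - level b q > lam}

/-- The interval `(Λ_{q-1}, Λ_q)`, where `Λ_{-1} = -∞`. -/
def gapBelow (b : ℝ) : ℕ → Set ℝ
  | 0 => Iio (level b 0)
  | q + 1 => Ioo (level b q) (level b (q + 1))

/-- `𝒩_q^-(λ)`: the number of eigenvalues `μ` of `H₋` in `(Λ_{q-1}, Λ_q)` with `Λ_q - μ > λ`,
counted with multiplicities. -/
def Nminus (b : ℝ) (m : Plane → Matrix (Fin 2) (Fin 2) ℂ) (q : ℕ) (lam : ℝ) : ℕ∞ :=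
  eigenCount (Hminus b m) {μ | μ ∈ gapBelow b q ∧ -(μ - level b q) > lam}

/-- The general assumptions on the matrix `m`: it is Hermitian and nonnegative at each point, its
entries are smooth and bounded together with all their derivatives, and they tend to `0` at
infinity. -/
structure Admissible (m : Plane → Matrix (Fin 2) (Fin 2) ℂ) : Prop where
  posSemidef : ∀ x, (m x).PosSemidef
  smooth : ∀ j k, ContDiff ℝ ∞ fun x => m x j k
  bounded : ∀ j k (n : ℕ), ∃ C : ℝ, ∀ x, ‖iteratedFDeriv ℝ n (fun x => m x j k) x‖ ≤ C
  decay : ∀ j k, Tendsto (fun x => m x j k) (cocompact Plane) (𝓝 0)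

/-- `T` is everywhere defined, bounded, self-adjoint and compact. -/
def IsCompactSelfAdjoint (T : L2 →ₗ.[ℂ] L2) : Prop :=
  ∃ S : L2 →L[ℂ] L2, T = ofBounded S ∧ IsSelfAdjoint S ∧ IsCompactOperator S

end Landau

end

/-! Passing to inverses replaces the unbounded operators by bounded ones with a compact
perturbation. Let T = H₀⁻¹ W H_±⁻¹. The resolvent identity reads H₊⁻¹ = H₀⁻¹ - T for the upper sign
and -H₋⁻¹ = -H₀⁻¹ - T for the lower one. In both cases T is compact and nonnegative, and Λ_q² P_q T
P_q is the Toeplitz operator of the theorem, because H₀⁻¹ acts as Λ_q⁻¹ on the range of P_q. The map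
μ ↦ 1/μ, or μ ↦ -1/μ, carries eigenvalues of H_± at distance more than λ from Λ_q to eigenvalues of
A - T in (β, α - s). Here A = ±H₀⁻¹, α = ±Λ_q⁻¹, β is the lower end of a spectral gap of A, and s
behaves like λ/Λ_q².

What remains is an abstract statement (`GapData.specCount_le_upper`, `GapData.specCount_le_lower`):
up to O(1), the eigenvalues of B = A - T in (β, α - s) are counted by those of PTP above (1 ± ε)s.
Both bounds use the form Re⟨(B - β)v, (B - α + s)v⟩. It is negative on the span of the eigenvectors
counted and nonnegative on the orthogonal complement of that span. Up to finitely many dimensions,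
which make T small, it is also nonnegative where PTP is at most (1 - ε)s and negative where PTP
exceeds (1 + ε)s. Subspaces on which the signs are incompatible meet trivially, and this compares
their dimensions.

The analytic input has three sources. The Landau states, built by two commuting oscillators from a
Gaussian, form a Hilbert basis (`eq_zero_of_orthogonal_stN`) and diagonalise H₀. An elliptic
estimate for ∑ Π_j n_{jk} Π_k (`second_order_bound`) bounds W relative to H₀ and, by the method of
continuity, makes 1 ± W H₀⁻¹ invertible, so that H_±⁻¹ = H₀⁻¹ (1 ± W H₀⁻¹)⁻¹. Compactness of H₀⁻¹ W
H₀⁻¹ (`IsCoeff.isCompactOperator_res0_pertS`) follows from the decay of m, since a compactly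
supported weight makes Π_j H₀⁻¹ Hilbert–Schmidt on every Landau level. -/

noncomputable section

namespace Landau

/-! ### Eigenvector spans, dimension comparison and compact operators in a Hilbert space -/

section Abstract

variable {H : Type*} [NormedAddCommGroup H] [InnerProductSpace ℂ H]

lemma re_inner_self (x : H) : (inner ℂ x x).re = ‖x‖ ^ 2 := inner_self_eq_norm_sq (𝕜 := ℂ) x

lemma re_inner_comm (x y : H) : (inner ℂ x y).re = (inner ℂ y x).re := inner_re_symm (𝕜 := ℂ) x y

/-- The span of all eigenvectors of `B` with eigenvalue in `I`. -/
def specSpan (B : H →L[ℂ] H) (I : Set ℝ) : Submodule ℂ H :=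
  ⨆ μ ∈ I, Module.End.eigenspace (B : H →ₗ[ℂ] H) (μ : ℂ)

lemma mem_specSpan {B : H →L[ℂ] H} {I : Set ℝ} {μ : ℝ} (hμ : μ ∈ I) {v : H}
    (hv : B v = (μ : ℂ) • v) : v ∈ specSpan B I := by
  refine Submodule.mem_iSup_of_mem μ (Submodule.mem_iSup_of_mem hμ ?_)
  exact Module.End.mem_eigenspace_iff.2 hv

lemma specSpan_le {B : H →L[ℂ] H} {I : Set ℝ} {U : Submodule ℂ H}
    (h : ∀ μ ∈ I, ∀ v, B v = (μ : ℂ) • v → v ∈ U) : specSpan B I ≤ U := by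
  refine iSup₂_le fun μ hμ v hv => h μ hμ v ?_
  exact Module.End.mem_eigenspace_iff.1 hv

lemma specSpan_mono (B : H →L[ℂ] H) {I J : Set ℝ} (h : I ⊆ J) : specSpan B I ≤ specSpan B J :=
  specSpan_le fun _ hμ _ hv => mem_specSpan (h hμ) hv

lemma map_mem_specSpan {B : H →L[ℂ] H} {I : Set ℝ} {v : H} (hv : v ∈ specSpan B I) :
    B v ∈ specSpan B I := by
  have : specSpan B I ≤ (specSpan B I).comap (B : H →ₗ[ℂ] H) :=
    specSpan_le fun μ hμ v hv => by
      simp only [Submodule.mem_comap, ContinuousLinearMap.coe_coe, hv]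
      exact Submodule.smul_mem _ _ (mem_specSpan hμ hv)
  exact this hv

/-- A quadratic form that is diagonal and positive on the eigenspaces of a symmetric operator
is positive on their span. -/
lemma re_inner_pos_of_mem_specSpan {B C D : H →L[ℂ] H}
    (hB : (B : H →ₗ[ℂ] H).IsSymmetric) {I : Set ℝ} (c d : ℝ → ℝ)
    (hC : ∀ μ v, B v = ((μ : ℝ) : ℂ) • v → C v = (c μ : ℂ) • v)
    (hD : ∀ μ v, B v = ((μ : ℝ) : ℂ) • v → D v = (d μ : ℂ) • v)
    (hpos : ∀ μ ∈ I, 0 < c μ * d μ) {v : H} (hv : v ∈ specSpan B I) (hv0 : v ≠ 0) :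
    0 < (inner ℂ (C v) (D v)).re := by
  have horth := (hB.orthogonalFamily_eigenspaces).comp
    (f := fun μ : I => ((μ : ℝ) : ℂ)) (fun a b h => Subtype.ext (Complex.ofReal_injective h))
  rw [specSpan, iSup_subtype', Submodule.mem_iSup_iff_exists_finsupp] at hv
  obtain ⟨f, hf, rfl⟩ := hv
  have hfB : ∀ i, B (f i) = ((i : ℝ) : ℂ) • f i := fun i =>
    Module.End.mem_eigenspace_iff.1 (hf i)
  have hip : ∀ i j, i ≠ j → inner ℂ (f i) (f j) = 0 := fun i j hij =>
    horth hij ⟨f i, hf i⟩ ⟨f j, hf j⟩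
  have key : inner ℂ (C (f.sum fun _ x => x)) (D (f.sum fun _ x => x)) =
      ∑ i ∈ f.support, ((c i * d i * ‖f i‖ ^ 2 : ℝ) : ℂ) := by
    simp only [Finsupp.sum, map_sum, sum_inner]
    refine Finset.sum_congr rfl fun i hi => ?_
    rw [inner_sum, Finset.sum_eq_single i]
    · rw [hC _ _ (hfB i), hD _ _ (hfB i), inner_smul_left, inner_smul_right,
        inner_self_eq_norm_sq_to_K]
      simp
      ring
    · intro j _ hj
      rw [hC _ _ (hfB i), hD _ _ (hfB j), inner_smul_left, inner_smul_right, hip i j hj.symm]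
      simp
    · intro h; exact absurd hi h
  rw [key, ← Complex.ofReal_sum, Complex.ofReal_re]
  refine Finset.sum_pos (fun i hi => ?_) ?_
  · have := Finsupp.mem_support_iff.1 hi
    have := hpos i i.2
    positivity
  · rw [Finset.nonempty_iff_ne_empty]
    intro h
    apply hv0
    simp [Finsupp.sum, h]

/-- The orthogonal projection onto U is injective on V. If U is infinite-dimensional the projection
need not exist, but then the right-hand side is ⊤. -/
lemma toENat_rank_le_of_inf_orthogonal_eq_bot {V U : Submodule ℂ H}
    (h : ∀ v ∈ V, v ∈ Uᗮ → v = 0) :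
    Cardinal.toENat (Module.rank ℂ V) ≤ Cardinal.toENat (Module.rank ℂ U) := by
  by_cases hU : Module.Finite ℂ U
  · refine OrderHomClass.mono Cardinal.toENat ?_
    have hinj : Function.Injective
        ((U.orthogonalProjectionOnto : H →ₗ[ℂ] U).comp V.subtype) := by
      rw [← LinearMap.ker_eq_bot, LinearMap.ker_eq_bot']
      intro v hv
      have hv' : U.orthogonalProjectionOnto (v : H) = 0 := hv
      rw [Submodule.orthogonalProjectionOnto_eq_zero_iff] at hv'
      exact Subtype.ext (h v v.2 hv')
    exact LinearMap.rank_le_of_injective _ hinj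
  · have : Cardinal.aleph0 ≤ Module.rank ℂ U := by
      rw [← not_lt]
      exact fun h' => hU (Module.rank_lt_aleph0_iff.1 h')
    rw [Cardinal.toENat_eq_top.2 this]
    exact le_top

lemma toENat_rank_sup_le (U F : Submodule ℂ H) [FiniteDimensional ℂ F] :
    Cardinal.toENat (Module.rank ℂ (U ⊔ F : Submodule ℂ H)) ≤
      Cardinal.toENat (Module.rank ℂ U) + (Module.finrank ℂ F : ℕ) := by
  have h1 := Submodule.rank_add_le_rank_add_rank U F
  have h2 := OrderHomClass.mono Cardinal.toENat h1
  rw [map_add] at h2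
  refine h2.trans ?_
  rw [← Module.finrank_eq_rank ℂ F, Cardinal.toENat_nat]

/-- Evaluate the nonnegative form at u - M⁻¹ L u with M = ‖L‖ + 1, where the 1 only keeps M
positive. The consequence is that vectors on which the form almost vanishes are almost in the
kernel. -/
lemma norm_sq_le_of_nonneg_on {L : H →L[ℂ] H} (hL : (L : H →ₗ[ℂ] H).IsSymmetric)
    {X : Submodule ℂ H} (hX : ∀ x ∈ X, L x ∈ X) (hpos : ∀ x ∈ X, 0 ≤ (inner ℂ (L x) x).re)
    {u : H} (hu : u ∈ X) : ‖L u‖ ^ 2 ≤ (‖L‖ + 1) * (inner ℂ (L u) u).re := by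
  set M := ‖L‖ + 1
  have hM : 0 < M := by positivity
  have hLL : (inner ℂ (L (L u)) (L u)).re ≤ M * ‖L u‖ ^ 2 := by
    calc (inner ℂ (L (L u)) (L u)).re ≤ ‖L (L u)‖ * ‖L u‖ := re_inner_le_norm (𝕜 := ℂ) _ _
      _ ≤ (‖L‖ * ‖L u‖) * ‖L u‖ := by gcongr; exact L.le_opNorm _
      _ ≤ M * ‖L u‖ ^ 2 := by
        have : ‖L‖ ≤ M := by simp [M]
        nlinarith [sq_nonneg ‖L u‖]
  have h := hpos (u - ((M⁻¹ : ℝ) : ℂ) • L u)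
    (X.sub_mem hu (X.smul_mem _ (hX _ hu)))
  have hs : inner ℂ (L (L u)) u = inner ℂ (L u) (L u) := hL _ _
  have hself : (inner ℂ (L u) (L u)).re = ‖L u‖ ^ 2 := re_inner_self _
  rw [map_sub, map_smul, inner_sub_left, inner_sub_right, inner_sub_right, inner_smul_left,
    inner_smul_left, inner_smul_right, inner_smul_right, hs, Complex.conj_ofReal] at h
  simp only [Complex.sub_re, Complex.re_ofReal_mul, hself] at h
  have h2 : M⁻¹ * (M⁻¹ * (inner ℂ (L (L u)) (L u)).re) ≤ M⁻¹ * ‖L u‖ ^ 2 := by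
    calc _ ≤ M⁻¹ * (M⁻¹ * (M * ‖L u‖ ^ 2)) := by gcongr
      _ = _ := by field_simp
  have h3 : M⁻¹ * ‖L u‖ ^ 2 ≤ (inner ℂ (L u) u).re := by linarith
  rwa [inv_mul_le_iff₀ hM] at h3

variable [CompleteSpace H]

/-- Take a finite δ-net of the image of the unit ball and let F be the span of its image under T*.
If w ⊥ F, then T w is orthogonal to every net point, yet within δ of one of them, y, so ‖T w‖² = ⟨T
w - y, T w⟩ ≤ δ‖T w‖. -/
lemma isCompactOperator_exists_small {T : H →L[ℂ] H} (hT : IsCompactOperator T) {δ : ℝ}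
    (hδ : 0 < δ) : ∃ F : Submodule ℂ H, FiniteDimensional ℂ F ∧ ∀ w ∈ Fᗮ, ‖T w‖ ≤ δ * ‖w‖ := by
  have hc := hT.isCompact_closure_image_closedBall (𝕜₁ := ℂ) (f := (T : H →ₗ[ℂ] H)) 1
  have htb := hc.totallyBounded.subset subset_closure
  obtain ⟨t, ht, hcov⟩ := Metric.totallyBounded_iff.1 htb δ hδ
  refine ⟨Submodule.span ℂ (T.adjoint '' t), FiniteDimensional.span_of_finite ℂ (ht.image _), ?_⟩
  intro w hw
  have hunit : ∀ w ∈ (Submodule.span ℂ (T.adjoint '' t))ᗮ, ‖w‖ ≤ 1 → ‖T w‖ ≤ δ := by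
    intro w hw hw1
    have hmem : T w ∈ (T : H →ₗ[ℂ] H) '' Metric.closedBall 0 1 := ⟨w, by simpa using hw1, rfl⟩
    have := hcov hmem
    simp only [mem_iUnion, Metric.mem_ball] at this
    obtain ⟨y, hy, hyd⟩ := this
    have h0 : inner ℂ y (T w) = 0 := by
      rw [← ContinuousLinearMap.adjoint_inner_left]
      exact (Submodule.mem_orthogonal _ _).1 hw _ (Submodule.subset_span ⟨y, hy, rfl⟩)
    have h1 : ‖T w‖ ^ 2 ≤ δ * ‖T w‖ := by
      have e : inner ℂ (T w) (T w) = inner ℂ (T w - y) (T w) := by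
        rw [inner_sub_left, h0, sub_zero]
      have h2 : ‖T w‖ ^ 2 = ‖inner ℂ (T w - y) (T w)‖ := by
        rw [← e, inner_self_eq_norm_sq_to_K]
        simp
      rw [h2]
      refine (norm_inner_le_norm _ _).trans ?_
      gcongr
      rw [← dist_eq_norm]
      exact hyd.le
    by_contra! hlt
    nlinarith
  by_cases hw0 : w = 0
  · simp [hw0]
  have hn : 0 < ‖w‖ := norm_pos_iff.2 hw0
  have := hunit (((‖w‖⁻¹ : ℝ) : ℂ) • w) (Submodule.smul_mem _ _ hw) (by
    rw [norm_smul]; simp [hn.ne'])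
  rw [map_smul, norm_smul] at this
  simp only [Complex.norm_real, norm_inv, norm_norm] at this
  rw [inv_mul_le_iff₀ hn] at this
  linarith

/-- T is the norm limit of the finite-rank operators obtained by composing it with the projections
onto the spaces F. -/
lemma IsCompactOperator.of_exists_small {T : H →L[ℂ] H}
    (h : ∀ δ > 0, ∃ F : Submodule ℂ H, FiniteDimensional ℂ F ∧ ∀ w ∈ Fᗮ, ‖T w‖ ≤ δ * ‖w‖) :
    IsCompactOperator T := by
  have hδ : ∀ n : ℕ, (0 : ℝ) < 1 / ((n : ℝ) + 1) := fun n => by positivity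
  choose F hF hsm using fun n : ℕ => h _ (hδ n)
  have hlim : Tendsto (fun n => T ∘L (F n).starProjection) atTop (𝓝 T) := by
    rw [tendsto_iff_norm_sub_tendsto_zero]
    refine squeeze_zero (fun _ => norm_nonneg _) (fun n => ?_)
      (tendsto_one_div_add_atTop_nhds_zero_nat (𝕜 := ℝ))
    refine ContinuousLinearMap.opNorm_le_bound _ (hδ n).le fun x => ?_
    have e : (T ∘L (F n).starProjection - T) x = -T ((F n)ᗮ.starProjection x) := by
      rw [Submodule.starProjection_orthogonal_val]
      simp
    rw [e, norm_neg]
    refine (hsm n _ (Submodule.starProjection_apply_mem _ _)).trans ?_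
    gcongr
    exact Submodule.norm_starProjection_apply_le _ _
  refine isCompactOperator_of_tendsto hlim (Eventually.of_forall fun n => ?_)
  have : IsCompactOperator ((F n).starProjection) := by
    have : ProperSpace (F n) := FiniteDimensional.proper ℂ (F n)
    have h1 : IsCompactOperator ((F n).orthogonalProjectionOnto) :=
      isCompactOperator_of_locallyCompactSpace_dom
        ((F n).orthogonalProjectionOnto : H →L[ℂ] F n)
    exact h1.clm_comp (F n).subtypeL
  exact this.clm_comp T

/-- A symmetric operator that is a nonpositive operator plus a compact one has an eigenvector
with positive eigenvalue in each closed invariant subspace where its form takes a positive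
value. -/
lemma exists_eigenvector_of_pos {K N : H →L[ℂ] H} (hK : (K : H →ₗ[ℂ] H).IsSymmetric)
    (hN : ∀ u, (inner ℂ (N u) u).re ≤ 0) (hc : IsCompactOperator (K - N)) {X : Submodule ℂ H}
    (hXc : IsClosed (X : Set H)) (hX : ∀ x ∈ X, K x ∈ X) {u : H} (hu : u ∈ X)
    (hpos : 0 < (inner ℂ (K u) u).re) :
    ∃ ρ : ℝ, 0 < ρ ∧ ∃ w ∈ X, w ≠ 0 ∧ K w = (ρ : ℂ) • w := by
  -- The eigenvalue is the supremum ρ of the Rayleigh quotient on the unit sphere of X; compactness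
  -- of K - N shows that it is attained.
  set S : Set ℝ := (fun v => (inner ℂ (K v) v).re) '' {v | v ∈ X ∧ ‖v‖ = 1} with hS
  have hu0 : u ≠ 0 := by rintro rfl; simp at hpos
  have hun : 0 < ‖u‖ := norm_pos_iff.2 hu0
  have hscale : ∀ v : H, ∀ r : ℝ, (inner ℂ (K ((r : ℂ) • v)) ((r : ℂ) • v)).re =
      r ^ 2 * (inner ℂ (K v) v).re := by
    intro v r
    rw [map_smul, inner_smul_left, inner_smul_right, Complex.conj_ofReal, Complex.re_ofReal_mul,
      Complex.re_ofReal_mul]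
    ring
  have hnorm : ∀ v : H, v ≠ 0 → ‖((‖v‖⁻¹ : ℝ) : ℂ) • v‖ = 1 := by
    intro v hv
    rw [norm_smul]
    simp [hv]
  have hbdd : BddAbove S := by
    refine ⟨‖K‖, ?_⟩
    rintro _ ⟨v, ⟨_, hv1⟩, rfl⟩
    calc (inner ℂ (K v) v).re ≤ ‖K v‖ * ‖v‖ := re_inner_le_norm (𝕜 := ℂ) _ _
      _ ≤ ‖K‖ := by rw [hv1, mul_one]; simpa [hv1] using K.le_opNorm v
  have huS : ‖u‖⁻¹ ^ 2 * (inner ℂ (K u) u).re ∈ S :=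
    ⟨((‖u‖⁻¹ : ℝ) : ℂ) • u, ⟨X.smul_mem _ hu, hnorm u hu0⟩, hscale u _⟩
  set ρ := sSup S with hρ
  have hρ0 : 0 < ρ := lt_of_lt_of_le (by positivity) (le_csSup hbdd huS)
  obtain ⟨s, -, hslim, hsS⟩ := exists_seq_tendsto_sSup ⟨_, huS⟩ hbdd
  choose v hv hvs using hsS
  have hL : (((ρ : ℂ) • ContinuousLinearMap.id ℂ H - K : H →L[ℂ] H) : H →ₗ[ℂ] H).IsSymmetric := by
    intro x y
    have hxy : inner ℂ (K x) y = inner ℂ x (K y) := hK x y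
    simp [inner_sub_left, inner_sub_right, hxy]
  set L : H →L[ℂ] H := (ρ : ℂ) • ContinuousLinearMap.id ℂ H - K with hLdef
  have hLapp : ∀ x, L x = (ρ : ℂ) • x - K x := fun x => by simp [hLdef]
  have hLin : ∀ x, (inner ℂ (L x) x).re = ρ * ‖x‖ ^ 2 - (inner ℂ (K x) x).re := by
    intro x
    rw [hLapp, inner_sub_left, inner_smul_left, Complex.conj_ofReal, Complex.sub_re,
      Complex.re_ofReal_mul, re_inner_self]
  have hLpos : ∀ x ∈ X, 0 ≤ (inner ℂ (L x) x).re := by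
    intro x hx
    rw [hLin]
    by_cases hx0 : x = 0
    · simp [hx0]
    have hxn : 0 < ‖x‖ := norm_pos_iff.2 hx0
    have : ‖x‖⁻¹ ^ 2 * (inner ℂ (K x) x).re ≤ ρ :=
      le_csSup hbdd ⟨((‖x‖⁻¹ : ℝ) : ℂ) • x, ⟨X.smul_mem _ hx, hnorm x hx0⟩, hscale x _⟩
    rw [inv_pow, inv_mul_le_iff₀ (by positivity)] at this
    linarith
  have hLX : ∀ x ∈ X, L x ∈ X := fun x hx => by
    rw [hLapp]; exact X.sub_mem (X.smul_mem _ hx) (hX _ hx)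
  -- Along a maximising sequence the form of L = ρ - K tends to 0, and L is nonnegative on X, so L
  -- v_n itself tends to 0.
  have hLv : Tendsto (fun n => L (v n)) atTop (𝓝 0) := by
    rw [tendsto_zero_iff_norm_tendsto_zero]
    have h1 : Tendsto (fun n => (‖L‖ + 1) * (ρ - s n)) atTop (𝓝 0) := by
      have := (tendsto_const_nhds (x := ρ)).sub hslim
      rw [sub_self] at this
      simpa using this.const_mul (‖L‖ + 1)
    have h2 : Tendsto (fun n => ‖L (v n)‖ ^ 2) atTop (𝓝 0) := by
      refine squeeze_zero (fun _ => by positivity) (fun n => ?_) h1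
      refine (norm_sq_le_of_nonneg_on hL hLX hLpos (hv n).1).trans (le_of_eq ?_)
      rw [hLin, (hv n).2, ← hvs n]
      ring
    have h3 := h2.sqrt
    simpa [Real.sqrt_sq] using h3
  -- the compact part converges along a subsequence
  have hcomp := hc.isCompact_closure_image_closedBall (𝕜₁ := ℂ) (f := ((K - N : H →L[ℂ] H) : H →ₗ[ℂ] H)) 1
  obtain ⟨y, -, φ, hφ, hy⟩ := hcomp.tendsto_subseq (x := fun n => (K - N) (v n)) (fun n =>
    subset_closure ⟨v n, by simp [(hv n).2], rfl⟩)
  -- ρ - N ≥ ρ > 0 is invertible, and (ρ - N) v_n = L v_n + (K - N) v_n converges along the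
  -- subsequence. Hence v_n converges too.
  have hunit : IsUnit ((ρ : ℂ) • ContinuousLinearMap.id ℂ H - N : H →L[ℂ] H) := by
    refine ContinuousLinearMap.isUnit_of_forall_le_norm_inner_map _ (c := ⟨ρ, hρ0.le⟩)
      (by exact_mod_cast hρ0) fun x => ?_
    refine le_trans ?_ (Complex.re_le_norm _)
    have : ((ρ : ℂ) • ContinuousLinearMap.id ℂ H - N : H →L[ℂ] H) x = (ρ : ℂ) • x - N x := by
      simp
    rw [this, inner_sub_left, inner_smul_left, Complex.conj_ofReal, Complex.sub_re,
      Complex.re_ofReal_mul, re_inner_self]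
    have := hN x
    change ‖x‖ ^ 2 * ρ ≤ _
    linarith
  obtain ⟨E, hE⟩ := hunit
  have hEinv : ∀ x, (↑E⁻¹ : H →L[ℂ] H) ((E : H →L[ℂ] H) x) = x := fun x => by
    rw [← mul_apply_eq_comp, Units.inv_mul, one_apply_eq_self]
  have hvlim : Tendsto (fun n => v (φ n)) atTop (𝓝 ((↑E⁻¹ : H →L[ℂ] H) (0 + y))) := by
    have h1 := (((↑E⁻¹ : H →L[ℂ] H).continuous.tendsto _).comp
      ((hLv.comp hφ.tendsto_atTop).add hy))
    refine h1.congr fun n => ?_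
    simp only [Function.comp]
    rw [← hEinv (v (φ n)), hE, hLapp]
    congr 1
    rw [← hE, hEinv, hE]
    simp
  set w := (↑E⁻¹ : H →L[ℂ] H) (0 + y)
  refine ⟨ρ, hρ0, w, hXc.mem_of_tendsto hvlim (Eventually.of_forall fun n => (hv _).1), ?_, ?_⟩
  · have : ‖w‖ = 1 := tendsto_nhds_unique hvlim.norm (by simp [(hv _).2])
    rintro h
    rw [h] at this
    simp at this
  · have h1 : Tendsto (fun n => L (v (φ n))) atTop (𝓝 (L w)) :=
      (L.continuous.tendsto _).comp hvlim
    have := tendsto_nhds_unique h1 (hLv.comp hφ.tendsto_atTop)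
    rw [hLapp, sub_eq_zero] at this
    exact this.symm

end Abstract

end Landau

end

noncomputable section

namespace Landau

/-! ### The quadratic form of a perturbed operator in a spectral gap -/

section Counting

variable {H : Type*} [NormedAddCommGroup H] [InnerProductSpace ℂ H]

/-- `P` is the orthogonal projection onto `Ker (A - α)`. -/
structure IsSpecProj (A P : H →L[ℂ] H) (α : ℝ) : Prop where
  symm : ∀ u v, inner ℂ (P u) v = inner ℂ u (P v)
  map : ∀ u, A (P u) = (α : ℂ) • P u
  fix : ∀ u, A u = (α : ℂ) • u → P u = u

/-- Form Cauchy–Schwarz inequality in its additive form. -/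
lemma abs_form_le {T : H →L[ℂ] H} (hTs : ∀ u v, inner ℂ (T u) v = inner ℂ u (T v))
    (hT0 : ∀ u, 0 ≤ (inner ℂ (T u) u).re) {η : ℝ} (hη : 0 < η) (u v : H) :
    |(inner ℂ (T u) v).re| ≤
      η * (inner ℂ (T u) u).re + (4 * η)⁻¹ * (inner ℂ (T v) v).re := by
  have key : ∀ r : ℝ, 0 ≤ r ^ 2 * (inner ℂ (T u) u).re + 2 * r * (inner ℂ (T u) v).re
      + (inner ℂ (T v) v).re := by
    intro r
    have h := hT0 ((r : ℂ) • u + v)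
    have e : (inner ℂ (T v) u).re = (inner ℂ (T u) v).re := by
      rw [hTs, re_inner_comm]
    rw [map_add, map_smul, inner_add_left, inner_add_right, inner_add_right, inner_smul_left,
      inner_smul_right, inner_smul_left, inner_smul_right, Complex.conj_ofReal] at h
    simp only [Complex.add_re, Complex.re_ofReal_mul, e] at h
    linarith
  -- The values r = ±2η bound the two signs of the mixed term after division by 4η.
  have h1 := key (2 * η)
  have h2 := key (-(2 * η))
  have h4 : (0 : ℝ) < 4 * η := by positivity
  rw [abs_le]
  constructor <;> rw [← mul_le_mul_iff_right₀ h4] <;> field_simp <;> linarith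

variable {A T P Q : H →L[ℂ] H} {α β γ : ℝ}

/-- The hypotheses on the unperturbed operator `A`, its spectral projections `P`, `Q` at the
ends `β < α` of a spectral gap, and the compact perturbation `T ≥ 0`. -/
structure GapData (A T P Q : H →L[ℂ] H) (α β γ : ℝ) : Prop where
  symmA : ∀ u v, inner ℂ (A u) v = inner ℂ u (A v)
  symmT : ∀ u v, inner ℂ (T u) v = inner ℂ u (T v)
  nonneg : ∀ u, 0 ≤ (inner ℂ (T u) u).re
  compact : IsCompactOperator T
  lt : β < α
  gap_pos : 0 < γ
  projP : IsSpecProj A P α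
  projQ : IsSpecProj A Q β
  gap : ∀ w, P w = 0 → Q w = 0 →
    γ * ‖w‖ ^ 2 ≤ (inner ℂ (A w - (β : ℂ) • w) (A w - (α : ℂ) • w)).re

namespace GapData

variable (h : GapData A T P Q α β γ)
include h

lemma PP (u : H) : P (P u) = P u := h.projP.fix _ (h.projP.map u)

lemma QQ (u : H) : Q (Q u) = Q u := h.projQ.fix _ (h.projQ.map u)

lemma inner_P_Q (u v : H) : inner ℂ (P u) (Q v) = 0 := by
  have h1 := h.symmA (P u) (Q v)
  rw [h.projP.map, h.projQ.map, inner_smul_left, inner_smul_right, Complex.conj_ofReal,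
    ← sub_eq_zero, ← sub_mul] at h1
  rcases mul_eq_zero.1 h1 with h2 | h2
  · rw [sub_eq_zero] at h2
    exact absurd (Complex.ofReal_injective h2) h.lt.ne'
  · exact h2

lemma P_Q (v : H) : P (Q v) = 0 := by
  rw [← inner_self_eq_zero (𝕜 := ℂ), ← h.projP.symm, h.PP, h.inner_P_Q]

lemma Q_P (v : H) : Q (P v) = 0 := by
  rw [← inner_self_eq_zero (𝕜 := ℂ), ← h.projQ.symm, h.QQ, ← inner_conj_symm, h.inner_P_Q,
    map_zero]

/-- The unperturbed quadratic form `⟨(A - β) v, (A - α + s) v⟩` is bounded below. -/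
lemma le_form {s : ℝ} (hs : 0 ≤ s) (v : H) :
    (γ - s * ‖A - (β : ℂ) • ContinuousLinearMap.id ℂ H‖) * ‖v - P v - Q v‖ ^ 2
      + s * (α - β) * ‖P v‖ ^ 2 ≤
    (inner ℂ (A v - (β : ℂ) • v) (A v - (α : ℂ) • v + (s : ℂ) • v)).re := by
  set x := Q v with hx
  set y := P v with hy
  set w := v - y - x with hw
  have hv : v = y + x + w := by rw [hw]; abel
  have hPw : P w = 0 := by
    rw [hw, map_sub, map_sub, hy, hx, h.PP, h.P_Q]; simp
  have hQw : Q w = 0 := by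
    rw [hw, map_sub, map_sub, hy, hx, h.QQ, h.Q_P]; simp
  have hAy : A y = (α : ℂ) • y := h.projP.map v
  have hAx : A x = (β : ℂ) • x := h.projQ.map v
  have hyx : inner ℂ y x = 0 := h.inner_P_Q v v
  have hyw : inner ℂ y w = 0 := by
    rw [hy, h.projP.symm, hPw, inner_zero_right]
  have hxw : inner ℂ x w = 0 := by
    rw [hx, h.projQ.symm, hQw, inner_zero_right]
  have hyAw : inner ℂ y (A w) = 0 := by
    rw [← h.symmA, hAy, inner_smul_left, hyw, mul_zero]
  have hxAw : inner ℂ x (A w) = 0 := by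
    rw [← h.symmA, hAx, inner_smul_left, hxw, mul_zero]
  have hxy : inner ℂ x y = 0 := by rw [← inner_conj_symm, hyx, map_zero]
  have hwx : inner ℂ w x = 0 := by rw [← inner_conj_symm, hxw, map_zero]
  have hwy : inner ℂ w y = 0 := by rw [← inner_conj_symm, hyw, map_zero]
  have hAwx : inner ℂ (A w) x = 0 := by rw [← inner_conj_symm, hxAw, map_zero]
  have hAwy : inner ℂ (A w) y = 0 := by rw [← inner_conj_symm, hyAw, map_zero]
  -- Since A x = β x, this factor has no x component, so the part of v in the range of Q contributes
  -- nothing to the form.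
  have e1 : A v - (β : ℂ) • v = ((α - β : ℝ) : ℂ) • y + (A w - (β : ℂ) • w) := by
    rw [hv, map_add, map_add, hAy, hAx]
    push_cast
    module
  have e2 : A v - (α : ℂ) • v + (s : ℂ) • v =
      (s : ℂ) • y + ((β - α + s : ℝ) : ℂ) • x + ((A w - (α : ℂ) • w) + (s : ℂ) • w) := by
    rw [hv, map_add, map_add, hAy, hAx]
    push_cast
    module
  have hgap := h.gap w hPw hQw
  have hbd : -(‖A - (β : ℂ) • ContinuousLinearMap.id ℂ H‖ * ‖w‖ ^ 2) ≤
      (inner ℂ (A w - (β : ℂ) • w) w).re := by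
    have h1 : ‖A w - (β : ℂ) • w‖ ≤ ‖A - (β : ℂ) • ContinuousLinearMap.id ℂ H‖ * ‖w‖ := by
      simpa using (A - (β : ℂ) • ContinuousLinearMap.id ℂ H).le_opNorm w
    have h2 := (Complex.abs_re_le_norm _).trans
      (norm_inner_le_norm (𝕜 := ℂ) (A w - (β : ℂ) • w) w)
    have h3 := (abs_le.1 h2).1
    have h4 : ‖A w - (β : ℂ) • w‖ * ‖w‖ ≤
        (‖A - (β : ℂ) • ContinuousLinearMap.id ℂ H‖ * ‖w‖) * ‖w‖ := by gcongr
    nlinarith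
  have e3 : inner ℂ (A v - (β : ℂ) • v) (A v - (α : ℂ) • v + (s : ℂ) • v) =
      ((s * (α - β) * ‖y‖ ^ 2 : ℝ) : ℂ) + inner ℂ (A w - (β : ℂ) • w) (A w - (α : ℂ) • w)
        + (s : ℂ) * inner ℂ (A w - (β : ℂ) • w) w := by
    rw [e1, e2]
    simp only [inner_add_left, inner_add_right, inner_sub_left, inner_sub_right, inner_smul_left,
      inner_smul_right, hyx, hyw, hyAw, hwx, hwy, hAwx, hAwy,
      inner_self_eq_norm_sq_to_K, Complex.conj_ofReal]
    push_cast
    simp only [Complex.coe_algebraMap]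
    ring
  rw [e3, Complex.add_re, Complex.add_re, Complex.ofReal_re, Complex.re_ofReal_mul]
  nlinarith

omit h in
/-- The error terms in the expansion of the form of `B = A - T` are absorbed. -/
lemma gap_arith {d ε η γ M M' δ κ s txx tyy tww taa txw tyw tyx tva tvv ww yy tt F : ℝ}
    (hd0 : 0 < d) (hε0 : 0 < ε) (hε1 : ε < 1) (hη0 : 0 < η) (hηd : η * (d + 3) = ε * d / 2)
    (hM'0 : 0 ≤ M') (hκ : κ = d / (2 * η) + 3 * η + 3 + (4 * η)⁻¹ * (M' + 1))
    (hδ : δ = γ / (2 * κ)) (hγ : 0 < γ) (hs0 : 0 < s) (hs1 : s ≤ ε * d / 6)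
    (hs2 : s * M ≤ γ / 4) (hs3 : s ≤ 1)
    (htxx0 : 0 ≤ txx) (htyy0 : 0 ≤ tyy) (htww0 : 0 ≤ tww) (hww : 0 ≤ ww) (hyy : 0 ≤ yy)
    (htt : 0 ≤ tt) (hform : (γ - s * M) * ww + s * d * yy ≤ F)
    (cxw : -(η * txx + (4 * η)⁻¹ * tww) ≤ txw) (cyw : tyw ≤ η * tyy + (4 * η)⁻¹ * tww)
    (cva : tva ≤ η * tvv + (4 * η)⁻¹ * taa) (htvv : tvv ≤ 3 * (txx + tyy + tww))
    (htwwle : tww ≤ δ * ww) (htaale : taa ≤ δ * (M' + 1) * ww)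
    (hvP : tyy ≤ (1 - ε) * s * yy) :
    0 ≤ F - d * (tyy + tyx + tyw) + d * (tyx + txx + txw) - tva - s * tvv + tt := by
  have hκ0 : 0 < κ := by rw [hκ]; positivity
  have herr : (2 * d * (4 * η)⁻¹ + 3 * η + 3) * tww + (4 * η)⁻¹ * taa ≤ γ / 2 * ww := by
    calc _ ≤ (2 * d * (4 * η)⁻¹ + 3 * η + 3) * (δ * ww)
          + (4 * η)⁻¹ * (δ * (M' + 1) * ww) := by gcongr
      _ = κ * δ * ww := by rw [hκ]; field_simp; ring
      _ = γ / 2 * ww := by rw [hδ]; field_simp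
  have hpx : 0 ≤ (d - d * η - 3 * η - 3 * s) * txx := by
    refine mul_nonneg ?_ htxx0
    nlinarith
  -- The bad P-terms have coefficient at most (1 + ε)d, and `hvP` gains a factor 1 - ε; the product
  -- 1 - ε² leaves them below s d‖P v‖².
  have hpy : (d + d * η + 3 * η + 3 * s) * tyy ≤ s * d * yy := by
    have h1 : d + d * η + 3 * η + 3 * s ≤ d + ε * d := by linarith
    calc _ ≤ (d + ε * d) * tyy := by gcongr
      _ ≤ (d + ε * d) * ((1 - ε) * s * yy) := by gcongr
      _ = (1 - ε ^ 2) * (s * d * yy) := by ring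
      _ ≤ 1 * (s * d * yy) := by
        gcongr
        nlinarith
      _ = _ := one_mul _
  have hcva : tva ≤ η * (3 * (txx + tyy + tww)) + (4 * η)⁻¹ * taa :=
    cva.trans (by gcongr)
  have hsv : s * tvv ≤ 3 * s * txx + 3 * s * tyy + 3 * tww := by
    calc _ ≤ s * (3 * (txx + tyy + tww)) := by gcongr
      _ = 3 * s * txx + 3 * s * tyy + 3 * (s * tww) := by ring
      _ ≤ 3 * s * txx + 3 * s * tyy + 3 * (1 * tww) := by gcongr
      _ = _ := by ring
  have hcx := mul_le_mul_of_nonneg_left cxw hd0.le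
  have hcy := mul_le_mul_of_nonneg_left cyw hd0.le
  have hw0 : 0 ≤ (γ / 2 - s * M) * ww := mul_nonneg (by linarith) hww
  linarith

variable [CompleteSpace H]

set_option maxHeartbeats 800000 in
/-- The form `⟨(B - β) v, (B - α + s) v⟩` of `B = A - T` is nonnegative on vectors whose
components are almost annihilated by `T`. -/
lemma form_nonneg {ε : ℝ} (hε0 : 0 < ε) (hε1 : ε < 1) :
    ∃ F : Submodule ℂ H, FiniteDimensional ℂ F ∧ ∃ s₀ > 0, ∀ s ∈ Ioo 0 s₀, ∀ v ∈ Fᗮ,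
      (inner ℂ (T (P v)) (P v)).re ≤ (1 - ε) * s * ‖P v‖ ^ 2 →
      0 ≤ (inner ℂ ((A - T) v - (β : ℂ) • v)
        ((A - T) v - (α : ℂ) • v + (s : ℂ) • v)).re := by
  set d := α - β with hd
  have hd0 : 0 < d := sub_pos.2 h.lt
  set M := ‖A - (β : ℂ) • ContinuousLinearMap.id ℂ H‖ with hM
  -- A' = (A - β) + (A - α) is what pairs with T v, on the component w, when the form is expanded to
  -- first order in T.
  set A' : H →L[ℂ] H := (2 : ℂ) • A - ((α + β : ℝ) : ℂ) • ContinuousLinearMap.id ℂ H with hA'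
  set M' := ‖A'‖ with hM'
  -- With this η the Cauchy–Schwarz errors η(d + 3) take half of the margin εd; the condition s ≤
  -- εd/6 gives the other half to the 3s terms.
  set η := ε * d / (2 * (d + 3)) with hη
  have hη0 : 0 < η := by positivity
  have hηd : η * (d + 3) = ε * d / 2 := by rw [hη]; field_simp
  set s₀ := min (min (ε * d / 6) (γ / (4 * (M + 1)))) 1 with hs₀
  have hs₀0 : 0 < s₀ := by
    have := h.gap_pos
    have : 0 ≤ M := norm_nonneg _
    positivity
  -- κ is the sum of all coefficients of the error terms on w, so δ = γ/(2κ) makes them cost at most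
  -- half of the gap term γ‖w‖².
  set κ := d / (2 * η) + 3 * η + 3 + (4 * η)⁻¹ * (M' + 1) with hκ
  have hM'0 : 0 ≤ M' := norm_nonneg _
  have hκ0 : 0 < κ := by positivity
  set δ := γ / (2 * κ) with hδ
  have hγ := h.gap_pos
  have hδ0 : 0 < δ := by positivity
  obtain ⟨F₁, hF₁, hF₁s⟩ := isCompactOperator_exists_small h.compact hδ0
  obtain ⟨F₂, hF₂, hF₂s⟩ := isCompactOperator_exists_small (T := T ∘L A')
    (h.compact.comp_clm A') hδ0
  let R : H →L[ℂ] H := ContinuousLinearMap.id ℂ H - P - Q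
  -- R = 1 - P - Q is symmetric, so v ⊥ R(F₁ ⊔ F₂) says exactly that w = R v is orthogonal to F₁ and
  -- F₂.
  refine ⟨(F₁ ⊔ F₂).map (R : H →ₗ[ℂ] H), inferInstance, s₀, hs₀0, ?_⟩
  rintro s ⟨hs0, hss⟩ v hv hvP
  set x := Q v with hx
  set y := P v with hy
  set w := v - y - x with hw
  have hRw : R v = w := by simp [R, hw, hx, hy]
  have hwF : w ∈ (F₁ ⊔ F₂)ᗮ := by
    rw [Submodule.mem_orthogonal] at hv ⊢
    intro z hz
    have h1 := hv (R z) ⟨z, hz, rfl⟩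
    rw [← hRw]
    have h2 : inner ℂ (R z) v = inner ℂ z (R v) := by
      simp [R, h.projP.symm, h.projQ.symm]
    rw [← h2, h1]
  have hw1 : ‖T w‖ ≤ δ * ‖w‖ := hF₁s w (Submodule.orthogonal_le le_sup_left hwF)
  have hw2 : ‖T (A' w)‖ ≤ δ * ‖w‖ := hF₂s w (Submodule.orthogonal_le le_sup_right hwF)
  have hA'w : A' w = (A w - (β : ℂ) • w) + (A w - (α : ℂ) • w) := by
    simp only [hA', sub_apply, smul_apply,
      ContinuousLinearMap.id_apply]
    push_cast
    module
  have hvs : v = y + x + w := by rw [hw]; abel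
  have hAy : A y = (α : ℂ) • y := h.projP.map v
  have hAx : A x = (β : ℂ) • x := h.projQ.map v
  have hform := h.le_form hs0.le v
  have hTsymm : ∀ u v, (inner ℂ (T u) v).re = (inner ℂ (T v) u).re := fun u v => by
    rw [h.symmT, re_inner_comm]
  -- expansion of the form
  have e1 : A v - (β : ℂ) • v = (d : ℂ) • y + (A w - (β : ℂ) • w) := by
    rw [hvs, map_add, map_add, hAy, hAx, hd]
    push_cast
    module
  have e2 : A v - (α : ℂ) • v = -((d : ℂ) • x) + (A w - (α : ℂ) • w) := by
    rw [hvs, map_add, map_add, hAy, hAx, hd]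
    push_cast
    module
  -- Of the two terms with factor d, the one on y yields the loss d⟨T y, y⟩, paid for by the
  -- hypothesis on P v, and the one on x yields a gain d⟨T x, x⟩. Their mixed terms ⟨T y, x⟩ cancel.
  have hexp : (inner ℂ ((A - T) v - (β : ℂ) • v)
      ((A - T) v - (α : ℂ) • v + (s : ℂ) • v)).re =
      (inner ℂ (A v - (β : ℂ) • v) (A v - (α : ℂ) • v + (s : ℂ) • v)).re
      - d * (inner ℂ (T v) y).re + d * (inner ℂ (T v) x).re - (inner ℂ (T v) (A' w)).re
      - s * (inner ℂ (T v) v).re + ‖T v‖ ^ 2 := by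
    have r1 : (A - T) v - (β : ℂ) • v = (A v - (β : ℂ) • v) - T v := by
      rw [sub_apply]; abel
    have r2 : (A - T) v - (α : ℂ) • v + (s : ℂ) • v =
        (A v - (α : ℂ) • v + (s : ℂ) • v) - T v := by
      rw [sub_apply]; abel
    have r3 : (inner ℂ (A v - (β : ℂ) • v) (T v)).re =
        d * (inner ℂ (T v) y).re + (inner ℂ (T v) (A w - (β : ℂ) • w)).re := by
      rw [re_inner_comm, e1, inner_add_right, inner_smul_right, Complex.add_re,
        Complex.re_ofReal_mul]
    have r4 : (inner ℂ (T v) (A v - (α : ℂ) • v + (s : ℂ) • v)).re =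
        -(d * (inner ℂ (T v) x).re) + (inner ℂ (T v) (A w - (α : ℂ) • w)).re
          + s * (inner ℂ (T v) v).re := by
      rw [inner_add_right, e2, inner_add_right, inner_neg_right, inner_smul_right,
        inner_smul_right, Complex.add_re, Complex.add_re, Complex.neg_re,
        Complex.re_ofReal_mul, Complex.re_ofReal_mul]
    have r5 : (inner ℂ (T v) (A' w)).re = (inner ℂ (T v) (A w - (β : ℂ) • w)).re
        + (inner ℂ (T v) (A w - (α : ℂ) • w)).re := by
      rw [hA'w, inner_add_right, Complex.add_re]
    rw [r1, r2, inner_sub_left, inner_sub_right, inner_sub_right, Complex.sub_re, Complex.sub_re,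
      Complex.sub_re, r3, r4, re_inner_self, r5]
    ring
  set txx := (inner ℂ (T x) x).re with htxx
  set tyy := (inner ℂ (T y) y).re with htyy
  set tww := (inner ℂ (T w) w).re with htww
  set taa := (inner ℂ (T (A' w)) (A' w)).re with htaa
  have htxx0 : 0 ≤ txx := h.nonneg x
  have htyy0 : 0 ≤ tyy := h.nonneg y
  have htvx : (inner ℂ (T v) x).re = (inner ℂ (T y) x).re + txx + (inner ℂ (T x) w).re := by
    rw [hvs, map_add, map_add, inner_add_left, inner_add_left, Complex.add_re, Complex.add_re,
      hTsymm w x]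
  have htvy : (inner ℂ (T v) y).re = tyy + (inner ℂ (T y) x).re + (inner ℂ (T y) w).re := by
    rw [hvs, map_add, map_add, inner_add_left, inner_add_left, Complex.add_re, Complex.add_re,
      hTsymm w y, hTsymm x y]
  have cxw := (abs_le.1 (abs_form_le h.symmT h.nonneg hη0 x w)).1
  have cyw := (abs_le.1 (abs_form_le h.symmT h.nonneg hη0 y w)).2
  have cva := (abs_le.1 (abs_form_le h.symmT h.nonneg hη0 v (A' w))).2
  have htvv : (inner ℂ (T v) v).re ≤ 3 * (txx + tyy + tww) := by
    have c1 := (abs_le.1 (abs_form_le h.symmT h.nonneg (by norm_num : (0:ℝ) < 1 / 2) x w)).2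
    have c2 := (abs_le.1 (abs_form_le h.symmT h.nonneg (by norm_num : (0:ℝ) < 1 / 2) y w)).2
    have c3 := (abs_le.1 (abs_form_le h.symmT h.nonneg (by norm_num : (0:ℝ) < 1 / 2) y x)).2
    have e : (inner ℂ (T v) v).re = txx + tyy + tww + 2 * (inner ℂ (T y) x).re
        + 2 * (inner ℂ (T x) w).re + 2 * (inner ℂ (T y) w).re := by
      have : (inner ℂ (T v) v).re =
          (inner ℂ (T v) y).re + (inner ℂ (T v) x).re + (inner ℂ (T v) w).re := by
        conv_lhs => rw [show inner ℂ (T v) v = inner ℂ (T v) (y + x + w) by rw [← hvs]]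
        rw [inner_add_right, inner_add_right, Complex.add_re, Complex.add_re]
      rw [this, htvx, htvy]
      conv_lhs => rw [hvs, map_add, map_add, inner_add_left, inner_add_left, Complex.add_re,
        Complex.add_re]
      ring
    rw [e]
    norm_num at c1 c2 c3
    linarith
  have htwwle : tww ≤ δ * ‖w‖ ^ 2 := by
    calc tww ≤ ‖T w‖ * ‖w‖ := re_inner_le_norm (𝕜 := ℂ) _ _
      _ ≤ (δ * ‖w‖) * ‖w‖ := by gcongr
      _ = _ := by ring
  have htaale : taa ≤ δ * (M' + 1) * ‖w‖ ^ 2 := by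
    calc taa ≤ ‖T (A' w)‖ * ‖A' w‖ := re_inner_le_norm (𝕜 := ℂ) _ _
      _ ≤ (δ * ‖w‖) * (M' * ‖w‖) := by gcongr; exact A'.le_opNorm w
      _ = δ * M' * ‖w‖ ^ 2 := by ring
      _ ≤ δ * (M' + 1) * ‖w‖ ^ 2 := by gcongr; exact le_add_of_nonneg_right zero_le_one
  have hs1 : s ≤ ε * d / 6 := (hss.le.trans (min_le_left _ _)).trans (min_le_left _ _)
  have hs2 : s * M ≤ γ / 4 := by
    have h1 : s ≤ γ / (4 * (M + 1)) := (hss.le.trans (min_le_left _ _)).trans (min_le_right _ _)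
    have hM0 : 0 ≤ M := norm_nonneg _
    calc s * M ≤ γ / (4 * (M + 1)) * (M + 1) :=
          mul_le_mul h1 (le_add_of_nonneg_right zero_le_one) hM0 (by positivity)
      _ = γ / 4 := by field_simp
  have hs3 : s ≤ 1 := hss.le.trans (min_le_right _ _)
  rw [hexp, htvx, htvy]
  exact gap_arith hd0 hε0 hε1 hη0 hηd hM'0 hκ hδ hγ hs0 hs1 hs2 hs3 htxx0 htyy0 (h.nonneg w)
    (sq_nonneg _) (sq_nonneg _) (sq_nonneg _) hform cxw cyw cva htvv htwwle htaale hvP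

end GapData

end Counting

end Landau

end

noncomputable section

namespace Landau

/-! ### The abstract counting estimates -/

section Counting

variable {H : Type*} [NormedAddCommGroup H] [InnerProductSpace ℂ H] [CompleteSpace H]
  {A T P Q : H →L[ℂ] H} {α β γ : ℝ}

/-- The number of eigenvalues of `B` in `I`, counted with multiplicities. -/
def specCount (B : H →L[ℂ] H) (I : Set ℝ) : ℕ∞ :=
  Cardinal.toENat (Module.rank ℂ (specSpan B I))

omit [CompleteSpace H] in
lemma specCount_mono (B : H →L[ℂ] H) {I J : Set ℝ} (h : I ⊆ J) :
    specCount B I ≤ specCount B J :=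
  OrderHomClass.mono Cardinal.toENat (Submodule.rank_mono (specSpan_mono B h))

omit [CompleteSpace H] in
-- The finite-dimensional space F is the source of every O(1) in the theorem.
lemma specCount_le_add {B B' : H →L[ℂ] H} {I J : Set ℝ} {F : Submodule ℂ H}
    [FiniteDimensional ℂ F]
    (h : ∀ v ∈ specSpan B I, v ∈ (specSpan B' J)ᗮ → v ∈ Fᗮ → v = 0) :
    specCount B I ≤ specCount B' J + (Module.finrank ℂ F : ℕ) := by
  refine (toENat_rank_le_of_inf_orthogonal_eq_bot fun v hv hvo => ?_).trans
    (toENat_rank_sup_le _ F)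
  exact h v hv (Submodule.orthogonal_le le_sup_left hvo)
    (Submodule.orthogonal_le le_sup_right hvo)

/-- On the orthogonal complement of the eigenvectors with eigenvalues above `t > 0`, a compact
symmetric operator is at most `t`. -/
lemma re_inner_le_of_mem_orthogonal {S : H →L[ℂ] H}
    (hS : ∀ u v, inner ℂ (S u) v = inner ℂ u (S v)) (hc : IsCompactOperator S) {t : ℝ}
    (ht : 0 ≤ t) {u : H} (hu : u ∈ (specSpan S (Ioi t))ᗮ) :
    (inner ℂ (S u) u).re ≤ t * ‖u‖ ^ 2 := by
  by_contra! hlt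
  set N : H →L[ℂ] H := -((t : ℂ) • ContinuousLinearMap.id ℂ H) with hN
  have hNapp : ∀ v, N v = -((t : ℂ) • v) := fun v => by simp [hN]
  have hNin : ∀ v, (inner ℂ (N v) v).re = -(t * ‖v‖ ^ 2) := fun v => by
    rw [hNapp, inner_neg_left, inner_smul_left, Complex.conj_ofReal, Complex.neg_re,
      Complex.re_ofReal_mul, re_inner_self]
  -- S - t is the nonpositive operator -t plus a compact one. A positive value of its form on the
  -- complement gives there an eigenvector of S with eigenvalue ρ + t > t, which is orthogonal to
  -- itself.
  obtain ⟨ρ, hρ, w, hw, hw0, hKw⟩ := exists_eigenvector_of_pos (K := S + N) (N := N)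
    (X := (specSpan S (Ioi t))ᗮ) (u := u)
    (by
      intro x y
      change inner ℂ (S x + N x) y = inner ℂ x (S y + N y)
      rw [inner_add_left, inner_add_right, hS, hNapp, hNapp, inner_neg_left, inner_neg_right,
        inner_smul_left, inner_smul_right, Complex.conj_ofReal])
    (fun v => by
      rw [hNin]
      have := mul_nonneg ht (sq_nonneg ‖v‖)
      linarith)
    (by rwa [add_sub_cancel_right]) (Submodule.isClosed_orthogonal _)
    (by
      intro x hx
      change S x + N x ∈ _
      rw [hNapp]
      refine Submodule.add_mem _ ?_ (Submodule.neg_mem _ (Submodule.smul_mem _ _ hx))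
      rw [Submodule.mem_orthogonal] at hx ⊢
      intro z hz
      rw [← hS]
      exact hx _ (map_mem_specSpan hz))
    hu
    (by
      change 0 < (inner ℂ (S u + N u) u).re
      rw [inner_add_left, Complex.add_re, hNin]
      linarith)
  have hSw : S w = ((ρ + t : ℝ) : ℂ) • w := by
    have : S w + N w = (ρ : ℂ) • w := hKw
    rw [hNapp] at this
    push_cast
    rw [add_smul, ← this]
    abel
  have hmem : w ∈ specSpan S (Ioi t) := mem_specSpan (by simpa using hρ) hSw
  exact hw0 (inner_self_eq_zero.1 ((Submodule.mem_orthogonal _ _).1 hw w hmem))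

namespace GapData

variable (h : GapData A T P Q α β γ)
include h

omit [CompleteSpace H] in
lemma symm_B (u v : H) : inner ℂ ((A - T) u) v = inner ℂ u ((A - T) v) := by
  simp [h.symmA, h.symmT]

omit [CompleteSpace H] in
lemma symm_PTP (u v : H) : inner ℂ ((P ∘L T ∘L P) u) v = inner ℂ u ((P ∘L T ∘L P) v) := by
  simp [h.projP.symm, h.symmT]

omit [CompleteSpace H] in
lemma compact_PTP : IsCompactOperator (P ∘L T ∘L P) :=
  (h.compact.comp_clm P).clm_comp P

omit [CompleteSpace H] in
-- Eigenvectors of PTP with nonzero eigenvalue lie in the range of P; t ≥ 0 excludes the eigenvalue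
-- 0.
lemma P_of_mem_specSpan {t : ℝ} (ht : 0 ≤ t) {z : H}
    (hz : z ∈ specSpan (P ∘L T ∘L P) (Ioi t)) : P z = z := by
  have : specSpan (P ∘L T ∘L P) (Ioi t) ≤
      LinearMap.ker ((P : H →ₗ[ℂ] H) - LinearMap.id) := by
    refine specSpan_le fun μ hμ v hv => ?_
    have hμ0 : (μ : ℂ) ≠ 0 := by
      have : 0 < μ := ht.trans_lt hμ
      exact_mod_cast this.ne'
    rw [LinearMap.mem_ker]
    simp only [LinearMap.sub_apply, LinearMap.id_apply, ContinuousLinearMap.coe_coe]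
    have e : v = (μ : ℂ)⁻¹ • P (T (P v)) := by
      rw [eq_inv_smul_iff₀ hμ0]; exact hv.symm
    rw [e, map_smul, h.PP, sub_self]
  have := this hz
  rw [LinearMap.mem_ker] at this
  simpa [sub_eq_zero] using this

/-- A vector of the counted span that is orthogonal to F and to the high eigenvectors of PTP has P v
in the region where PTP ≤ (1 - ε)s. There `form_nonneg` makes the form nonnegative, while it is
negative on nonzero vectors of the counted span. -/
theorem specCount_le_upper {ε : ℝ} (hε0 : 0 < ε) (hε1 : ε < 1) :
    ∃ C : ℕ, ∃ s₀ > 0, ∀ s ∈ Ioo 0 s₀,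
      specCount (A - T) (Ioo β (α - s)) ≤
        specCount (P ∘L T ∘L P) (Ioi ((1 - ε) * s)) + C := by
  obtain ⟨F, hF, s₀, hs₀, hform⟩ := h.form_nonneg hε0 hε1
  refine ⟨Module.finrank ℂ F, s₀, hs₀, fun s hs => specCount_le_add (F := F) ?_⟩
  intro v hv hvS hvF
  by_contra hv0
  have ht : 0 ≤ (1 - ε) * s := mul_nonneg (by linarith) hs.1.le
  have hPv : P v ∈ (specSpan (P ∘L T ∘L P) (Ioi ((1 - ε) * s)))ᗮ := by
    rw [Submodule.mem_orthogonal] at hvS ⊢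
    intro z hz
    rw [← h.projP.symm, h.P_of_mem_specSpan ht hz]
    exact hvS z hz
  have hle := re_inner_le_of_mem_orthogonal h.symm_PTP h.compact_PTP ht hPv
  have e : inner ℂ ((P ∘L T ∘L P) (P v)) (P v) = inner ℂ (T (P v)) (P v) := by
    simp only [ContinuousLinearMap.comp_apply, h.PP, h.projP.symm]
  rw [e] at hle
  have h1 := hform s hs v hvF hle
  have h2 := re_inner_pos_of_mem_specSpan (B := A - T)
    (C := (β : ℂ) • ContinuousLinearMap.id ℂ H - (A - T))
    (D := (A - T) - ((α - s : ℝ) : ℂ) • ContinuousLinearMap.id ℂ H) (fun u v => h.symm_B u v)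
    (I := Ioo β (α - s)) (fun μ => β - μ) (fun μ => μ - (α - s))
    (fun μ v hv => by
      rw [sub_apply, hv]
      simp [sub_smul])
    (fun μ v hv => by
      rw [sub_apply, hv]
      simp [sub_smul])
    (fun μ hμ => mul_pos_of_neg_of_neg (by linarith [hμ.1]) (by linarith [hμ.2])) hv hv0
  have e1 : ((β : ℂ) • ContinuousLinearMap.id ℂ H - (A - T)) v =
      -((A - T) v - (β : ℂ) • v) := by simp
  have e2 : ((A - T) - ((α - s : ℝ) : ℂ) • ContinuousLinearMap.id ℂ H) v =
      (A - T) v - (α : ℂ) • v + (s : ℂ) • v := by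
    rw [sub_apply, smul_apply,
      ContinuousLinearMap.id_apply]
    push_cast
    module
  rw [e1, e2, inner_neg_left, Complex.neg_re] at h2
  linarith

/-- The form of `(B - β) (B - α + s)`, `B = A - T`, is nonnegative on vectors orthogonal to all
eigenvectors of `B` with eigenvalue in `(β, α - s)`. -/
lemma form_nonneg_of_mem_orthogonal {s : ℝ} (hs0 : 0 < s) (hsd : s < α - β)
    (hs : s * ‖A - (β : ℂ) • ContinuousLinearMap.id ℂ H‖ ≤ γ) {y : H}
    (hy : y ∈ (specSpan (A - T) (Ioo β (α - s)))ᗮ) :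
    0 ≤ (inner ℂ ((A - T) y - (β : ℂ) • y)
        ((A - T) y - (α : ℂ) • y + (s : ℂ) • y)).re := by
  by_contra! hlt
  set B := A - T with hB
  have hBs : ∀ u v, inner ℂ (B u) v = inner ℂ u (B v) := h.symm_B
  set I := ContinuousLinearMap.id ℂ H
  set X := (specSpan B (Ioo β (α - s)))ᗮ with hX
  have hBX : ∀ x ∈ X, B x ∈ X := by
    intro x hx
    rw [hX, Submodule.mem_orthogonal] at hx ⊢
    intro z hz
    rw [← hBs]
    exact hx _ (map_mem_specSpan hz)
  -- qf Z = -(Z - α + s)(Z - β). By `le_form` qf A ≤ 0, and qf B - qf A is compact, so a negative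
  -- value of the form on X produces an eigenvector of qf B in X with eigenvalue ρ > 0.
  let qf : (H →L[ℂ] H) → H →L[ℂ] H := fun Z =>
    -((Z - ((α - s : ℝ) : ℂ) • I) ∘L (Z - (β : ℂ) • I))
  have hqf : ∀ Z : H →L[ℂ] H, (∀ u v, inner ℂ (Z u) v = inner ℂ u (Z v)) → ∀ u v,
      inner ℂ (qf Z u) v =
        -inner ℂ (Z u - (β : ℂ) • u) (Z v - (α : ℂ) • v + (s : ℂ) • v) := by
    intro Z hZ u v
    have e : qf Z u = -(Z (Z u - (β : ℂ) • u) - ((α - s : ℝ) : ℂ) • (Z u - (β : ℂ) • u)) := rfl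
    have e' : Z v - (α : ℂ) • v + (s : ℂ) • v = Z v - ((α - s : ℝ) : ℂ) • v := by
      push_cast; module
    rw [e, inner_neg_left, inner_sub_left, hZ, inner_smul_left, Complex.conj_ofReal, e',
      inner_sub_right (_ - _), inner_smul_right]
  have hqfs : ∀ u v, inner ℂ (qf B u) v = inner ℂ u (qf B v) := by
    intro u v
    have e1 : ∀ v, B v - (α : ℂ) • v + (s : ℂ) • v = B v - ((α - s : ℝ) : ℂ) • v := fun v => by
      push_cast; module
    rw [hqf B hBs, ← inner_conj_symm u, hqf B hBs, e1, e1, map_neg, inner_conj_symm]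
    congr 1
    simp only [inner_sub_left, inner_sub_right, inner_smul_left, inner_smul_right,
      Complex.conj_ofReal, hBs]
    ring
  have hKcomp : IsCompactOperator (qf B - qf A) := by
    have e : qf B - qf A = T ∘L (A - (β : ℂ) • I) + (B - ((α - s : ℝ) : ℂ) • I) ∘L T := by
      ext1 u
      change -((A - T) ((A - T) u - (β : ℂ) • u) - ((α - s : ℝ) : ℂ) • ((A - T) u - (β : ℂ) • u))
        - -(A (A u - (β : ℂ) • u) - ((α - s : ℝ) : ℂ) • (A u - (β : ℂ) • u)) =
        T (A u - (β : ℂ) • u) + ((A - T) (T u) - ((α - s : ℝ) : ℂ) • T u)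
      simp only [sub_apply, map_sub, map_smul]
      module
    rw [e]
    have h2 : IsCompactOperator ((B - ((α - s : ℝ) : ℂ) • I) ∘L T) :=
      h.compact.clm_comp (B - ((α - s : ℝ) : ℂ) • I)
    exact (h.compact.comp_clm (A - (β : ℂ) • I)).add h2
  obtain ⟨ρ, hρ, w, hw, hw0, hKw⟩ := exists_eigenvector_of_pos (K := qf B) (N := qf A)
    (X := X) (u := y) hqfs
    (fun v => by
      rw [hqf A h.symmA, Complex.neg_re]
      have h1 := h.le_form hs0.le v
      have h2 : 0 ≤ (γ - s * ‖A - (β : ℂ) • I‖) * ‖v - P v - Q v‖ ^ 2 :=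
        mul_nonneg (by linarith) (sq_nonneg _)
      have h3 : 0 ≤ s * (α - β) * ‖P v‖ ^ 2 :=
        mul_nonneg (mul_nonneg hs0.le (sub_nonneg.2 h.lt.le)) (sq_nonneg _)
      linarith)
    hKcomp (Submodule.isClosed_orthogonal _)
    (by
      intro x hx
      have e : qf B x = -(B (B x - (β : ℂ) • x) - ((α - s : ℝ) : ℂ) • (B x - (β : ℂ) • x)) := rfl
      rw [e]
      have h1 : B x - (β : ℂ) • x ∈ X := X.sub_mem (hBX x hx) (X.smul_mem _ hx)
      exact X.neg_mem (X.sub_mem (hBX _ h1) (X.smul_mem _ h1)))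
    hy (by rw [hqf B hBs, Complex.neg_re]; linarith)
  -- factor the quadratic polynomial
  set c := (β + (α - s)) / 2 with hc
  set r := ((α - s) - β) / 2 with hr
  have hBw : B (B w) - (2 * c : ℂ) • B w + (c ^ 2 : ℂ) • w = ((r ^ 2 - ρ : ℝ) : ℂ) • w := by
    have e : qf B w = -(B (B w) - (β : ℂ) • B w - (((α - s : ℝ) : ℂ) • B w
        - ((α - s : ℝ) : ℂ) • (β : ℂ) • w)) := by
      change -(B (B w - (β : ℂ) • w) - ((α - s : ℝ) : ℂ) • (B w - (β : ℂ) • w)) = _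
      rw [map_sub, map_smul, smul_sub]
    rw [e] at hKw
    have h1 : B (B w) = (β : ℂ) • B w + (((α - s : ℝ) : ℂ) • B w
        - ((α - s : ℝ) : ℂ) • (β : ℂ) • w) - (ρ : ℂ) • w := by
      rw [← hKw]; abel
    rw [h1, hc, hr]
    push_cast
    module
  -- With c the midpoint and r the half-length of (β, α - s), the equation reads (B - c)² w = (r² -
  -- ρ) w, and B - c is symmetric.
  have hsq : 0 ≤ r ^ 2 - ρ := by
    have h1 : inner ℂ (B w - (c : ℂ) • w) (B w - (c : ℂ) • w) =
        ((r ^ 2 - ρ : ℝ) : ℂ) * inner ℂ w w := by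
      rw [← Complex.conj_ofReal (r ^ 2 - ρ), ← inner_smul_left, ← hBw]
      simp only [inner_sub_left, inner_sub_right, inner_smul_left, inner_smul_right,
        inner_add_left, hBs, map_mul, map_pow, Complex.conj_ofReal, map_ofNat]
      ring
    have h2 := congrArg Complex.re h1
    rw [re_inner_self, Complex.re_ofReal_mul, re_inner_self] at h2
    have h3 : 0 < ‖w‖ ^ 2 := by have := norm_pos_iff.2 hw0; positivity
    by_contra! h4
    nlinarith [sq_nonneg ‖B w - (c : ℂ) • w‖]
  set σ := √(r ^ 2 - ρ) with hσ
  have hσ2 : σ ^ 2 = r ^ 2 - ρ := Real.sq_sqrt hsq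
  have hσ0 : 0 ≤ σ := Real.sqrt_nonneg _
  have hXeq : ∀ z ∈ X, ∀ μ ∈ Ioo β (α - s), B z = ((μ : ℝ) : ℂ) • z → z = 0 := by
    intro z hz μ hμ hBz
    exact inner_self_eq_zero.1 ((Submodule.mem_orthogonal _ _).1 hz z (mem_specSpan hμ hBz))
  have hrpos : 0 < r := by rw [hr]; linarith
  have hσr : σ < r := by nlinarith
  -- (B - c - σ)(B - c + σ) w = 0 with 0 ≤ σ < r, so c ± σ both lie in the interval, where B has no
  -- eigenvectors in X. The two factors are removed one after the other, and w = 0 results.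
  have hw' : B w + ((σ - c : ℝ) : ℂ) • w = 0 := by
    refine hXeq _ (X.add_mem (hBX _ hw) (X.smul_mem _ hw)) (c + σ) ⟨by linarith, by linarith⟩ ?_
    rw [map_add, map_smul]
    have h1 : B (B w) = (2 * c : ℂ) • B w - (c ^ 2 : ℂ) • w + ((σ ^ 2 : ℝ) : ℂ) • w := by
      rw [hσ2, ← hBw]; abel
    rw [h1]
    push_cast
    module
  refine hw0 (hXeq w hw (c - σ) ⟨by linarith, by linarith⟩ ?_)
  rw [eq_neg_of_add_eq_zero_left hw', ← neg_smul]
  push_cast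
  congr 1
  ring

/-- For y in the high spectral span of PTP, A y = αy and, with d = α - β, the form equals d s‖y‖² -
(d + s)⟨T y, y⟩ + ‖T y‖². Since ⟨T y, y⟩ > (1 + ε)s‖y‖² and ‖T y‖² ≤ (εd/2)⟨T y, y⟩ up to finitely
many dimensions, it is negative. This is impossible if y is orthogonal to all eigenvectors of A - T
counted. -/
theorem specCount_le_lower {ε : ℝ} (hε0 : 0 < ε) (hε1 : ε < 1) :
    ∃ C : ℕ, ∃ s₀ > 0, ∀ s ∈ Ioo 0 s₀,
      specCount (P ∘L T ∘L P) (Ioi ((1 + ε) * s)) ≤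
        specCount (A - T) (Ioo β (α - s)) + C := by
  have hd0 : 0 < α - β := sub_pos.2 h.lt
  set δ := ε * (α - β) / 2 with hδ
  have hδ0 : 0 < δ := by positivity
  obtain ⟨F, hF, hFs⟩ := isCompactOperator_exists_small h.compact hδ0
  have hγ := h.gap_pos
  set M := ‖A - (β : ℂ) • ContinuousLinearMap.id ℂ H‖ with hM
  have hM0 : 0 ≤ M := norm_nonneg _
  -- By symmetry of T, y ⊥ T(F) means T y ⊥ F. It is T y, not y, on which T has to be small.
  refine ⟨Module.finrank ℂ (F.map (T : H →ₗ[ℂ] H)), min (γ / (M + 1)) (α - β), by positivity,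
    fun s hs => specCount_le_add (F := F.map (T : H →ₗ[ℂ] H)) ?_⟩
  intro y hy hyB hyF
  by_contra hy0
  have hs0 := hs.1
  have hsM : s * M ≤ γ := by
    have h1 := hs.2.le.trans (min_le_left _ _)
    rw [le_div_iff₀ (by positivity)] at h1
    nlinarith
  have ht : 0 ≤ (1 + ε) * s := mul_nonneg (by linarith) hs0.le
  have hPy := h.P_of_mem_specSpan ht hy
  have hAy : A y = (α : ℂ) • y := by rw [← hPy]; exact h.projP.map y
  have hlow : (1 + ε) * s * ‖y‖ ^ 2 < (inner ℂ (T y) y).re := by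
    have h2 := re_inner_pos_of_mem_specSpan (B := P ∘L T ∘L P)
      (C := P ∘L T ∘L P - (((1 + ε) * s : ℝ) : ℂ) • ContinuousLinearMap.id ℂ H)
      (D := ContinuousLinearMap.id ℂ H) (fun u v => h.symm_PTP u v)
      (I := Ioi ((1 + ε) * s)) (fun μ => μ - (1 + ε) * s) (fun _ => 1)
      (fun μ v hv => by
        rw [sub_apply, hv]
        simp [sub_smul])
      (fun μ v hv => by simp)
      (fun μ hμ => by simpa using hμ) hy hy0
    rw [sub_apply, inner_sub_left, Complex.sub_re,
      smul_apply, ContinuousLinearMap.id_apply, inner_smul_left,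
      Complex.conj_ofReal, Complex.re_ofReal_mul, re_inner_self] at h2
    simp only [ContinuousLinearMap.comp_apply, hPy, h.projP.symm] at h2
    linarith
  have hTy : T y ∈ Fᗮ := by
    rw [Submodule.mem_orthogonal] at hyF ⊢
    intro z hz
    rw [← h.symmT]
    exact hyF _ ⟨z, hz, rfl⟩
  have hTT : ‖T y‖ ^ 2 ≤ δ * (inner ℂ (T y) y).re := by
    have h1 := (abs_le.1 (abs_form_le h.symmT h.nonneg (by positivity : 0 < δ / 2) y (T y))).2
    have h2 : (inner ℂ (T (T y)) (T y)).re ≤ δ * ‖T y‖ ^ 2 := by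
      calc _ ≤ ‖T (T y)‖ * ‖T y‖ := re_inner_le_norm (𝕜 := ℂ) _ _
        _ ≤ (δ * ‖T y‖) * ‖T y‖ := by gcongr; exact hFs _ hTy
        _ = _ := by ring
    rw [re_inner_self] at h1
    have h3 : (4 * (δ / 2))⁻¹ * (inner ℂ (T (T y)) (T y)).re ≤ ‖T y‖ ^ 2 / 2 := by
      calc _ ≤ (4 * (δ / 2))⁻¹ * (δ * ‖T y‖ ^ 2) := by gcongr
        _ = _ := by field_simp; ring
    linarith
  have hnn := h.form_nonneg_of_mem_orthogonal hs0 (hs.2.trans_le (min_le_right _ _)) hsM hyB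
  have e1 : (A - T) y - (β : ℂ) • y = ((α - β : ℝ) : ℂ) • y - T y := by
    rw [sub_apply, hAy]; push_cast; module
  have e2 : (A - T) y - (α : ℂ) • y + (s : ℂ) • y = (s : ℂ) • y - T y := by
    rw [sub_apply, hAy]; module
  have e3 : (inner ℂ ((A - T) y - (β : ℂ) • y)
        ((A - T) y - (α : ℂ) • y + (s : ℂ) • y)).re =
      (α - β) * s * ‖y‖ ^ 2 - (α - β + s) * (inner ℂ (T y) y).re + ‖T y‖ ^ 2 := by
    rw [e1, e2]
    simp only [inner_sub_left, inner_sub_right, inner_smul_left, inner_smul_right,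
      Complex.sub_re, Complex.conj_ofReal, Complex.re_ofReal_mul, re_inner_self,
      re_inner_comm y (T y)]
    ring
  rw [e3] at hnn
  have hyn : 0 < ‖y‖ ^ 2 := by have := norm_pos_iff.2 hy0; positivity
  set t := (inner ℂ (T y) y).re
  have ht0 : 0 ≤ t := h.nonneg y
  -- (1 - ε/2)(1 + ε) = 1 + ε(1 - ε)/2 ≥ 1.
  have k1 : (α - β) * s * ‖y‖ ^ 2 ≤ (1 - ε / 2) * (α - β) * ((1 + ε) * s * ‖y‖ ^ 2) := by
    have : 0 ≤ (α - β) * s * ‖y‖ ^ 2 * (ε * (1 - ε)) := by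
      have : 0 < 1 - ε := by linarith
      positivity
    nlinarith
  have k2 : (1 - ε / 2) * (α - β) * ((1 + ε) * s * ‖y‖ ^ 2) < (1 - ε / 2) * (α - β) * t := by
    have : 0 < 1 - ε / 2 := by linarith
    gcongr
  have k3 : 0 ≤ s * t := mul_nonneg hs0.le ht0
  rw [hδ] at hTT
  nlinarith

end GapData

end Counting

end Landau

end

noncomputable section

namespace Landau

open Function (HasTemperateGrowth)

/-! ### Operators on Schwartz functions -/

/-- The Schwartz space of the plane. -/
abbrev Schw : Type := SchwartzMap Plane ℂ

/-- The embedding of Schwartz functions into `L²`. -/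
def toL2 : Schw →L[ℂ] L2 := SchwartzMap.toLpCLM ℂ ℂ 2 (volume : Measure Plane)

lemma coeFn_toL2 (φ : Schw) : (toL2 φ : Plane → ℂ) =ᵐ[volume] φ := φ.coeFn_toLp 2 volume

lemma inner_toL2 (φ ψ : Schw) : inner ℂ (toL2 φ) (toL2 ψ) = ∫ x, conj (φ x) * ψ x := by
  refine (SchwartzMap.inner_toL2_toL2_eq φ ψ volume).trans ?_
  simp only [RCLike.inner_apply']

lemma toL2_injective : Function.Injective toL2 := SchwartzMap.injective_toLp 2 volume

/-- The standard basis vector of the plane. -/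
abbrev dir (j : Fin 2) : Plane := EuclideanSpace.single j 1

/-- Partial derivatives. -/
def pd (j : Fin 2) (f : Plane → ℂ) (x : Plane) : ℂ := fderiv ℝ f x (dir j)

lemma hasTemperateGrowth_fderiv {f : Plane → ℂ} (hf : HasTemperateGrowth f) :
    HasTemperateGrowth (fderiv ℝ f) := by
  refine ⟨hf.1.fderiv_right (m := ∞) (by simp), fun n => ?_⟩
  obtain ⟨k, C, h⟩ := hf.2 (n + 1)
  exact ⟨k, C, fun x => by rw [norm_iteratedFDeriv_fderiv]; exact h x⟩

lemma hasTemperateGrowth_pd {f : Plane → ℂ} (hf : HasTemperateGrowth f) (j : Fin 2) :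
    HasTemperateGrowth (pd j f) := by
  have h := (ContinuousLinearMap.apply ℝ ℂ (dir j)).hasTemperateGrowth
  exact h.comp (hasTemperateGrowth_fderiv hf)

/-- Multiplication by a function of temperate growth. -/
def mulS (f : Plane → ℂ) : Schw →L[ℂ] Schw := SchwartzMap.smulLeftCLM ℂ f

lemma mulS_apply {f : Plane → ℂ} (hf : HasTemperateGrowth f) (φ : Schw) (x : Plane) :
    mulS f φ x = f x * φ x := by
  rw [mulS, SchwartzMap.smulLeftCLM_apply_apply hf, smul_eq_mul]

/-- Partial derivative of a Schwartz function. -/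
def derS (j : Fin 2) : Schw →L[ℂ] Schw := LineDeriv.lineDerivOpCLM ℂ Schw (dir j)

lemma derS_apply (j : Fin 2) (φ : Schw) (x : Plane) : derS j φ x = pd j φ x := rfl

lemma hasTemperateGrowth_coord (j : Fin 2) : HasTemperateGrowth (fun x : Plane => (x j : ℂ)) := by
  have h : HasTemperateGrowth (fun x : Plane => x j) :=
    (EuclideanSpace.proj (𝕜 := ℝ) j).hasTemperateGrowth
  exact Complex.ofRealCLM.hasTemperateGrowth.comp h

lemma hasTemperateGrowth_A0 (b : ℝ) (j : Fin 2) :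
    HasTemperateGrowth (fun x : Plane => (A0 b j x : ℂ)) := by
  fin_cases j
  · exact Complex.ofRealCLM.hasTemperateGrowth.comp
      ((-(b / 2)) • (EuclideanSpace.proj (𝕜 := ℝ) 1 : Plane →L[ℝ] ℝ)).hasTemperateGrowth
  · exact Complex.ofRealCLM.hasTemperateGrowth.comp
      ((b / 2) • (EuclideanSpace.proj (𝕜 := ℝ) 0 : Plane →L[ℝ] ℝ)).hasTemperateGrowth

/-- The magnetic derivative `Π_j` on Schwartz functions. -/
def piS (b : ℝ) (j : Fin 2) : Schw →L[ℂ] Schw :=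
  (-Complex.I) • derS j - mulS (fun x => (A0 b j x : ℂ))

lemma piS_apply (b : ℝ) (j : Fin 2) (φ : Schw) (x : Plane) :
    piS b j φ x = piExpr b j φ x := by
  change -Complex.I * derS j φ x - mulS (fun x => (A0 b j x : ℂ)) φ x = _
  rw [mulS_apply (hasTemperateGrowth_A0 b j), derS_apply]
  rfl

lemma inner_mulS {f : Plane → ℂ} (hf : HasTemperateGrowth f)
    (hf' : HasTemperateGrowth (fun x => conj (f x))) (φ ψ : Schw) :
    inner ℂ (toL2 (mulS f φ)) (toL2 ψ) = inner ℂ (toL2 φ) (toL2 (mulS (fun x => conj (f x)) ψ)) := by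
  rw [inner_toL2, inner_toL2]
  congr 1
  ext x
  rw [mulS_apply hf, mulS_apply hf', map_mul]
  ring

lemma hasTemperateGrowth_conj {f : Plane → ℂ} (hf : HasTemperateGrowth f) :
    HasTemperateGrowth (fun x => conj (f x)) :=
  (Complex.conjCLE.toContinuousLinearMap.hasTemperateGrowth).comp hf

lemma inner_derS (j : Fin 2) (φ ψ : Schw) :
    inner ℂ (toL2 (derS j φ)) (toL2 ψ) = -inner ℂ (toL2 φ) (toL2 (derS j ψ)) := by
  rw [inner_toL2, inner_toL2, eq_neg_iff_add_eq_zero, add_comm, ← eq_neg_iff_add_eq_zero]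
  exact SchwartzMap.integral_bilinear_lineDerivOp_right_eq_neg_left φ ψ
    ((ContinuousLinearMap.mul ℝ ℂ).comp Complex.conjCLE.toContinuousLinearMap) (dir j)

lemma inner_piS (b : ℝ) (j : Fin 2) (φ ψ : Schw) :
    inner ℂ (toL2 (piS b j φ)) (toL2 ψ) = inner ℂ (toL2 φ) (toL2 (piS b j ψ)) := by
  have e : ∀ φ : Schw, piS b j φ = (-Complex.I) • derS j φ - mulS (fun x => (A0 b j x : ℂ)) φ :=
    fun _ => rfl
  have hc : (fun x : Plane => conj ((A0 b j x : ℂ))) = fun x => (A0 b j x : ℂ) := by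
    ext x; exact Complex.conj_ofReal _
  have h := inner_mulS (hasTemperateGrowth_A0 b j)
    (hasTemperateGrowth_conj (hasTemperateGrowth_A0 b j)) φ ψ
  rw [hc] at h
  rw [e, e, map_sub, map_sub, inner_sub_left, inner_sub_right, h, map_smul, map_smul,
    inner_smul_left, inner_smul_right, inner_derS]
  simp

lemma pd_mul {f g : Plane → ℂ} (hf : HasTemperateGrowth f) (φ : Schw) (j : Fin 2) (x : Plane)
    (hg : g = fun y => f y * φ y) : pd j g x = f x * pd j φ x + pd j f x * φ x := by
  have h1 : HasFDerivAt f (fderiv ℝ f x) x :=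
    (hf.1.differentiable (by simp)).differentiableAt.hasFDerivAt
  have h2 : HasFDerivAt φ (fderiv ℝ φ x) x := SchwartzMap.hasFDerivAt φ x
  have := (h1.mul h2).fderiv
  rw [pd, hg]
  change fderiv ℝ (f * (φ : Plane → ℂ)) x _ = _
  rw [this]
  simp only [add_apply, smul_apply, smul_eq_mul, pd]
  ring

lemma coe_mulS {f : Plane → ℂ} (hf : HasTemperateGrowth f) (φ : Schw) :
    (mulS f φ : Plane → ℂ) = fun y => f y * φ y := by
  ext y; exact mulS_apply hf φ y

lemma derS_mulS {f : Plane → ℂ} (hf : HasTemperateGrowth f) (j : Fin 2) (φ : Schw) :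
    derS j (mulS f φ) = mulS f (derS j φ) + mulS (pd j f) φ := by
  ext x
  rw [add_apply, derS_apply, mulS_apply hf, mulS_apply (hasTemperateGrowth_pd hf j),
    pd_mul hf φ j x (coe_mulS hf φ)]
  rfl

lemma mulS_comm {f g : Plane → ℂ} (hf : HasTemperateGrowth f) (hg : HasTemperateGrowth g)
    (φ : Schw) : mulS f (mulS g φ) = mulS g (mulS f φ) := by
  ext x
  rw [mulS_apply hf, mulS_apply hg, mulS_apply hg, mulS_apply hf]
  ring

lemma piS_mulS {f : Plane → ℂ} (hf : HasTemperateGrowth f) (b : ℝ) (j : Fin 2) (φ : Schw) :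
    piS b j (mulS f φ) = mulS f (piS b j φ) - Complex.I • mulS (pd j f) φ := by
  have e : ∀ φ : Schw, piS b j φ = (-Complex.I) • derS j φ - mulS (fun x => (A0 b j x : ℂ)) φ :=
    fun _ => rfl
  rw [e, e, derS_mulS hf, map_sub, map_smul, mulS_comm (hasTemperateGrowth_A0 b j) hf]
  module

lemma derS_comm (j k : Fin 2) (φ : Schw) : derS j (derS k φ) = derS k (derS j φ) := by
  ext x
  have h : ∀ j k : Fin 2, derS j (derS k φ) x = fderiv ℝ (fderiv ℝ φ) x (dir j) (dir k) := by
    intro j k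
    rw [derS_apply, pd]
    have hd : DifferentiableAt ℝ (fderiv ℝ φ) x :=
      ((φ.smooth ⊤).fderiv_right (m := ∞) (by simp)).differentiable (by simp) |>.differentiableAt
    have : (derS k φ : Plane → ℂ) = fun y => fderiv ℝ φ y (dir k) := rfl
    rw [this, fderiv_clm_apply hd (differentiableAt_const _)]
    simp
  rw [h, h]
  have hs : IsSymmSndFDerivAt ℝ φ x :=
    ((φ.smooth 2).contDiffAt).isSymmSndFDerivAt (by simp)
  exact hs _ _

lemma pd_A0 (b : ℝ) (j k : Fin 2) (x : Plane) :
    pd j (fun x => (A0 b k x : ℂ)) x = ((!![0, b / 2; -(b / 2), 0] : Matrix _ _ ℝ) j k : ℂ) := by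
  have hcoord : ∀ (c : ℝ) (l : Fin 2), pd j (fun x : Plane => ((c * x l : ℝ) : ℂ)) x =
      ((c * (dir j) l : ℝ) : ℂ) := by
    intro c l
    have : (fun x : Plane => ((c * x l : ℝ) : ℂ)) =
        (Complex.ofRealCLM.comp (c • (EuclideanSpace.proj (𝕜 := ℝ) l) : Plane →L[ℝ] ℝ)) := by
      ext x; simp
    rw [pd, this, ContinuousLinearMap.fderiv]
    simp only [ContinuousLinearMap.comp_apply, smul_apply]
    rfl
  fin_cases k
  · have := hcoord (-(b / 2)) 1
    fin_cases j <;> simpa [A0] using this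
  · have := hcoord (b / 2) 0
    fin_cases j <;> simpa [A0] using this

/-- The canonical commutation relation `[Π₁, Π₂] = i b`. -/
lemma piS_comm (b : ℝ) (φ : Schw) :
    piS b 0 (piS b 1 φ) = piS b 1 (piS b 0 φ) + (Complex.I * b) • φ := by
  have e : ∀ j, ∀ φ : Schw,
      piS b j φ = (-Complex.I) • derS j φ - mulS (fun x => (A0 b j x : ℂ)) φ := fun _ _ => rfl
  have h01 : mulS (pd 0 fun x => (A0 b 1 x : ℂ)) φ = ((b / 2 : ℝ) : ℂ) • φ := by
    ext x
    rw [mulS_apply (hasTemperateGrowth_pd (hasTemperateGrowth_A0 b 1) 0), pd_A0]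
    simp
  have h10 : mulS (pd 1 fun x => (A0 b 0 x : ℂ)) φ = ((-(b / 2) : ℝ) : ℂ) • φ := by
    ext x
    rw [mulS_apply (hasTemperateGrowth_pd (hasTemperateGrowth_A0 b 0) 1), pd_A0]
    simp
  rw [e 0, e 1, e 1, e 0]
  simp only [map_sub, map_smul, derS_mulS (hasTemperateGrowth_A0 b _), h01, h10,
    derS_comm 0 1, mulS_comm (hasTemperateGrowth_A0 b 0) (hasTemperateGrowth_A0 b 1)]
  push_cast
  module

end Landau

end

noncomputable section

namespace Landau

open Function (HasTemperateGrowth)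

/-! ### Ladder operators -/

/-- The annihilation operator `a = Π₁ + i Π₂`. -/
def annS (b : ℝ) : Schw →L[ℂ] Schw := piS b 0 + Complex.I • piS b 1

/-- The creation operator `a† = Π₁ - i Π₂`. -/
def creS (b : ℝ) : Schw →L[ℂ] Schw := piS b 0 - Complex.I • piS b 1

/-- The complex coordinate `z = x₁ + i x₂`. -/
def zf (x : Plane) : ℂ := (x 0 : ℂ) + Complex.I * (x 1 : ℂ)

/-- The complex coordinate `z̄ = x₁ - i x₂`. -/
def zbf (x : Plane) : ℂ := (x 0 : ℂ) - Complex.I * (x 1 : ℂ)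

lemma hasTemperateGrowth_zf : HasTemperateGrowth zf :=
  (hasTemperateGrowth_coord 0).add
    ((HasTemperateGrowth.const Complex.I).mul (hasTemperateGrowth_coord 1))

lemma hasTemperateGrowth_zbf : HasTemperateGrowth zbf :=
  (hasTemperateGrowth_coord 0).sub
    ((HasTemperateGrowth.const Complex.I).mul (hasTemperateGrowth_coord 1))

lemma pd_coord (j l : Fin 2) (x : Plane) :
    pd j (fun x : Plane => (x l : ℂ)) x = if l = j then 1 else 0 := by
  have : (fun x : Plane => (x l : ℂ)) =
      (Complex.ofRealCLM.comp (EuclideanSpace.proj (𝕜 := ℝ) l : Plane →L[ℝ] ℝ)) := by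
    ext x; simp
  rw [pd, this, ContinuousLinearMap.fderiv]
  simp only [ContinuousLinearMap.comp_apply]
  change (((dir j) l : ℝ) : ℂ) = _
  rw [PiLp.single_apply]
  split_ifs <;> simp

lemma mulS_zf (φ : Schw) : mulS zf φ =
    mulS (fun x => (x 0 : ℂ)) φ + Complex.I • mulS (fun x => (x 1 : ℂ)) φ := by
  ext x
  rw [add_apply, smul_apply, mulS_apply hasTemperateGrowth_zf,
    mulS_apply (hasTemperateGrowth_coord 0), mulS_apply (hasTemperateGrowth_coord 1), zf,
    smul_eq_mul]
  ring

lemma mulS_zbf (φ : Schw) : mulS zbf φ =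
    mulS (fun x => (x 0 : ℂ)) φ - Complex.I • mulS (fun x => (x 1 : ℂ)) φ := by
  ext x
  rw [sub_apply, smul_apply, mulS_apply hasTemperateGrowth_zbf,
    mulS_apply (hasTemperateGrowth_coord 0), mulS_apply (hasTemperateGrowth_coord 1), zbf,
    smul_eq_mul]
  ring

lemma piS_coord (b : ℝ) (j l : Fin 2) (φ : Schw) :
    piS b j (mulS (fun x => (x l : ℂ)) φ) =
      mulS (fun x => (x l : ℂ)) (piS b j φ) - (if l = j then Complex.I else 0) • φ := by
  rw [piS_mulS (hasTemperateGrowth_coord l)]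
  congr 1
  ext x
  rw [smul_apply, smul_apply, mulS_apply (hasTemperateGrowth_pd (hasTemperateGrowth_coord l) j),
    pd_coord]
  split_ifs <;> simp

lemma annS_apply (b : ℝ) (φ : Schw) : annS b φ = piS b 0 φ + Complex.I • piS b 1 φ := rfl

lemma creS_apply (b : ℝ) (φ : Schw) : creS b φ = piS b 0 φ - Complex.I • piS b 1 φ := rfl

lemma piS_zero_eq (b : ℝ) (φ : Schw) : piS b 0 φ = (1 / 2 : ℂ) • (annS b φ + creS b φ) := by
  rw [annS_apply, creS_apply]; module

lemma piS_one_eq (b : ℝ) (φ : Schw) :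
    piS b 1 φ = (-Complex.I / 2 : ℂ) • (annS b φ - creS b φ) := by
  rw [annS_apply, creS_apply]
  have : (-Complex.I / 2 : ℂ) • (piS b 0 φ + Complex.I • piS b 1 φ
    - (piS b 0 φ - Complex.I • piS b 1 φ)) = (-(Complex.I * Complex.I)) • piS b 1 φ := by module
  rw [this, Complex.I_mul_I]
  simp

lemma inner_annS (b : ℝ) (φ ψ : Schw) :
    inner ℂ (toL2 (annS b φ)) (toL2 ψ) = inner ℂ (toL2 φ) (toL2 (creS b ψ)) := by
  rw [annS_apply, creS_apply, map_add, map_sub, map_smul, map_smul, inner_add_left,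
    inner_sub_right, inner_smul_left, inner_smul_right, inner_piS, inner_piS, Complex.conj_I]
  ring

lemma inner_creS (b : ℝ) (φ ψ : Schw) :
    inner ℂ (toL2 (creS b φ)) (toL2 ψ) = inner ℂ (toL2 φ) (toL2 (annS b ψ)) := by
  rw [annS_apply, creS_apply, map_add, map_sub, map_smul, map_smul, inner_sub_left,
    inner_add_right, inner_smul_left, inner_smul_right, inner_piS, inner_piS, Complex.conj_I]
  ring

lemma annS_creS (b : ℝ) (φ : Schw) :
    annS b (creS b φ) = creS b (annS b φ) + (2 * b : ℂ) • φ := by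
  simp only [annS_apply, creS_apply, map_add, map_sub, map_smul, piS_comm]
  have h : Complex.I • (Complex.I * (b : ℂ)) • φ = (-(b : ℂ)) • φ := by
    rw [smul_smul, ← mul_assoc, Complex.I_mul_I]; simp
  simp only [smul_add, smul_sub, h]
  module

/-- The Landau Hamiltonian on Schwartz functions. -/
def hamS (b : ℝ) : Schw →L[ℂ] Schw := piS b 0 ∘L piS b 0 + piS b 1 ∘L piS b 1

lemma hamS_apply (b : ℝ) (φ : Schw) :
    hamS b φ = piS b 0 (piS b 0 φ) + piS b 1 (piS b 1 φ) := rfl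

lemma hamS_eq (b : ℝ) (φ : Schw) : hamS b φ = creS b (annS b φ) + (b : ℂ) • φ := by
  simp only [hamS_apply, annS_apply, creS_apply, map_add, map_smul, piS_comm]
  have h : Complex.I • (Complex.I * (b : ℂ)) • φ = (-(b : ℂ)) • φ := by
    rw [smul_smul, ← mul_assoc, Complex.I_mul_I]; simp
  have h2 : ∀ χ : Schw, Complex.I • Complex.I • χ = -χ := fun χ => by
    rw [smul_smul, Complex.I_mul_I]; simp
  simp only [smul_add, smul_sub, h, h2]
  module

/-- The creation operator `c† = a + i b z` of the second oscillator. -/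
def cocS (b : ℝ) : Schw →L[ℂ] Schw := annS b + (Complex.I * b) • mulS zf

/-- The annihilation operator `c = a† - i b z̄` of the second oscillator. -/
def coaS (b : ℝ) : Schw →L[ℂ] Schw := creS b - (Complex.I * b) • mulS zbf

lemma cocS_apply (b : ℝ) (φ : Schw) :
    cocS b φ = annS b φ + (Complex.I * b) • mulS zf φ := rfl

lemma coaS_apply (b : ℝ) (φ : Schw) :
    coaS b φ = creS b φ - (Complex.I * b) • mulS zbf φ := rfl

lemma annS_zf (b : ℝ) (φ : Schw) : annS b (mulS zf φ) = mulS zf (annS b φ) := by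
  simp only [annS_apply, mulS_zf, map_add, map_smul, piS_coord]
  have h2 : ∀ χ : Schw, Complex.I • Complex.I • χ = -χ := fun χ => by
    rw [smul_smul, Complex.I_mul_I]; simp
  simp [smul_sub, h2]
  abel

lemma creS_zf (b : ℝ) (φ : Schw) :
    creS b (mulS zf φ) = mulS zf (creS b φ) - (2 * Complex.I) • φ := by
  simp only [creS_apply, mulS_zf, map_sub, map_add, map_smul, piS_coord]
  have h2 : ∀ χ : Schw, Complex.I • Complex.I • χ = -χ := fun χ => by
    rw [smul_smul, Complex.I_mul_I]; simp
  simp [smul_sub, h2]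
  module

lemma annS_zbf (b : ℝ) (φ : Schw) :
    annS b (mulS zbf φ) = mulS zbf (annS b φ) - (2 * Complex.I) • φ := by
  simp only [annS_apply, mulS_zbf, map_sub, map_add, map_smul, piS_coord]
  have h2 : ∀ χ : Schw, Complex.I • Complex.I • χ = -χ := fun χ => by
    rw [smul_smul, Complex.I_mul_I]; simp
  simp [smul_sub, h2]
  module

lemma creS_zbf (b : ℝ) (φ : Schw) : creS b (mulS zbf φ) = mulS zbf (creS b φ) := by
  simp only [creS_apply, mulS_zbf, map_sub, map_smul, piS_coord]
  have h2 : ∀ χ : Schw, Complex.I • Complex.I • χ = -χ := fun χ => by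
    rw [smul_smul, Complex.I_mul_I]; simp
  simp [smul_sub, h2]
  abel

/-- The operator c† commutes with a† here and with a in `annS_cocS`, so it moves within a Landau
level; this is the source of the infinite degeneracy. -/
lemma creS_cocS (b : ℝ) (φ : Schw) : creS b (cocS b φ) = cocS b (creS b φ) := by
  rw [cocS_apply, cocS_apply, map_add, map_smul, creS_zf, annS_creS, smul_sub, smul_smul]
  have : Complex.I * (b : ℂ) * (2 * Complex.I) = -(2 * b) := by
    linear_combination (2 * (b : ℂ)) * Complex.I_mul_I
  rw [this]
  module

lemma annS_cocS (b : ℝ) (φ : Schw) : annS b (cocS b φ) = cocS b (annS b φ) := by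
  rw [cocS_apply, cocS_apply, map_add, map_smul, annS_zf]

lemma creS_coaS (b : ℝ) (φ : Schw) : creS b (coaS b φ) = coaS b (creS b φ) := by
  rw [coaS_apply, coaS_apply, map_sub, map_smul, creS_zbf]

lemma coaS_cocS (b : ℝ) (φ : Schw) :
    coaS b (cocS b φ) = cocS b (coaS b φ) + (2 * b : ℂ) • φ := by
  have hz : mulS zbf (mulS zf φ) = mulS zf (mulS zbf φ) :=
    mulS_comm hasTemperateGrowth_zbf hasTemperateGrowth_zf φ
  simp only [coaS_apply, cocS_apply, map_add, map_sub, map_smul, creS_zf, annS_zbf, annS_creS, hz,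
    smul_sub, smul_smul]
  have : Complex.I * (b : ℂ) * (2 * Complex.I) = -(2 * b) := by
    linear_combination (2 * (b : ℂ)) * Complex.I_mul_I
  rw [this]
  match_scalars <;> first | ring1 | linear_combination (-(2 : ℂ) * b) * Complex.I_mul_I

lemma inner_cocS (b : ℝ) (φ ψ : Schw) :
    inner ℂ (toL2 (cocS b φ)) (toL2 ψ) = inner ℂ (toL2 φ) (toL2 (coaS b ψ)) := by
  have hc : (fun x => conj (zf x)) = zbf := by
    ext x; simp [zf, zbf]; ring
  have h := inner_mulS hasTemperateGrowth_zf (hc ▸ hasTemperateGrowth_zbf) φ ψ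
  rw [hc] at h
  rw [cocS_apply, coaS_apply, map_add, map_sub, map_smul, map_smul, inner_add_left,
    inner_sub_right, inner_smul_left, inner_smul_right, inner_annS, h, map_mul, Complex.conj_I,
    Complex.conj_ofReal]
  ring

/-! ### The Gaussian -/

/-- The real-linear map `x ↦ -(b/2) ⟨x, ·⟩`, the logarithmic derivative of the Gaussian. -/
def gaussLog (b : ℝ) : Plane →L[ℝ] Plane →L[ℝ] ℂ :=
  (ContinuousLinearMap.compL ℝ Plane ℝ ℂ ((-(b / 2)) • Complex.ofRealCLM)) ∘L (innerSL ℝ)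

lemma gaussLog_apply (b : ℝ) (x v : Plane) :
    gaussLog b x v = -((b / 2 : ℝ) : ℂ) * ((inner ℝ x v : ℝ) : ℂ) := by
  simp only [gaussLog]
  change ((-(b / 2) : ℝ) : ℂ) • ((inner ℝ x v : ℝ) : ℂ) = _
  push_cast
  rw [smul_eq_mul]

/-- The Gaussian `e^{-b|x|²/4}`. -/
def gaussFun (b : ℝ) (x : Plane) : ℂ := ((Real.exp (-(b / 4) * ‖x‖ ^ 2) : ℝ) : ℂ)

lemma hasFDerivAt_gaussFun (b : ℝ) (x : Plane) :
    HasFDerivAt (gaussFun b) (gaussFun b x • gaussLog b x) x := by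
  have h1 : HasFDerivAt (fun x : Plane => ‖x‖ ^ 2) (2 • innerSL ℝ x) x :=
    (hasStrictFDerivAt_norm_sq x).hasFDerivAt
  have h2 := ((h1.const_mul (-(b / 4))).exp)
  have h3 := (Complex.ofRealCLM.hasFDerivAt).comp x h2
  refine h3.congr_fderiv ?_
  ext v
  simp [gaussLog_apply, gaussFun]
  ring

lemma contDiff_gaussFun (b : ℝ) : ContDiff ℝ ∞ (gaussFun b) := by
  have h1 : ContDiff ℝ ∞ (fun x : Plane => Real.exp (-(b / 4) * ‖x‖ ^ 2)) :=
    (contDiff_const.mul (contDiff_norm_sq ℝ)).exp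
  exact Complex.ofRealCLM.contDiff.comp h1

/-- A derivative of the Gaussian is the Gaussian times the linear map `gaussLog`, so Leibniz' rule
reduces order n + 1 to orders at most n, with the weight raised by p to absorb the growth of
`gaussLog`. At order zero a square is completed in the exponent. -/
lemma gaussFun_decay {b : ℝ} (hb : 0 < b) (n : ℕ) : ∀ k : ℕ, ∃ C : ℝ, ∀ x : Plane,
    (1 + ‖x‖) ^ k * ‖iteratedFDeriv ℝ n (gaussFun b) x‖ ≤ C := by
  induction n using Nat.strong_induction_on with
  | _ n ih =>
    intro k
    rcases n with _ | n
    · refine ⟨k.factorial * Real.exp (1 + 1 / b), fun x => ?_⟩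
      rw [norm_iteratedFDeriv_zero, gaussFun, Complex.norm_real, Real.norm_eq_abs, Real.abs_exp]
      have h1 : (1 + ‖x‖) ^ k ≤ k.factorial * Real.exp (1 + ‖x‖) := by
        have := Real.pow_div_factorial_le_exp (1 + ‖x‖) (by positivity) k
        rw [div_le_iff₀ (by positivity)] at this
        linarith
      calc _ ≤ (k.factorial * Real.exp (1 + ‖x‖)) * Real.exp (-(b / 4) * ‖x‖ ^ 2) := by gcongr
        _ = k.factorial * Real.exp (1 + ‖x‖ + -(b / 4) * ‖x‖ ^ 2) := by rw [mul_assoc, ← Real.exp_add]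
        _ ≤ _ := by
          refine mul_le_mul_of_nonneg_left (Real.exp_le_exp.2 ?_) (by positivity)
          have : 0 ≤ (b * ‖x‖ / 2 - 1) ^ 2 / b := by positivity
          have e : (b * ‖x‖ / 2 - 1) ^ 2 / b = b / 4 * ‖x‖ ^ 2 - ‖x‖ + 1 / b := by
            field_simp; ring
          linarith
    · have hfd : fderiv ℝ (gaussFun b) = fun x => gaussFun b x • gaussLog b x := by
        ext1 x; exact (hasFDerivAt_gaussFun b x).fderiv
      have htg : HasTemperateGrowth (gaussLog b) := (gaussLog b).hasTemperateGrowth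
      obtain ⟨p, D, hD0, hD⟩ := htg.norm_iteratedFDeriv_le_uniform n
      have ih' : ∀ i : ℕ, ∃ C : ℝ, i < n + 1 → ∀ x : Plane,
          (1 + ‖x‖) ^ (k + p) * ‖iteratedFDeriv ℝ i (gaussFun b) x‖ ≤ C := by
        intro i
        by_cases hi : i < n + 1
        · obtain ⟨C, hC⟩ := ih i hi (k + p)
          exact ⟨C, fun _ => hC⟩
        · exact ⟨0, fun h => absurd h hi⟩
      choose C hC using ih'
      refine ⟨∑ i ∈ Finset.range (n + 1), (n.choose i : ℝ) * C i * D, fun x => ?_⟩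
      rw [← norm_iteratedFDeriv_fderiv, hfd]
      have h1 := norm_iteratedFDeriv_smul_le (𝕜 := ℝ) (contDiff_gaussFun b) htg.1 x (n := n)
        (WithTop.coe_le_coe.2 le_top)
      refine (mul_le_mul_of_nonneg_left h1 (by positivity)).trans ?_
      rw [Finset.mul_sum]
      refine Finset.sum_le_sum fun i hi => ?_
      have hi' := Finset.mem_range.1 hi
      have h2 := hC i hi' x
      have h3 := hD (n - i) (Nat.sub_le _ _) x
      have hC0 : 0 ≤ C i := le_trans (by positivity) h2
      calc (1 + ‖x‖) ^ k * ((n.choose i : ℝ) * ‖iteratedFDeriv ℝ i (gaussFun b) x‖ *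
            ‖iteratedFDeriv ℝ (n - i) (gaussLog b) x‖)
          ≤ (1 + ‖x‖) ^ k * ((n.choose i : ℝ) * ‖iteratedFDeriv ℝ i (gaussFun b) x‖ *
            (D * (1 + ‖x‖) ^ p)) := by gcongr
        _ = (n.choose i : ℝ) * ((1 + ‖x‖) ^ (k + p) * ‖iteratedFDeriv ℝ i (gaussFun b) x‖) * D := by
          rw [pow_add]; ring
        _ ≤ _ := by gcongr

/-- The Gaussian `e^{-b|x|²/4}` as a Schwartz function (for `b > 0`). -/
def gaussS {b : ℝ} (hb : 0 < b) : Schw where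
  toFun := gaussFun b
  smooth' := contDiff_gaussFun b
  decay' k n := by
    obtain ⟨C, hC⟩ := gaussFun_decay hb n k
    refine ⟨C, fun x => le_trans ?_ (hC x)⟩
    gcongr
    linarith

lemma gaussS_apply {b : ℝ} (hb : 0 < b) (x : Plane) : gaussS hb x = gaussFun b x := rfl

lemma pd_gaussS {b : ℝ} (hb : 0 < b) (j : Fin 2) (x : Plane) :
    pd j (gaussS hb) x = -((b / 2 : ℝ) : ℂ) * (x j : ℂ) * gaussFun b x := by
  have : fderiv ℝ (gaussS hb) x = gaussFun b x • gaussLog b x :=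
    (hasFDerivAt_gaussFun b x).fderiv
  rw [pd, this, smul_apply, gaussLog_apply, EuclideanSpace.inner_single_right]
  simp
  ring

lemma piS_gaussS {b : ℝ} (hb : 0 < b) (j : Fin 2) (x : Plane) :
    piS b j (gaussS hb) x =
      (Complex.I * ((b / 2 : ℝ) : ℂ) * (x j : ℂ) - (A0 b j x : ℂ)) * gaussFun b x := by
  have h := piS_apply b j (gaussS hb) x
  have h2 := pd_gaussS hb j x
  rw [pd] at h2
  rw [h, piExpr, h2, gaussS_apply]
  ring

lemma annS_gaussS {b : ℝ} (hb : 0 < b) : annS b (gaussS hb) = 0 := by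
  ext x
  rw [annS_apply, add_apply, smul_apply, piS_gaussS, piS_gaussS]
  simp [A0]
  linear_combination (b / 2 * x 1 * gaussFun b x : ℂ) * Complex.I_mul_I

lemma coaS_gaussS {b : ℝ} (hb : 0 < b) : coaS b (gaussS hb) = 0 := by
  ext x
  rw [coaS_apply, creS_apply, sub_apply, sub_apply, smul_apply, smul_apply, piS_gaussS,
    piS_gaussS, mulS_apply hasTemperateGrowth_zbf, gaussS_apply]
  simp [A0, zbf]
  linear_combination (b / 2 * x 1 * gaussFun b x : ℂ) * Complex.I_mul_I

lemma gaussS_ne_zero {b : ℝ} (hb : 0 < b) : gaussS hb ≠ 0 := by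
  intro h
  have := congrArg (fun φ : Schw => φ 0) h
  simp [gaussS_apply, gaussFun] at this

end Landau

end

noncomputable section

namespace Landau

open Function (HasTemperateGrowth)

/-! ### Landau states -/

/-- The (unnormalized) Landau states `(a†)^q (c†)^k e^{-b|x|²/4}`. -/
def stS {b : ℝ} (hb : 0 < b) (k q : ℕ) : Schw := (creS b)^[q] ((cocS b)^[k] (gaussS hb))

variable {b : ℝ} (hb : 0 < b)

lemma stS_zero_zero : stS hb 0 0 = gaussS hb := rfl

lemma creS_stS (k q : ℕ) : creS b (stS hb k q) = stS hb k (q + 1) := by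
  rw [stS, stS, Function.iterate_succ_apply']

lemma cocS_iterate_creS (q : ℕ) (φ : Schw) :
    cocS b ((creS b)^[q] φ) = (creS b)^[q] (cocS b φ) := by
  induction q with
  | zero => rfl
  | succ q ih => rw [Function.iterate_succ_apply', Function.iterate_succ_apply', ← creS_cocS, ih]

lemma cocS_stS (k q : ℕ) : cocS b (stS hb k q) = stS hb (k + 1) q := by
  rw [stS, stS, cocS_iterate_creS, Function.iterate_succ_apply']

lemma annS_stS_zero (k : ℕ) : annS b (stS hb k 0) = 0 := by
  induction k with
  | zero => exact annS_gaussS hb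
  | succ k ih => rw [← cocS_stS, annS_cocS, ih, map_zero]

lemma annS_stS_succ (k q : ℕ) :
    annS b (stS hb k (q + 1)) = (2 * b * (q + 1) : ℂ) • stS hb k q := by
  induction q with
  | zero => rw [← creS_stS, annS_creS, annS_stS_zero, map_zero, zero_add]; simp
  | succ q ih =>
    rw [← creS_stS, annS_creS, ih, map_smul, creS_stS]
    push_cast
    module

lemma coaS_stS_zero (q : ℕ) : coaS b (stS hb 0 q) = 0 := by
  induction q with
  | zero => exact coaS_gaussS hb
  | succ q ih => rw [← creS_stS, ← creS_coaS, ih, map_zero]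

lemma coaS_stS_succ (k q : ℕ) :
    coaS b (stS hb (k + 1) q) = (2 * b * (k + 1) : ℂ) • stS hb k q := by
  induction k with
  | zero => rw [← cocS_stS, coaS_cocS, coaS_stS_zero, map_zero, zero_add]; simp
  | succ k ih =>
    rw [← cocS_stS, coaS_cocS, ih, map_smul, cocS_stS]
    push_cast
    module

lemma hamS_stS (k q : ℕ) : hamS b (stS hb k q) = (level b q : ℂ) • stS hb k q := by
  rw [hamS_eq]
  rcases q with _ | q
  · rw [annS_stS_zero, map_zero, zero_add]; simp [level]
  · rw [annS_stS_succ, map_smul, creS_stS, ← add_smul]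
    congr 1
    simp [level]
    ring

lemma cocS_coaS_stS (k q : ℕ) :
    cocS b (coaS b (stS hb k q)) = ((2 * b * k : ℝ) : ℂ) • stS hb k q := by
  rcases k with _ | k
  · rw [coaS_stS_zero, map_zero]; simp
  · rw [coaS_stS_succ, map_smul, cocS_stS]
    push_cast
    rfl

lemma inner_hamS (φ ψ : Schw) :
    inner ℂ (toL2 (hamS b φ)) (toL2 ψ) = inner ℂ (toL2 φ) (toL2 (hamS b ψ)) := by
  rw [hamS_apply, hamS_apply, map_add, map_add, inner_add_left, inner_add_right]
  simp only [inner_piS]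

lemma inner_coaS (φ ψ : Schw) :
    inner ℂ (toL2 (coaS b φ)) (toL2 ψ) = inner ℂ (toL2 φ) (toL2 (cocS b ψ)) := by
  rw [← inner_conj_symm, ← inner_cocS, inner_conj_symm]

lemma eq_zero_of_inner_eq {r s : ℝ} (hrs : r ≠ s) {c : ℂ}
    (h : conj (r : ℂ) * c = (s : ℂ) * c) : c = 0 := by
  rw [Complex.conj_ofReal, ← sub_eq_zero, ← sub_mul] at h
  rcases mul_eq_zero.1 h with h | h
  · exact absurd (Complex.ofReal_injective (sub_eq_zero.1 h)) hrs
  · exact h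

include hb in
lemma level_strictMono : StrictMono (level b) := by
  intro p q h
  unfold level
  have : (p : ℝ) < q := by exact_mod_cast h
  nlinarith

/-- The states are joint eigenvectors of the symmetric operators H₀ and c†c, whose eigenvalues
determine q and k. -/
lemma inner_stS_of_ne {k q k' q' : ℕ} (h : (k, q) ≠ (k', q')) :
    inner ℂ (toL2 (stS hb k q)) (toL2 (stS hb k' q')) = 0 := by
  by_cases hq : q = q'
  · have hk : k ≠ k' := by rintro rfl; exact h (by rw [hq])
    have e : inner ℂ (toL2 (cocS b (coaS b (stS hb k q)))) (toL2 (stS hb k' q')) =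
        inner ℂ (toL2 (stS hb k q)) (toL2 (cocS b (coaS b (stS hb k' q')))) := by
      rw [inner_cocS, inner_coaS]
    rw [cocS_coaS_stS, cocS_coaS_stS, map_smul, map_smul, inner_smul_left, inner_smul_right] at e
    refine eq_zero_of_inner_eq ?_ e
    intro h
    have : (k : ℝ) = k' := mul_left_cancel₀ (by positivity) h
    exact hk (by exact_mod_cast this)
  · have e := inner_hamS (b := b) (stS hb k q) (stS hb k' q')
    rw [hamS_stS, hamS_stS, map_smul, map_smul, inner_smul_left, inner_smul_right] at e
    exact eq_zero_of_inner_eq (fun h => hq ((level_strictMono hb).injective h)) e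

lemma norm_sq_toL2_eq (φ : Schw) : ((‖toL2 φ‖ ^ 2 : ℝ) : ℂ) = inner ℂ (toL2 φ) (toL2 φ) := by
  rw [inner_self_eq_norm_sq_to_K]; push_cast; rfl

lemma norm_sq_stS_succ (k q : ℕ) :
    ‖toL2 (stS hb k (q + 1))‖ ^ 2 = 2 * b * (q + 1) * ‖toL2 (stS hb k q)‖ ^ 2 := by
  apply Complex.ofReal_injective
  rw [norm_sq_toL2_eq]
  conv_lhs => rw [← creS_stS, inner_creS, creS_stS, annS_stS_succ, map_smul, inner_smul_right,
    ← norm_sq_toL2_eq]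
  push_cast
  ring

lemma norm_sq_stS_succ_left (k q : ℕ) :
    ‖toL2 (stS hb (k + 1) q)‖ ^ 2 = 2 * b * (k + 1) * ‖toL2 (stS hb k q)‖ ^ 2 := by
  apply Complex.ofReal_injective
  rw [norm_sq_toL2_eq]
  conv_lhs => rw [← cocS_stS, inner_cocS, cocS_stS, coaS_stS_succ, map_smul, inner_smul_right,
    ← norm_sq_toL2_eq]
  push_cast
  ring

lemma norm_stS_pos (k q : ℕ) : 0 < ‖toL2 (stS hb k q)‖ := by
  have h0 : 0 < ‖toL2 (stS hb 0 0)‖ := by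
    rw [norm_pos_iff, stS_zero_zero]
    exact fun h => gaussS_ne_zero hb (toL2_injective (h.trans (map_zero toL2).symm))
  have hk : ∀ k, 0 < ‖toL2 (stS hb k 0)‖ := by
    intro k
    induction k with
    | zero => exact h0
    | succ k ih =>
      have : 0 < ‖toL2 (stS hb (k + 1) 0)‖ ^ 2 := by rw [norm_sq_stS_succ_left]; positivity
      exact lt_of_le_of_ne (norm_nonneg _) (fun h => by rw [← h] at this; simp at this)
  induction q with
  | zero => exact hk k
  | succ q ih =>
    have : 0 < ‖toL2 (stS hb k (q + 1))‖ ^ 2 := by rw [norm_sq_stS_succ]; positivity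
    exact lt_of_le_of_ne (norm_nonneg _) (fun h => by rw [← h] at this; simp at this)

/-- The normalized Landau states. -/
def stN (i : ℕ × ℕ) : L2 :=
  ((‖toL2 (stS hb i.1 i.2)‖⁻¹ : ℝ) : ℂ) • toL2 (stS hb i.1 i.2)

lemma orthonormal_stN : Orthonormal ℂ (stN hb) := by
  constructor
  · intro i
    rw [stN, norm_smul]
    simp [(norm_stS_pos hb i.1 i.2).ne']
  · intro i j hij
    rw [stN, stN, inner_smul_left, inner_smul_right, inner_stS_of_ne hb hij]
    simp

/-! ### Completeness of the Landau states -/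

/-- The span of the Landau states. -/
def stSpan : Submodule ℂ Schw := Submodule.span ℂ (range fun i : ℕ × ℕ => stS hb i.1 i.2)

lemma stS_mem (k q : ℕ) : stS hb k q ∈ stSpan hb := Submodule.subset_span ⟨(k, q), rfl⟩

lemma map_mem_stSpan {L : Schw →L[ℂ] Schw} (h : ∀ k q, L (stS hb k q) ∈ stSpan hb) {φ : Schw}
    (hφ : φ ∈ stSpan hb) : L φ ∈ stSpan hb := by
  have : stSpan hb ≤ (stSpan hb).comap (L : Schw →ₗ[ℂ] Schw) := by
    refine Submodule.span_le.2 ?_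
    rintro _ ⟨i, rfl⟩
    exact h i.1 i.2
  exact this hφ

lemma annS_mem_stSpan {φ : Schw} (hφ : φ ∈ stSpan hb) : annS b φ ∈ stSpan hb := by
  refine map_mem_stSpan hb (fun k q => ?_) hφ
  rcases q with _ | q
  · rw [annS_stS_zero]; exact zero_mem _
  · rw [annS_stS_succ]; exact Submodule.smul_mem _ _ (stS_mem hb _ _)

lemma coaS_mem_stSpan {φ : Schw} (hφ : φ ∈ stSpan hb) : coaS b φ ∈ stSpan hb := by
  refine map_mem_stSpan hb (fun k q => ?_) hφ
  rcases k with _ | k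
  · rw [coaS_stS_zero]; exact zero_mem _
  · rw [coaS_stS_succ]; exact Submodule.smul_mem _ _ (stS_mem hb _ _)

lemma creS_mem_stSpan {φ : Schw} (hφ : φ ∈ stSpan hb) : creS b φ ∈ stSpan hb :=
  map_mem_stSpan hb (fun k q => by rw [creS_stS]; exact stS_mem hb _ _) hφ

lemma cocS_mem_stSpan {φ : Schw} (hφ : φ ∈ stSpan hb) : cocS b φ ∈ stSpan hb :=
  map_mem_stSpan hb (fun k q => by rw [cocS_stS]; exact stS_mem hb _ _) hφ

/-- i b z = c† - a and i b z̄ = a† - c, and all four ladder operators preserve the span. Hence it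
contains every polynomial times the Gaussian. -/
lemma mulS_coord_mem_stSpan (l : Fin 2) {φ : Schw} (hφ : φ ∈ stSpan hb) :
    mulS (fun x => (x l : ℂ)) φ ∈ stSpan hb := by
  have hIb : Complex.I * (b : ℂ) ≠ 0 :=
    mul_ne_zero Complex.I_ne_zero (Complex.ofReal_ne_zero.2 hb.ne')
  have hz : mulS zf φ ∈ stSpan hb := by
    have : mulS zf φ = (Complex.I * (b : ℂ))⁻¹ • (cocS b φ - annS b φ) := by
      rw [eq_inv_smul_iff₀ hIb, cocS_apply, add_sub_cancel_left]
    rw [this]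
    exact Submodule.smul_mem _ _ (Submodule.sub_mem _ (cocS_mem_stSpan hb hφ)
      (annS_mem_stSpan hb hφ))
  have hzb : mulS zbf φ ∈ stSpan hb := by
    have : mulS zbf φ = (Complex.I * (b : ℂ))⁻¹ • (creS b φ - coaS b φ) := by
      rw [eq_inv_smul_iff₀ hIb, coaS_apply]; abel
    rw [this]
    exact Submodule.smul_mem _ _ (Submodule.sub_mem _ (creS_mem_stSpan hb hφ)
      (coaS_mem_stSpan hb hφ))
  fin_cases l
  · have : mulS (fun x => (x 0 : ℂ)) φ = (1 / 2 : ℂ) • (mulS zf φ + mulS zbf φ) := by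
      rw [mulS_zf, mulS_zbf]; module
    simp only [Fin.zero_eta, this]
    exact Submodule.smul_mem _ _ (Submodule.add_mem _ hz hzb)
  · have : mulS (fun x => (x 1 : ℂ)) φ = (-Complex.I / 2 : ℂ) • (mulS zf φ - mulS zbf φ) := by
      rw [mulS_zf, mulS_zbf]
      match_scalars <;> first | ring1 | linear_combination Complex.I_mul_I
    simp only [Fin.mk_one, this]
    exact Submodule.smul_mem _ _ (Submodule.sub_mem _ hz hzb)

/-- The complex-valued linear form `⟨ξ, x⟩`. -/
def linf (ξ : Plane) (x : Plane) : ℂ := ((inner ℝ x ξ : ℝ) : ℂ)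

lemma linf_eq (ξ x : Plane) : linf ξ x = (ξ 0 : ℂ) * (x 0 : ℂ) + (ξ 1 : ℂ) * (x 1 : ℂ) := by
  simp [linf, PiLp.inner_apply]

lemma hasTemperateGrowth_linf (ξ : Plane) : HasTemperateGrowth (linf ξ) := by
  have : linf ξ = fun x => (ξ 0 : ℂ) * (x 0 : ℂ) + (ξ 1 : ℂ) * (x 1 : ℂ) := by
    ext x; exact linf_eq ξ x
  rw [this]
  exact ((HasTemperateGrowth.const _).mul (hasTemperateGrowth_coord 0)).add
    ((HasTemperateGrowth.const _).mul (hasTemperateGrowth_coord 1))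

lemma linf_pow_gauss_mem (ξ : Plane) (n : ℕ) :
    (mulS (linf ξ))^[n] (gaussS hb) ∈ stSpan hb := by
  induction n with
  | zero => exact stS_mem hb 0 0
  | succ n ih =>
    rw [Function.iterate_succ_apply']
    set φ := (mulS (linf ξ))^[n] (gaussS hb)
    have : mulS (linf ξ) φ = (ξ 0 : ℂ) • mulS (fun x => (x 0 : ℂ)) φ +
        (ξ 1 : ℂ) • mulS (fun x => (x 1 : ℂ)) φ := by
      ext x
      rw [mulS_apply (hasTemperateGrowth_linf ξ), add_apply, smul_apply, smul_apply,
        mulS_apply (hasTemperateGrowth_coord 0), mulS_apply (hasTemperateGrowth_coord 1), linf_eq,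
        smul_eq_mul, smul_eq_mul]
      ring
    rw [this]
    exact Submodule.add_mem _ (Submodule.smul_mem _ _ (mulS_coord_mem_stSpan hb 0 ih))
      (Submodule.smul_mem _ _ (mulS_coord_mem_stSpan hb 1 ih))

lemma linf_pow_gauss_apply (ξ : Plane) (n : ℕ) (x : Plane) :
    (mulS (linf ξ))^[n] (gaussS hb) x = linf ξ x ^ n * gaussFun b x := by
  induction n with
  | zero => simp [gaussS_apply]
  | succ n ih =>
    rw [Function.iterate_succ_apply', mulS_apply (hasTemperateGrowth_linf ξ), ih]
    ring

include hb in
/-- The function `e^{c|x|} e^{-b|x|²/4}` is square integrable. -/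
lemma memLp_exp_mul_gauss (c : ℝ) :
    MemLp (fun x : Plane => (Real.exp (c * ‖x‖) : ℂ) * gaussFun b x) 2 volume := by
  -- The dominating function is a wider Gaussian, e^{-b|x|²/8}; completing the square produces the
  -- factor e^{2c²/b}.
  have hb2 : 0 < b / 2 := by positivity
  refine MemLp.of_le_mul (c := Real.exp (2 * c ^ 2 / b))
    ((gaussS hb2).memLp 2 volume) ?_ (Eventually.of_forall fun x => ?_)
  · have h1 : Continuous (gaussFun b) := (contDiff_gaussFun b).continuous
    have h2 : Continuous (fun x : Plane => (Real.exp (c * ‖x‖) : ℂ)) := by fun_prop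
    exact (h2.mul h1).aestronglyMeasurable
  · rw [norm_mul, gaussS_apply, gaussFun, gaussFun, Complex.norm_real, Complex.norm_real,
      Complex.norm_real, Real.norm_eq_abs, Real.norm_eq_abs, Real.norm_eq_abs, Real.abs_exp,
      Real.abs_exp, Real.abs_exp, ← Real.exp_add, ← Real.exp_add]
    refine Real.exp_le_exp.2 ?_
    have : 0 ≤ (b * ‖x‖ / 2 - 2 * c) ^ 2 / (2 * b) := by positivity
    have e : (b * ‖x‖ / 2 - 2 * c) ^ 2 / (2 * b) = b / 8 * ‖x‖ ^ 2 - c * ‖x‖ + 2 * c ^ 2 / b := by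
      field_simp; ring
    linarith

/-- An integrable function with vanishing Fourier transform vanishes. -/
lemma ae_eq_zero_of_fourier_eq_zero {f : Plane → ℂ} (hf : Integrable f)
    (h : ∀ ξ, FourierTransform.fourier f ξ = 0) : f =ᵐ[volume] 0 := by
  refine ae_eq_zero_of_integral_contDiff_smul_eq_zero hf.locallyIntegrable fun g hg hgc => ?_
  have hgc' : HasCompactSupport (fun x => (g x : ℂ)) := hgc.comp_left (g := ((↑) : ℝ → ℂ)) rfl
  have hg' : ContDiff ℝ ∞ (fun x => (g x : ℂ)) := Complex.ofRealCLM.contDiff.comp hg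
  set ψ : Schw := hgc'.toSchwartzMap hg'
  set χ : Schw := FourierTransformInv.fourierInv ψ
  have hχ : FourierTransform.fourier χ = ψ := FourierTransform.fourier_fourierInv_eq ψ
  -- The test function is the Fourier transform of a Schwartz function, so the transform can be
  -- moved onto f, where it vanishes.
  have h1 := VectorFourier.integral_fourierIntegral_smul_eq_flip (L := innerₗ Plane)
    (e := Real.fourierChar) Real.continuous_fourierChar continuous_inner (χ.integrable (μ := volume)) hf
  have h2 : ∀ x, VectorFourier.fourierIntegral Real.fourierChar volume (innerₗ Plane) χ x = ψ x := by
    intro x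
    rw [← hχ]; rfl
  have h3 : ∀ x, VectorFourier.fourierIntegral Real.fourierChar volume (innerₗ Plane).flip f x = 0 := by
    intro x
    rw [flip_innerₗ]
    exact h x
  simp only [h2, h3, smul_zero, integral_zero] at h1
  rw [← h1]
  congr 1

/-- Orthogonality makes all moments of f = Gaussian · u vanish. As e^{c|x|} f is integrable for
every c, the exponential series may be integrated term by term, so the Fourier transform of f is
zero. -/
theorem eq_zero_of_orthogonal_stN {u : L2} (hu : ∀ i, inner ℂ (stN hb i) u = 0) : u = 0 := by
  have h1 : ∀ φ ∈ stSpan hb, inner ℂ (toL2 φ) u = 0 := by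
    intro φ hφ
    induction hφ using Submodule.span_induction with
    | mem φ h =>
      obtain ⟨i, rfl⟩ := h
      have h2 := hu i
      rw [stN, inner_smul_left] at h2
      rcases mul_eq_zero.1 h2 with h2 | h2
      · simp [(norm_stS_pos hb i.1 i.2).ne'] at h2
      · exact h2
    | zero => simp
    | add φ ψ _ _ h1 h2 => rw [map_add, inner_add_left, h1, h2, add_zero]
    | smul c φ _ h1 => rw [map_smul, inner_smul_left, h1, mul_zero]
  set f : Plane → ℂ := fun x => gaussFun b x * u x with hf
  have hexp : ∀ c : ℝ, Integrable (fun x => (Real.exp (c * ‖x‖) : ℂ) * f x) := by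
    intro c
    have := (Lp.memLp u).integrable_mul (memLp_exp_mul_gauss hb c)
    refine this.congr (Eventually.of_forall fun x => ?_)
    simp only [Pi.mul_apply, hf]
    ring
  have hfint : Integrable f := by
    have := hexp 0
    simpa using this
  have hmom : ∀ (ξ : Plane) (n : ℕ), ∫ x, linf ξ x ^ n * f x = 0 := by
    intro ξ n
    have h2 := h1 _ (linf_pow_gauss_mem hb ξ n)
    rw [L2.inner_def] at h2
    rw [← h2]
    refine integral_congr_ae ?_
    filter_upwards [coeFn_toL2 ((mulS (linf ξ))^[n] (gaussS hb))] with x hx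
    rw [hx, linf_pow_gauss_apply, RCLike.inner_apply', map_mul, map_pow]
    simp only [linf, gaussFun, Complex.conj_ofReal, hf]
    ring
  have hfour : ∀ ξ, FourierTransform.fourier f ξ = 0 := by
    intro ξ
    rw [Real.fourier_eq']
    set w : Plane → ℂ := fun x => ((-2 * Real.pi * inner ℝ x ξ : ℝ) : ℂ) * Complex.I with hw
    have hwl : ∀ x, w x = (-2 * Real.pi * Complex.I) * linf ξ x := by
      intro x; simp only [hw, linf]; push_cast; ring
    have hwn : ∀ x, ‖w x‖ ≤ 2 * Real.pi * ‖ξ‖ * ‖x‖ := by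
      intro x
      have : ‖w x‖ = 2 * Real.pi * |inner ℝ x ξ| := by
        rw [hw, norm_mul, Complex.norm_I, mul_one, Complex.norm_real, Real.norm_eq_abs, abs_mul,
          abs_mul, abs_of_pos Real.pi_pos]
        norm_num
      rw [this]
      have h2 := abs_real_inner_le_norm x ξ
      have := Real.pi_pos
      calc 2 * Real.pi * |inner ℝ x ξ| ≤ 2 * Real.pi * (‖x‖ * ‖ξ‖) := by gcongr
        _ = _ := by ring
    have hs := hasSum_integral_of_dominated_convergence (μ := (volume : Measure Plane))
      (F := fun (n : ℕ) x => (w x ^ n / (n.factorial : ℂ)) * f x)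
      (f := fun x => Complex.exp (w x) * f x)
      (fun n x => ((2 * Real.pi * ‖ξ‖ * ‖x‖) ^ n / n.factorial) * ‖f x‖)
      (fun n => by
        have : Continuous w := by
          rw [hw]; fun_prop
        exact ((this.pow n).div_const _).aestronglyMeasurable.mul hfint.aestronglyMeasurable)
      (fun n => Eventually.of_forall fun x => by
        rw [norm_mul, norm_div, norm_pow, Complex.norm_natCast]
        gcongr
        exact hwn x)
      (Eventually.of_forall fun x => (Real.summable_pow_div_factorial _).mul_right _)
      (by
        refine ((hexp (2 * Real.pi * ‖ξ‖)).norm).congr (Eventually.of_forall fun x => ?_)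
        simp only
        rw [tsum_mul_right, norm_mul, Complex.norm_real, Real.norm_eq_abs, Real.abs_exp,
          Real.exp_eq_exp_ℝ, NormedSpace.exp_eq_tsum_div])
      (Eventually.of_forall fun x => by
        have h3 := NormedSpace.expSeries_div_hasSum_exp (w x)
        rw [← Complex.exp_eq_exp_ℂ] at h3
        exact h3.mul_right _)
    have hz : ∀ n : ℕ, ∫ x, (w x ^ n / (n.factorial : ℂ)) * f x = 0 := by
      intro n
      have : ∀ x, (w x ^ n / (n.factorial : ℂ)) * f x =
          ((-2 * Real.pi * Complex.I) ^ n / (n.factorial : ℂ)) * (linf ξ x ^ n * f x) := by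
        intro x; rw [hwl, mul_pow]; ring
      simp only [this]
      rw [integral_const_mul, hmom, mul_zero]
    simp only [hz] at hs
    have := hs.unique hasSum_zero
    simpa only [smul_eq_mul] using this
  have hzero := ae_eq_zero_of_fourier_eq_zero hfint hfour
  refine Lp.ext ?_
  filter_upwards [hzero, Lp.coeFn_zero ℂ 2 (volume : Measure Plane)] with x hx h0
  rw [h0]
  have : gaussFun b x * u x = 0 := hx
  rcases mul_eq_zero.1 this with h | h
  · rw [gaussFun] at h
    exact absurd (Complex.ofReal_eq_zero.1 h) (Real.exp_pos _).ne'
  · exact h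

/-- The Hilbert basis of Landau states. -/
def basis : HilbertBasis (ℕ × ℕ) ℂ L2 :=
  HilbertBasis.mkOfOrthogonalEqBot (orthonormal_stN hb) (by
    rw [Submodule.eq_bot_iff]
    intro u hu
    refine eq_zero_of_orthogonal_stN hb fun i => ?_
    exact (Submodule.mem_orthogonal _ _).1 hu _ (Submodule.subset_span ⟨i, rfl⟩))

lemma basis_apply (i : ℕ × ℕ) : basis hb i = stN hb i := by
  rw [basis, HilbertBasis.coe_mkOfOrthogonalEqBot]

end Landau

end

noncomputable section

namespace Landau

open Function (HasTemperateGrowth)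

/-! ### A priori estimates for second order operators on Schwartz functions -/

lemma norm_toL2_mulS_le {f : Plane → ℂ} (hf : HasTemperateGrowth f) {N : ℝ}
    (hN : ∀ x, ‖f x‖ ≤ N) (φ : Schw) : ‖toL2 (mulS f φ)‖ ≤ N * ‖toL2 φ‖ := by
  refine Lp.norm_le_mul_norm_of_ae_le_mul ?_
  filter_upwards [coeFn_toL2 (mulS f φ), coeFn_toL2 φ] with x h1 h2
  rw [h1, h2, mulS_apply hf, norm_mul]
  exact mul_le_mul_of_nonneg_right (hN x) (norm_nonneg _)

lemma integrable_conj_mul (φ ψ : Schw) : Integrable (fun x => conj (φ x) * ψ x) := by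
  refine (L2.integrable_inner (𝕜 := ℂ) (toL2 φ) (toL2 ψ)).congr ?_
  filter_upwards [coeFn_toL2 φ, coeFn_toL2 ψ] with x h1 h2
  rw [h1, h2, RCLike.inner_apply']

lemma norm_sq_toL2 (φ : Schw) : ‖toL2 φ‖ ^ 2 = ∫ x, (conj (φ x) * φ x).re := by
  have h := norm_sq_toL2_eq φ
  rw [inner_toL2] at h
  have h2 := congrArg Complex.re h
  rw [Complex.ofReal_re] at h2
  rw [h2]
  exact (integral_re (𝕜 := ℂ) (integrable_conj_mul φ φ)).symm

lemma re_inner_toL2 (φ ψ : Schw) :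
    (inner ℂ (toL2 φ) (toL2 ψ)).re = ∫ x, (conj (φ x) * ψ x).re := by
  rw [inner_toL2]
  exact (integral_re (𝕜 := ℂ) (integrable_conj_mul φ ψ)).symm

/-- A matrix of coefficients which is uniformly elliptic with constant `c` and, together with its
first derivatives, bounded by `N`. -/
structure IsElliptic (n : Fin 2 → Fin 2 → Plane → ℂ) (c N : ℝ) : Prop where
  temperate : ∀ j k, HasTemperateGrowth (n j k)
  bound : ∀ j k x, ‖n j k x‖ ≤ N
  bound_pd : ∀ l j k x, ‖pd l (n j k) x‖ ≤ N
  lower : ∀ x (z : Fin 2 → ℂ),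
    c * ∑ j, ‖z j‖ ^ 2 ≤ (∑ j, ∑ k, conj (z j) * (n j k x * z k)).re

lemma form_lower {n : Fin 2 → Fin 2 → Plane → ℂ} {c : ℝ}
    (ht : ∀ j k, HasTemperateGrowth (n j k))
    (hl : ∀ x (z : Fin 2 → ℂ),
      c * ∑ j, ‖z j‖ ^ 2 ≤ (∑ j, ∑ k, conj (z j) * (n j k x * z k)).re) (w : Fin 2 → Schw) :
    c * ∑ j, ‖toL2 (w j)‖ ^ 2 ≤
      (∑ j, ∑ k, inner ℂ (toL2 (w j)) (toL2 (mulS (n j k) (w k)))).re := by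
  simp only [Complex.re_sum, norm_sq_toL2, re_inner_toL2]
  have hi : ∀ φ ψ : Schw, Integrable (fun x => (conj (φ x) * ψ x).re) :=
    fun φ ψ => (integrable_conj_mul φ ψ).re
  rw [← integral_finsetSum _ fun j _ => hi _ _, ← integral_const_mul]
  have e : ∑ j, ∑ k, ∫ x, (conj (w j x) * mulS (n j k) (w k) x).re =
      ∫ x, ∑ j, ∑ k, (conj (w j x) * mulS (n j k) (w k) x).re := by
    rw [integral_finsetSum _ fun j _ => integrable_finsetSum _ fun k _ => hi _ _]
    exact Finset.sum_congr rfl fun j _ => (integral_finsetSum _ fun k _ => hi _ _).symm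
  rw [e]
  refine integral_mono ?_ ?_ fun x => ?_
  · exact (integrable_finsetSum _ fun j _ => hi _ _).const_mul c
  · exact integrable_finsetSum _ fun j _ => integrable_finsetSum _ fun k _ => hi _ _
  · have h := hl x (fun j => w j x)
    simp only [Complex.re_sum] at h
    simp only [mulS_apply (ht _ _)]
    refine le_trans (le_of_eq ?_) h
    congr 1
    refine Finset.sum_congr rfl fun j _ => ?_
    rw [mul_comm, Complex.mul_conj, Complex.ofReal_re, Complex.normSq_eq_norm_sq]

/-- The second order operator `∑ Π_j n_{jk} Π_k` on Schwartz functions. -/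
def divS (b : ℝ) (n : Fin 2 → Fin 2 → Plane → ℂ) : Schw →L[ℂ] Schw :=
  ∑ j, ∑ k, piS b j ∘L mulS (n j k) ∘L piS b k

lemma divS_apply (b : ℝ) (n : Fin 2 → Fin 2 → Plane → ℂ) (φ : Schw) :
    divS b n φ = ∑ j, ∑ k, piS b j (mulS (n j k) (piS b k φ)) := by
  simp [divS]

lemma inner_divS (b : ℝ) (n : Fin 2 → Fin 2 → Plane → ℂ) (φ ψ : Schw) :
    inner ℂ (toL2 φ) (toL2 (divS b n ψ)) =
      ∑ j, ∑ k, inner ℂ (toL2 (piS b j φ)) (toL2 (mulS (n j k) (piS b k ψ))) := by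
  rw [divS_apply]
  simp only [map_sum, inner_sum, inner_piS]

variable {b : ℝ}

/-- Two expressions for ⟨φ, H₀ φ⟩; the second shows H₀ ≥ b. -/
lemma sum_norm_sq_piS (φ : Schw) :
    ∑ j, ‖toL2 (piS b j φ)‖ ^ 2 = ‖toL2 (annS b φ)‖ ^ 2 + b * ‖toL2 φ‖ ^ 2 := by
  have h : inner ℂ (toL2 φ) (toL2 (hamS b φ)) = inner ℂ (toL2 φ) (toL2 (hamS b φ)) := rfl
  conv_lhs at h => rw [hamS_apply]
  conv_rhs at h => rw [hamS_eq]
  simp only [map_add, inner_add_right, ← inner_piS, ← inner_annS, map_smul, inner_smul_right,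
    ← norm_sq_toL2_eq] at h
  rw [Fin.sum_univ_two]
  exact_mod_cast h

lemma norm_le_of_sq_le {x y c : ℝ} (hc : 0 < c) (hx : 0 ≤ x) (hy : 0 ≤ y)
    (h : c * x ^ 2 ≤ x * y) : x ≤ c⁻¹ * y := by
  rcases hx.eq_or_lt with rfl | hx
  · positivity
  · rw [inv_mul_eq_div, le_div_iff₀ hc]
    have : x * (x * c) ≤ x * y := by linarith [h, sq x, show c * x ^ 2 = x * (x * c) by ring]
    exact le_of_mul_le_mul_left this hx

/-- Ellipticity bounds the form of the operator below by c times that of H₀, hence by c b‖φ‖²;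
Cauchy–Schwarz does the rest. -/
lemma first_order_bound (hb : 0 < b) {n : Fin 2 → Fin 2 → Plane → ℂ} {c N : ℝ} (hc : 0 < c)
    (hn : IsElliptic n c N) (φ : Schw) :
    ‖toL2 φ‖ ≤ (c * b)⁻¹ * ‖toL2 (divS b n φ)‖ ∧
      c * ∑ j, ‖toL2 (piS b j φ)‖ ^ 2 ≤ (c * b)⁻¹ * ‖toL2 (divS b n φ)‖ ^ 2 := by
  have h1 := form_lower hn.temperate hn.lower (fun j => piS b j φ)
  rw [← inner_divS] at h1
  have h2 : (inner ℂ (toL2 φ) (toL2 (divS b n φ))).re ≤ ‖toL2 φ‖ * ‖toL2 (divS b n φ)‖ :=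
    re_inner_le_norm (𝕜 := ℂ) _ _
  have h3 := sum_norm_sq_piS (b := b) φ
  have h4 : b * ‖toL2 φ‖ ^ 2 ≤ ∑ j, ‖toL2 (piS b j φ)‖ ^ 2 := by
    rw [h3]; linarith [sq_nonneg ‖toL2 (annS b φ)‖]
  have h5 : ‖toL2 φ‖ ≤ (c * b)⁻¹ * ‖toL2 (divS b n φ)‖ := by
    refine norm_le_of_sq_le (by positivity) (norm_nonneg _) (norm_nonneg _) ?_
    calc c * b * ‖toL2 φ‖ ^ 2 = c * (b * ‖toL2 φ‖ ^ 2) := by ring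
      _ ≤ _ := (mul_le_mul_of_nonneg_left h4 hc.le).trans (h1.trans h2)
  refine ⟨h5, h1.trans (h2.trans ?_)⟩
  calc _ ≤ ((c * b)⁻¹ * ‖toL2 (divS b n φ)‖) * ‖toL2 (divS b n φ)‖ :=
        mul_le_mul_of_nonneg_right h5 (norm_nonneg _)
    _ = _ := by ring

/-- The antisymmetric symbol in the commutation relation `[Π_j, Π_l] = i b ε_{jl}`. -/
def symb (j l : Fin 2) : ℝ := !![0, 1; -1, 0] j l

lemma abs_symb_le (j l : Fin 2) : |symb j l| ≤ 1 := by
  fin_cases j <;> fin_cases l <;> simp [symb]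

lemma piS_piS (j l : Fin 2) (φ : Schw) :
    piS b j (piS b l φ) = piS b l (piS b j φ) + (Complex.I * ((b * symb j l : ℝ) : ℂ)) • φ := by
  fin_cases j <;> fin_cases l
  · simp [symb]
  · simpa [symb] using piS_comm b φ
  · have := piS_comm b φ
    simp only [symb, Fin.mk_one, Fin.zero_eta]
    rw [this]
    simp
  · simp [symb]

/-- Moving Π_j to the left and Π_l to the right costs two commutators of size b. Taking χ = n_{jk}
Π_k φ then leads to the elliptic form evaluated on the vector (Π_l Π_j φ)_j. -/
lemma inner_second_order (l j : Fin 2) (φ χ : Schw) :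
    inner ℂ (toL2 (piS b l (piS b l φ))) (toL2 (piS b j χ)) =
      inner ℂ (toL2 (piS b l (piS b j φ))) (toL2 (piS b l χ)) -
        2 * (Complex.I * ((b * symb j l : ℝ) : ℂ)) * inner ℂ (toL2 (piS b l φ)) (toL2 χ) := by
  have hc : conj (Complex.I * ((b * symb j l : ℝ) : ℂ)) =
      -(Complex.I * ((b * symb j l : ℝ) : ℂ)) := by
    rw [map_mul, Complex.conj_I, Complex.conj_ofReal, neg_mul]
  rw [← inner_piS, piS_piS j l (piS b l φ), map_add, inner_add_left, map_smul, inner_smul_left, hc,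
    inner_piS b l (piS b j (piS b l φ)), piS_piS j l φ, map_add, inner_add_left, map_smul,
    inner_smul_left, hc, ← inner_piS b l φ χ]
  ring

lemma inner_second_order_ge (hb : 0 < b) {f : Plane → ℂ} (hf : HasTemperateGrowth f) {N : ℝ}
    (l j k : Fin 2) (h0 : ∀ x, ‖f x‖ ≤ N) (h1 : ∀ x, ‖pd l f x‖ ≤ N) (φ : Schw) :
    (inner ℂ (toL2 (piS b l (piS b j φ))) (toL2 (mulS f (piS b l (piS b k φ))))).re
        - N * ‖toL2 (piS b l (piS b j φ))‖ * ‖toL2 (piS b k φ)‖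
        - 2 * b * N * ‖toL2 (piS b l φ)‖ * ‖toL2 (piS b k φ)‖ ≤
      (inner ℂ (toL2 (piS b l (piS b l φ))) (toL2 (piS b j (mulS f (piS b k φ))))).re := by
  rw [inner_second_order, piS_mulS hf, map_sub, inner_sub_right, map_smul, inner_smul_right,
    Complex.sub_re, Complex.sub_re]
  have e1 : (Complex.I * inner ℂ (toL2 (piS b l (piS b j φ)))
      (toL2 (mulS (pd l f) (piS b k φ)))).re ≤
      N * ‖toL2 (piS b l (piS b j φ))‖ * ‖toL2 (piS b k φ)‖ := by
    refine (Complex.re_le_norm _).trans ?_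
    rw [norm_mul, Complex.norm_I, one_mul]
    refine (norm_inner_le_norm _ _).trans ?_
    calc _ ≤ ‖toL2 (piS b l (piS b j φ))‖ * (N * ‖toL2 (piS b k φ)‖) :=
          mul_le_mul_of_nonneg_left (norm_toL2_mulS_le (hasTemperateGrowth_pd hf l) h1 _)
            (norm_nonneg _)
      _ = _ := by ring
  have e2 : (2 * (Complex.I * ((b * symb j l : ℝ) : ℂ)) *
      inner ℂ (toL2 (piS b l φ)) (toL2 (mulS f (piS b k φ)))).re ≤
      2 * b * N * ‖toL2 (piS b l φ)‖ * ‖toL2 (piS b k φ)‖ := by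
    refine (Complex.re_le_norm _).trans ?_
    rw [norm_mul, norm_mul, norm_mul, Complex.norm_I, one_mul, Complex.norm_real,
      Real.norm_eq_abs, abs_mul, abs_of_pos hb, Complex.norm_ofNat]
    have h2 := (norm_inner_le_norm (𝕜 := ℂ) (toL2 (piS b l φ)) (toL2 (mulS f (piS b k φ)))).trans
      (mul_le_mul_of_nonneg_left (norm_toL2_mulS_le hf h0 (piS b k φ)) (norm_nonneg _))
    calc _ ≤ 2 * (b * 1) * (‖toL2 (piS b l φ)‖ * (N * ‖toL2 (piS b k φ)‖)) := by
          gcongr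
          exact abs_symb_le j l
      _ = _ := by ring
  linarith

/-- Either S ≤ X, or X ≤ S and the inequality can be divided by S. -/
lemma quad_bound {c A B S X : ℝ} (hc : 0 < c) (hA : 0 ≤ A) (hB : 0 ≤ B) (hX : 0 ≤ X)
    (h : c * S ^ 2 ≤ A * (S * X) + B * X ^ 2) : S ≤ ((A + B) / c + 1) * X := by
  by_contra! hlt
  have h1 : X ≤ S := by
    refine le_trans ?_ hlt.le
    have : 0 ≤ (A + B) / c := by positivity
    nlinarith
  have hS' : 0 < S := lt_of_le_of_lt (by positivity) hlt
  have h2 : c * S ^ 2 ≤ (A + B) * (S * X) := by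
    have : B * X ^ 2 ≤ B * (S * X) := by
      apply mul_le_mul_of_nonneg_left _ hB
      rw [sq]; exact mul_le_mul_of_nonneg_right h1 hX
    linarith
  have h3 : c * S ≤ (A + B) * X := by
    refine le_of_mul_le_mul_left ?_ hS'
    calc S * (c * S) = c * S ^ 2 := by ring
      _ ≤ _ := h2
      _ = _ := by ring
  have h4 : S ≤ (A + B) / c * X := by
    rw [div_mul_eq_mul_div, le_div_iff₀ hc]; linarith
  linarith

lemma sum_inner_divS_le (n : Fin 2 → Fin 2 → Plane → ℂ) (φ : Schw) {S : ℝ}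
    (hle : ∀ l j, ‖toL2 (piS b l (piS b j φ))‖ ≤ S) :
    ∑ l, ∑ j, ∑ k, (inner ℂ (toL2 (piS b l (piS b l φ)))
      (toL2 (piS b j (mulS (n j k) (piS b k φ))))).re ≤ 2 * (S * ‖toL2 (divS b n φ)‖) := by
  have e : ∀ l, ∑ j, ∑ k, (inner ℂ (toL2 (piS b l (piS b l φ)))
      (toL2 (piS b j (mulS (n j k) (piS b k φ))))).re =
      (inner ℂ (toL2 (piS b l (piS b l φ))) (toL2 (divS b n φ))).re := by
    intro l
    rw [divS_apply]
    simp only [map_sum, inner_sum, Complex.re_sum]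
  have e2 : ∀ l, (inner ℂ (toL2 (piS b l (piS b l φ))) (toL2 (divS b n φ))).re ≤
      S * ‖toL2 (divS b n φ)‖ := by
    intro l
    exact (re_inner_le_norm (𝕜 := ℂ) _ _).trans
      (mul_le_mul_of_nonneg_right (hle l l) (norm_nonneg _))
  rw [Finset.sum_congr rfl fun l _ => e l, Fin.sum_univ_two]
  linarith [e2 0, e2 1]

lemma error_arith {N D S X s p r R R' : ℝ} (hb : 0 ≤ b) (hN : 0 ≤ N) (hD : 0 ≤ D) (hX : 0 ≤ X)
    (hs : 0 ≤ s) (hp : 0 ≤ p) (hsS : s ≤ S) (hpX : p ≤ D * X) (hrX : r ≤ D * X)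
    (h : R - N * s * p - 2 * b * N * r * p ≤ R') :
    R ≤ R' + (N * D * (S * X) + 2 * b * N * D ^ 2 * X ^ 2) := by
  have hS : 0 ≤ S := hs.trans hsS
  have h3 : N * s * p ≤ N * S * (D * X) := by gcongr
  have h4 : 2 * b * N * r * p ≤ 2 * b * N * (D * X) * (D * X) := by gcongr
  have e3 : N * S * (D * X) = N * D * (S * X) := by ring
  have e4 : 2 * b * N * (D * X) * (D * X) = 2 * b * N * D ^ 2 * X ^ 2 := by ring
  linarith

lemma sum_le_sum_add {F G : Fin 2 → Fin 2 → Fin 2 → ℝ} {E : ℝ}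
    (h : ∀ l j k, F l j k ≤ G l j k + E) :
    ∑ l, ∑ j, ∑ k, F l j k ≤ ∑ l, ∑ j, ∑ k, G l j k + 8 * E := by
  simp only [Fin.sum_univ_two]
  linarith [h 0 0 0, h 0 0 1, h 0 1 0, h 0 1 1, h 1 0 0, h 1 0 1, h 1 1 0, h 1 1 1]

/-- Elliptic regularity: all second order expressions are controlled by `∑ Π_j n_{jk} Π_k φ`. -/
theorem second_order_bound (hb : 0 < b) {c : ℝ} (hc : 0 < c) (N : ℝ) :
    ∃ C : ℝ, 0 ≤ C ∧ ∀ n : Fin 2 → Fin 2 → Plane → ℂ, IsElliptic n c N → ∀ φ : Schw,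
      ‖toL2 φ‖ ≤ C * ‖toL2 (divS b n φ)‖ ∧
      (∀ k, ‖toL2 (piS b k φ)‖ ≤ C * ‖toL2 (divS b n φ)‖) ∧
      ∀ l k, ‖toL2 (piS b l (piS b k φ))‖ ≤ C * ‖toL2 (divS b n φ)‖ := by
  by_cases hN : 0 ≤ N
  swap
  · refine ⟨0, le_rfl, fun n hn => ?_⟩
    exact absurd ((norm_nonneg _).trans (hn.bound 0 0 0)) hN
  set D : ℝ := c⁻¹ * b.sqrt⁻¹ with hD
  have hD0 : 0 ≤ D := by positivity
  -- The 2 comes from the two values of l in the main term; the 8, and the 16 = 8 · 2 below, from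
  -- the commutator errors of the eight triples (l, j, k).
  set A : ℝ := 2 + 8 * N * D
  set B : ℝ := 16 * b * N * D ^ 2
  set C₂ : ℝ := (A + B) / c + 1
  have hA : 0 ≤ A := by positivity
  have hB : 0 ≤ B := by positivity
  refine ⟨(c * b)⁻¹ + D + C₂, by positivity, fun n hn φ => ?_⟩
  set X : ℝ := ‖toL2 (divS b n φ)‖
  have hX : 0 ≤ X := norm_nonneg _
  obtain ⟨h0, h1⟩ := first_order_bound hb hc hn φ
  have h1' : ∀ k, ‖toL2 (piS b k φ)‖ ≤ D * X := by
    intro k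
    refine abs_le_of_sq_le_sq' ?_ (by positivity) |>.2
    have h2 : ‖toL2 (piS b k φ)‖ ^ 2 ≤ ∑ j, ‖toL2 (piS b j φ)‖ ^ 2 :=
      Finset.single_le_sum (f := fun j => ‖toL2 (piS b j φ)‖ ^ 2) (fun j _ => sq_nonneg _)
        (Finset.mem_univ k)
    refine h2.trans ?_
    have h3 : ∑ j, ‖toL2 (piS b j φ)‖ ^ 2 ≤ c⁻¹ * ((c * b)⁻¹ * X ^ 2) := by
      rw [inv_mul_eq_div, le_div_iff₀ hc]; linarith
    refine h3.trans (le_of_eq ?_)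
    rw [hD, mul_pow, mul_pow, inv_pow, inv_pow, Real.sq_sqrt hb.le]
    field_simp
  set S : ℝ := √(∑ l, ∑ j, ‖toL2 (piS b l (piS b j φ))‖ ^ 2)
  have hSsq : S ^ 2 = ∑ l, ∑ j, ‖toL2 (piS b l (piS b j φ))‖ ^ 2 :=
    Real.sq_sqrt (Finset.sum_nonneg fun l _ => Finset.sum_nonneg fun j _ => sq_nonneg _)
  have hS0 : 0 ≤ S := Real.sqrt_nonneg _
  have hle : ∀ l j, ‖toL2 (piS b l (piS b j φ))‖ ≤ S := by
    intro l j
    refine Real.le_sqrt_of_sq_le ?_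
    refine le_trans ?_ (Finset.single_le_sum
      (f := fun l => ∑ j, ‖toL2 (piS b l (piS b j φ))‖ ^ 2)
      (fun l _ => Finset.sum_nonneg fun j _ => sq_nonneg _) (Finset.mem_univ l))
    exact Finset.single_le_sum (f := fun j => ‖toL2 (piS b l (piS b j φ))‖ ^ 2)
      (fun j _ => sq_nonneg _) (Finset.mem_univ j)
  -- Ellipticity is applied, for each l, to the vector with components Π_l Π_j φ.
  have hlow : c * S ^ 2 ≤ ∑ l, ∑ j, ∑ k,
      (inner ℂ (toL2 (piS b l (piS b j φ)))
        (toL2 (mulS (n j k) (piS b l (piS b k φ))))).re := by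
    rw [hSsq, Finset.mul_sum]
    refine Finset.sum_le_sum fun l _ => ?_
    have := form_lower hn.temperate hn.lower (fun j => piS b l (piS b j φ))
    simpa only [Complex.re_sum] using this
  have hterm : ∀ l j k, (inner ℂ (toL2 (piS b l (piS b j φ)))
        (toL2 (mulS (n j k) (piS b l (piS b k φ))))).re ≤
      (inner ℂ (toL2 (piS b l (piS b l φ))) (toL2 (piS b j (mulS (n j k) (piS b k φ))))).re +
        (N * D * (S * X) + 2 * b * N * D ^ 2 * X ^ 2) := by
    intro l j k
    have h2 := inner_second_order_ge hb (hn.temperate j k) l j k (hn.bound j k)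
      (hn.bound_pd l j k) φ
    exact error_arith hb.le hN hD0 hX (norm_nonneg _) (norm_nonneg _) (hle l j)
      (h1' k) (h1' l) h2
  have hmain : ∑ l, ∑ j, ∑ k, (inner ℂ (toL2 (piS b l (piS b l φ)))
      (toL2 (piS b j (mulS (n j k) (piS b k φ))))).re ≤ 2 * (S * X) :=
     sum_inner_divS_le n φ hle
  have hfin : c * S ^ 2 ≤ A * (S * X) + B * X ^ 2 := by
    have h5 := hlow.trans (sum_le_sum_add hterm)
    have h6 : A * (S * X) + B * X ^ 2 = 2 * (S * X) +
      8 * (N * D * (S * X) + 2 * b * N * D ^ 2 * X ^ 2) := by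
      simp only [A, B]; ring
    rw [h6]
    linarith only [h5, hmain]
  have hSX := quad_bound hc hA hB hX hfin
  have hC2 : 0 ≤ C₂ := by positivity
  have hcb : 0 ≤ (c * b)⁻¹ := by positivity
  have m1 : 0 ≤ (c * b)⁻¹ * X := by positivity
  have m2 : 0 ≤ D * X := by positivity
  have m3 : 0 ≤ C₂ * X := by positivity
  have e : ((c * b)⁻¹ + D + C₂) * X = (c * b)⁻¹ * X + D * X + C₂ * X := by ring
  rw [e]
  refine ⟨by linarith, fun k => by linarith [h1' k], fun l k => by linarith [hle l k]⟩

end Landau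

end

noncomputable section

namespace Landau

open Function (HasTemperateGrowth)

/-! ### The Schwartz space as a core -/

lemma norm_zf (x : Plane) : ‖zf x‖ = ‖x‖ := by
  have h : zf x = (⟨x 0, x 1⟩ : ℂ) := by
    apply Complex.ext <;> simp [zf]
  rw [h, EuclideanSpace.norm_eq, Complex.norm_eq_sqrt_sq_add_sq, Fin.sum_univ_two]
  simp

/-- A fixed smooth bump function on the plane. -/
def bump : ContDiffBump (0 : Plane) := ⟨1, 2, one_pos, one_lt_two⟩

/-- A sequence of smooth cutoff functions. -/
def cutoff (n : ℕ) (x : Plane) : ℂ := ((bump ((n + 1 : ℝ)⁻¹ • x) : ℝ) : ℂ)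

lemma contDiff_cutoff (n : ℕ) : ContDiff ℝ ∞ (cutoff n) :=
  Complex.ofRealCLM.contDiff.comp (bump.contDiff.comp (contDiff_id.const_smul _))

lemma hasCompactSupport_cutoff (n : ℕ) : HasCompactSupport (cutoff n) := by
  have h1 : HasCompactSupport (fun x : Plane => bump ((n + 1 : ℝ)⁻¹ • x)) :=
    bump.hasCompactSupport.comp_homeomorph
      (Homeomorph.smulOfNeZero ((n + 1 : ℝ)⁻¹) (by positivity))
  exact h1.comp_left (g := ((↑) : ℝ → ℂ)) rfl

lemma hasTemperateGrowth_cutoff (n : ℕ) : HasTemperateGrowth (cutoff n) :=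
  (hasCompactSupport_cutoff n).hasTemperateGrowth (contDiff_cutoff n)

lemma exists_cutoff_bound : ∃ C : ℝ, ∀ (n : ℕ) (x y : Plane),
    ‖cutoff n x - cutoff n y‖ ≤ C / (n + 1) * ‖x - y‖ := by
  obtain ⟨C, hC⟩ := bump.contDiff.lipschitzWith_of_hasCompactSupport
    bump.hasCompactSupport (n := 1) (by simp)
  refine ⟨C, fun n x y => ?_⟩
  have h := hC.dist_le_mul ((n + 1 : ℝ)⁻¹ • x) ((n + 1 : ℝ)⁻¹ • y)
  rw [dist_eq_norm, dist_eq_norm, ← smul_sub, norm_smul, norm_inv] at h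
  rw [cutoff, cutoff, ← Complex.ofReal_sub, Complex.norm_real]
  refine h.trans (le_of_eq ?_)
  have : ‖(n + 1 : ℝ)‖ = n + 1 := by rw [Real.norm_eq_abs]; exact abs_of_pos (by positivity)
  rw [this]
  ring

lemma cutoff_zero (n : ℕ) : cutoff n 0 = 1 := by
  rw [cutoff, smul_zero, bump.one_of_mem_closedBall (by simp [bump])]
  simp

/-- The cutoff is 1 at the origin and Lipschitz with constant C/(n + 1), so it differs from 1 by at
most C|x|/(n + 1). The error is controlled by the L² norm of zφ. -/
lemma tendsto_cutoff (φ : Schw) :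
    Tendsto (fun n => toL2 (mulS (cutoff n) φ)) atTop (𝓝 (toL2 φ)) := by
  obtain ⟨C, hC⟩ := exists_cutoff_bound
  rw [tendsto_iff_norm_sub_tendsto_zero]
  have hlim : Tendsto (fun n : ℕ => C / ((n : ℝ) + 1) * ‖toL2 (mulS zf φ)‖) atTop (𝓝 0) := by
    have := (tendsto_const_div_atTop_nhds_zero_nat C).comp (tendsto_add_atTop_nat 1)
    have h2 := this.mul_const ‖toL2 (mulS zf φ)‖
    rw [zero_mul] at h2
    refine h2.congr fun n => ?_
    simp
  refine squeeze_zero (fun n => norm_nonneg _) (fun n => ?_) hlim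
  rw [← map_sub]
  refine Lp.norm_le_mul_norm_of_ae_le_mul ?_
  filter_upwards [coeFn_toL2 (mulS (cutoff n) φ - φ), coeFn_toL2 (mulS zf φ)] with x h1 h2
  rw [h1, h2, sub_apply, mulS_apply (hasTemperateGrowth_cutoff n), mulS_apply hasTemperateGrowth_zf,
    norm_mul, norm_zf, ← sub_one_mul, norm_mul, ← mul_assoc]
  refine mul_le_mul_of_nonneg_right ?_ (norm_nonneg _)
  have h3 := hC n x 0
  rwa [cutoff_zero, sub_zero] at h3

lemma tendsto_pd_cutoff (j : Fin 2) (φ : Schw) :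
    Tendsto (fun n => toL2 (mulS (pd j (cutoff n)) φ)) atTop (𝓝 0) := by
  obtain ⟨C, hC⟩ := exists_cutoff_bound
  rw [tendsto_zero_iff_norm_tendsto_zero]
  have hlim : Tendsto (fun n : ℕ => |C| / ((n : ℝ) + 1) * ‖toL2 φ‖) atTop (𝓝 0) := by
    have := (tendsto_const_div_atTop_nhds_zero_nat |C|).comp (tendsto_add_atTop_nat 1)
    have h2 := this.mul_const ‖toL2 φ‖
    rw [zero_mul] at h2
    refine h2.congr fun n => ?_
    simp
  refine squeeze_zero (fun n => norm_nonneg _) (fun n => ?_) hlim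
  refine norm_toL2_mulS_le (hasTemperateGrowth_pd (hasTemperateGrowth_cutoff n) j) (fun x => ?_) φ
  have hlip : LipschitzWith (Real.toNNReal (|C| / (n + 1))) (cutoff n) := by
    refine LipschitzWith.of_dist_le_mul fun x y => ?_
    rw [dist_eq_norm, dist_eq_norm, Real.coe_toNNReal _ (by positivity)]
    refine (hC n x y).trans ?_
    gcongr
    exact le_abs_self C
  have h1 := norm_fderiv_le_of_lipschitz ℝ hlip (x₀ := x)
  rw [Real.coe_toNNReal _ (by positivity)] at h1
  have h2 := (fderiv ℝ (cutoff n) x).le_opNorm (dir j)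
  have h3 : ‖dir j‖ = 1 := by simp
  rw [h3, mul_one] at h2
  exact h2.trans h1

lemma isTest_mulS_cutoff (n : ℕ) (φ : Schw) : IsTest (mulS (cutoff n) φ) := by
  refine ⟨(mulS (cutoff n) φ).smooth ⊤, ?_⟩
  rw [coe_mulS (hasTemperateGrowth_cutoff n)]
  exact (hasCompactSupport_cutoff n).mul_right

lemma toL2_eq_toLp {φ : Schw} {f : Plane → ℂ} (hf : MemLp f 2 volume) (h : ∀ x, φ x = f x) :
    toL2 φ = hf.toLp f := by
  refine Lp.ext ?_
  filter_upwards [coeFn_toL2 φ, hf.coeFn_toLp] with x h1 h2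
  rw [h1, h2, h]

variable {b : ℝ}

/-- Schwartz functions may serve as test functions: cut them off, and the commutator term with the
derivative of the cutoff tends to 0. All later computations can then stay in the Schwartz space,
which the Π_j preserve. -/
lemma mem_piGraph_iff (j : Fin 2) (p : L2 × L2) :
    p ∈ piGraph b j ↔ ∀ φ : Schw, inner ℂ (toL2 (piS b j φ)) p.1 = inner ℂ (toL2 φ) p.2 := by
  constructor
  · intro hp φ
    have h1 : ∀ n, inner ℂ (toL2 (piS b j (mulS (cutoff n) φ))) p.1 =
        inner ℂ (toL2 (mulS (cutoff n) φ)) p.2 := by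
      intro n
      have ht := isTest_mulS_cutoff n φ
      rw [toL2_eq_toLp (ht.memLp_piExpr b j) (piS_apply b j _), toL2_eq_toLp ht.memLp fun _ => rfl]
      exact hp _ ht
    have h2 : Tendsto (fun n => toL2 (piS b j (mulS (cutoff n) φ))) atTop
        (𝓝 (toL2 (piS b j φ))) := by
      have := (tendsto_cutoff (piS b j φ)).sub ((tendsto_pd_cutoff j φ).const_smul Complex.I)
      rw [smul_zero, sub_zero] at this
      refine this.congr fun n => ?_
      rw [piS_mulS (hasTemperateGrowth_cutoff n), map_sub, map_smul]
    have h3 := h2.inner (𝕜 := ℂ) (tendsto_const_nhds (x := p.1))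
    have h4 := (tendsto_cutoff φ).inner (𝕜 := ℂ) (tendsto_const_nhds (x := p.2))
    simp only [h1] at h3
    exact tendsto_nhds_unique h3 h4
  · intro hp φ h
    set ψ : Schw := h.compact.toSchwartzMap h.smooth
    have e1 : toL2 ψ = h.memLp.toLp φ := toL2_eq_toLp h.memLp fun _ => rfl
    have e2 : toL2 (piS b j ψ) = (h.memLp_piExpr b j).toLp _ :=
      toL2_eq_toLp (h.memLp_piExpr b j) (piS_apply b j ψ)
    rw [← e1, ← e2]
    exact hp ψ

lemma isClosed_piGraph (j : Fin 2) : IsClosed (piGraph b j : Set (L2 × L2)) := by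
  have : (piGraph b j : Set (L2 × L2)) =
      ⋂ φ : Schw, {p | inner ℂ (toL2 (piS b j φ)) p.1 = inner ℂ (toL2 φ) p.2} := by
    ext p
    simp only [SetLike.mem_coe, mem_piGraph_iff, mem_iInter, mem_ofPred_eq]
  rw [this]
  exact isClosed_iInter fun φ => isClosed_eq (by fun_prop) (by fun_prop)

lemma toL2_mem_piGraph (j : Fin 2) (φ : Schw) : (toL2 φ, toL2 (piS b j φ)) ∈ piGraph b j :=
  (mem_piGraph_iff j _).2 fun ψ => inner_piS b j ψ φ

/-! ### Bounded extensions of operators relative to the Landau Hamiltonian -/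

/-- Every Landau state is H₀ applied to a multiple of itself, and the states are complete. An
operator bounded relative to H₀ is therefore determined by its values on vectors H₀ φ. -/
lemma dense_range_hamS (hb : 0 < b) : DenseRange fun φ : Schw => toL2 (hamS b φ) := by
  have hle : Submodule.span ℂ (range (basis hb)) ≤
      LinearMap.range (((toL2 : Schw →L[ℂ] L2) ∘L hamS b : Schw →L[ℂ] L2) : Schw →ₗ[ℂ] L2) := by
    refine Submodule.span_le.2 ?_
    rintro _ ⟨i, rfl⟩
    have hl : (level b i.2 : ℂ) ≠ 0 :=
      Complex.ofReal_ne_zero.2 (by unfold level; positivity)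
    refine ⟨((‖toL2 (stS hb i.1 i.2)‖⁻¹ : ℝ) : ℂ) • (level b i.2 : ℂ)⁻¹ • stS hb i.1 i.2, ?_⟩
    change toL2 (hamS b _) = _
    rw [map_smul, map_smul, map_smul, hamS_stS, smul_smul _ _ (stS hb i.1 i.2), inv_mul_cancel₀ hl, one_smul,
      basis_apply, stN]
  have hd := (basis hb).dense_span
  have hr : Dense ((LinearMap.range (((toL2 : Schw →L[ℂ] L2) ∘L hamS b : Schw →L[ℂ] L2) :
      Schw →ₗ[ℂ] L2) : Submodule ℂ L2) : Set L2) :=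
    Submodule.dense_iff_topologicalClosure_eq_top.2 (top_le_iff.1 (hd ▸
      Submodule.topologicalClosure_mono hle))
  exact hr

/-- Closed properties of vectors of `L²` may be checked on the range of the Landau Hamiltonian on
Schwartz functions. -/
lemma hamS_induction (hb : 0 < b) {p : L2 → Prop} (hp : IsClosed {f | p f})
    (h : ∀ φ : Schw, p (toL2 (hamS b φ))) (f : L2) : p f :=
  (dense_range_hamS hb).induction_on f hp h

/-- Relative boundedness with respect to the Landau Hamiltonian. -/
def HamBdd (b : ℝ) (T : Schw →L[ℂ] Schw) : Prop :=
  ∃ C, ∀ φ, ‖toL2 (T φ)‖ ≤ C * ‖toL2 (hamS b φ)‖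

/-- The bounded extension to `L²` of the map `H₀ φ ↦ T φ`. -/
def extS (b : ℝ) (T : Schw →L[ℂ] Schw) : L2 →L[ℂ] L2 :=
  LinearMap.extendOfNorm (((toL2 : Schw →L[ℂ] L2) ∘L T : Schw →L[ℂ] L2) : Schw →ₗ[ℂ] L2)
    (((toL2 : Schw →L[ℂ] L2) ∘L hamS b : Schw →L[ℂ] L2) : Schw →ₗ[ℂ] L2)

lemma extS_apply (hb : 0 < b) {T : Schw →L[ℂ] Schw} (hT : HamBdd b T) (φ : Schw) :
    extS b T (toL2 (hamS b φ)) = toL2 (T φ) :=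
  LinearMap.extendOfNorm_eq
    (f := (((toL2 : Schw →L[ℂ] L2) ∘L T : Schw →L[ℂ] L2) : Schw →ₗ[ℂ] L2))
    (e := (((toL2 : Schw →L[ℂ] L2) ∘L hamS b : Schw →L[ℂ] L2) : Schw →ₗ[ℂ] L2))
    (dense_range_hamS hb) hT φ

lemma HamBdd.add {T T' : Schw →L[ℂ] Schw} (h : HamBdd b T) (h' : HamBdd b T') :
    HamBdd b (T + T') := by
  obtain ⟨C, hC⟩ := h
  obtain ⟨C', hC'⟩ := h'
  refine ⟨C + C', fun φ => ?_⟩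
  rw [add_apply, map_add]
  refine (norm_add_le _ _).trans ?_
  rw [add_mul]
  exact add_le_add (hC φ) (hC' φ)

lemma HamBdd.mulS_comp {T : Schw →L[ℂ] Schw} (h : HamBdd b T) {f : Plane → ℂ}
    (hf : HasTemperateGrowth f) {N : ℝ} (hN : ∀ x, ‖f x‖ ≤ N) : HamBdd b (mulS f ∘L T) := by
  obtain ⟨C, hC⟩ := h
  have hN0 : 0 ≤ N := (norm_nonneg _).trans (hN 0)
  refine ⟨N * C, fun φ => ?_⟩
  refine (norm_toL2_mulS_le hf hN _).trans ?_
  rw [mul_assoc]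
  exact mul_le_mul_of_nonneg_left (hC φ) hN0

lemma divS_one (φ : Schw) : divS b (fun j k _ => if j = k then 1 else 0) φ = hamS b φ := by
  have h1 : ∀ φ : Schw, mulS (fun _ => (1 : ℂ)) φ = φ := fun φ => by
    ext x; rw [mulS_apply (HasTemperateGrowth.const _), one_mul]
  have h0 : ∀ φ : Schw, mulS (fun _ => (0 : ℂ)) φ = 0 := fun φ => by
    ext x; rw [mulS_apply (HasTemperateGrowth.const _), zero_mul]; rfl
  rw [divS_apply, hamS_apply]
  simp [Fin.sum_univ_two, h1, h0]

lemma isElliptic_one : IsElliptic (fun j k _ => if j = k then 1 else 0) 1 1 where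
  temperate j k := HasTemperateGrowth.const _
  bound j k x := by split_ifs <;> simp
  bound_pd l j k x := by simp [pd]
  lower x z := by
    simp only [Fin.sum_univ_two, one_mul, Complex.add_re]
    simp [Complex.mul_re, Complex.sq_norm, Complex.normSq_apply]

/-- This is `second_order_bound` for the identity matrix. -/
lemma hamBdd_all (hb : 0 < b) : HamBdd b (ContinuousLinearMap.id ℂ Schw) ∧
    (∀ k, HamBdd b (piS b k)) ∧ ∀ l k, HamBdd b (piS b l ∘L piS b k) := by
  obtain ⟨C, -, hC⟩ := second_order_bound hb one_pos 1
  have h := hC _ isElliptic_one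
  simp only [divS_one] at h
  exact ⟨⟨C, fun φ => (h φ).1⟩, fun k => ⟨C, fun φ => (h φ).2.1 k⟩,
    fun l k => ⟨C, fun φ => (h φ).2.2 l k⟩⟩

lemma hamBdd_piS_mulS_piS (hb : 0 < b) {f : Plane → ℂ} (hf : HasTemperateGrowth f) {N : ℝ}
    (j k : Fin 2) (h0 : ∀ x, ‖f x‖ ≤ N) (h1 : ∀ x, ‖pd j f x‖ ≤ N) :
    HamBdd b (piS b j ∘L mulS f ∘L piS b k) := by
  have hg : HasTemperateGrowth fun x => -Complex.I * pd j f x :=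
    (HasTemperateGrowth.const _).mul (hasTemperateGrowth_pd hf j)
  have hT : piS b j ∘L mulS f ∘L piS b k = mulS f ∘L (piS b j ∘L piS b k) +
      mulS (fun x => -Complex.I * pd j f x) ∘L piS b k := by
    ext φ x
    have := congrArg (fun ψ : Schw => ψ x) (piS_mulS hf b j (piS b k φ))
    simp only [sub_apply, smul_apply, mulS_apply (hasTemperateGrowth_pd hf j)] at this
    simp only [ContinuousLinearMap.comp_apply, add_apply]
    rw [this, mulS_apply hg, smul_eq_mul]
    ring
  rw [hT]
  refine (((hamBdd_all hb).2.2 j k).mulS_comp hf h0).add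
    (((hamBdd_all hb).2.1 k).mulS_comp hg (N := N) fun x => ?_)
  rw [norm_mul, norm_neg, Complex.norm_I, one_mul]
  exact h1 x

end Landau

end

noncomputable section

namespace Landau

open Function (HasTemperateGrowth)

/-! ### Graphs of unbounded operators -/

/-- Composition of operators is composition of relations between graphs; in this form natural
domains never have to be computed. -/
lemma mem_graph_opComp {g f : L2 →ₗ.[ℂ] L2} {x z : L2} :
    (x, z) ∈ (opComp g f).graph ↔ ∃ y, (x, y) ∈ f.graph ∧ (y, z) ∈ g.graph := by
  constructor
  · intro h
    obtain ⟨w, hw1, hw2⟩ := (LinearPMap.mem_graph_iff _).1 h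
    obtain ⟨w, hw⟩ := w
    have hw' := hw
    obtain ⟨⟨y, hy, hyx⟩, h2⟩ := hw
    have hyx' : (y : L2) = w := hyx
    have hfy : f.domRestrict ((g.domain.comap f.toFun).map f.domain.subtype) ⟨w, hw'⟩ = f y :=
      LinearPMap.domRestrict_apply hyx'.symm
    have hwx : w = x := hw1
    refine ⟨f y, (LinearPMap.mem_graph_iff _).2 ⟨y, hyx'.trans hwx, rfl⟩,
      (LinearPMap.mem_graph_iff _).2 ⟨⟨f y, hy⟩, rfl, ?_⟩⟩
    refine Eq.trans ?_ hw2
    change g ⟨f y, hy⟩ = g ⟨f.domRestrict _ ⟨w, hw'⟩, _⟩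
    congr 1
    exact Subtype.ext hfy.symm
  · rintro ⟨y, hxy, hyz⟩
    obtain ⟨u, hu1, hu2⟩ := (LinearPMap.mem_graph_iff _).1 hxy
    obtain ⟨v, hv1, hv2⟩ := (LinearPMap.mem_graph_iff _).1 hyz
    have hu1' : (u : L2) = x := hu1
    have hu2' : f u = y := hu2
    have hv1' : (v : L2) = y := hv1
    have hv2' : g v = z := hv2
    have hdom : f u ∈ g.domain := by rw [hu2', ← hv1']; exact v.2
    have hmem : (u : L2) ∈ ((g.domain.comap f.toFun).map f.domain.subtype) ⊓ f.domain :=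
      ⟨⟨u, hdom, rfl⟩, u.2⟩
    refine (LinearPMap.mem_graph_iff _).2 ⟨⟨u, hmem⟩, hu1', ?_⟩
    have hfu : f.domRestrict ((g.domain.comap f.toFun).map f.domain.subtype) ⟨u, hmem⟩ = f u :=
      LinearPMap.domRestrict_apply rfl
    refine Eq.trans ?_ hv2'
    change g ⟨f.domRestrict _ ⟨u, hmem⟩, _⟩ = g v
    congr 1
    exact Subtype.ext (hfu.trans (hu2'.trans hv1'.symm))

lemma mem_graph_add {f g : L2 →ₗ.[ℂ] L2} {x z : L2} :
    (x, z) ∈ (f + g).graph ↔ ∃ y y', (x, y) ∈ f.graph ∧ (x, y') ∈ g.graph ∧ z = y + y' := by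
  constructor
  · intro h
    obtain ⟨w, hw1, hw2⟩ := (LinearPMap.mem_graph_iff _).1 h
    refine ⟨f ⟨w, w.2.1⟩, g ⟨w, w.2.2⟩, (LinearPMap.mem_graph_iff _).2 ⟨_, hw1, rfl⟩,
      (LinearPMap.mem_graph_iff _).2 ⟨_, hw1, rfl⟩, ?_⟩
    rw [← LinearPMap.add_apply]
    exact hw2.symm
  · rintro ⟨y, y', h1, h2, rfl⟩
    obtain ⟨u, hu1, hu2⟩ := (LinearPMap.mem_graph_iff _).1 h1
    obtain ⟨v, hv1, hv2⟩ := (LinearPMap.mem_graph_iff _).1 h2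
    have hu1' : (u : L2) = x := hu1
    have hv1' : (v : L2) = x := hv1
    subst hu1'
    have hm : (u : L2) ∈ f.domain ⊓ g.domain := ⟨u.2, by rw [← hv1']; exact v.2⟩
    refine (LinearPMap.mem_graph_iff _).2 ⟨⟨u, hm⟩, rfl, ?_⟩
    refine (LinearPMap.add_apply f g ⟨u, hm⟩).trans ?_
    have e : v = ⟨u, hm.2⟩ := Subtype.ext hv1'
    exact congrArg₂ (· + ·) hu2 ((congrArg g e.symm).trans hv2)

lemma mem_graph_sub {f g : L2 →ₗ.[ℂ] L2} {x z : L2} :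
    (x, z) ∈ (f - g).graph ↔ ∃ y y', (x, y) ∈ f.graph ∧ (x, y') ∈ g.graph ∧ z = y - y' := by
  constructor
  · intro h
    obtain ⟨w, hw1, hw2⟩ := (LinearPMap.mem_graph_iff _).1 h
    refine ⟨f ⟨w, w.2.1⟩, g ⟨w, w.2.2⟩, (LinearPMap.mem_graph_iff _).2 ⟨_, hw1, rfl⟩,
      (LinearPMap.mem_graph_iff _).2 ⟨_, hw1, rfl⟩, ?_⟩
    rw [← LinearPMap.sub_apply]
    exact hw2.symm
  · rintro ⟨y, y', h1, h2, rfl⟩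
    obtain ⟨u, hu1, hu2⟩ := (LinearPMap.mem_graph_iff _).1 h1
    obtain ⟨v, hv1, hv2⟩ := (LinearPMap.mem_graph_iff _).1 h2
    have hu1' : (u : L2) = x := hu1
    have hv1' : (v : L2) = x := hv1
    subst hu1'
    have hm : (u : L2) ∈ f.domain ⊓ g.domain := ⟨u.2, by rw [← hv1']; exact v.2⟩
    refine (LinearPMap.mem_graph_iff _).2 ⟨⟨u, hm⟩, rfl, ?_⟩
    refine (LinearPMap.sub_apply f g ⟨u, hm⟩).trans ?_
    have e : v = ⟨u, hm.2⟩ := Subtype.ext hv1'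
    exact congrArg₂ (· - ·) hu2 ((congrArg g e.symm).trans hv2)

lemma mem_graph_ofBounded {T : L2 →L[ℂ] L2} {x z : L2} :
    (x, z) ∈ (ofBounded T).graph ↔ z = T x := by
  constructor
  · intro h
    obtain ⟨w, hw1, hw2⟩ := (LinearPMap.mem_graph_iff _).1 h
    have hw1' : (w : L2) = x := hw1
    rw [← hw1']
    exact hw2.symm
  · rintro rfl
    exact (LinearPMap.mem_graph_iff _).2 ⟨⟨x, trivial⟩, rfl, rfl⟩

lemma mem_graph_piOp {b : ℝ} {j : Fin 2} {p : L2 × L2} :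
    p ∈ (piOp b j).graph ↔ p ∈ piGraph b j := by
  rw [piOp, Submodule.toLinearPMap_graph_eq _ fun x => piGraph_functional b j x]

lemma mem_graph_mulOp {a : Plane → ℂ} {p : L2 × L2} :
    p ∈ (mulOp a).graph ↔ p ∈ mulGraph a := by
  rw [mulOp, Submodule.toLinearPMap_graph_eq _ fun x => mulGraph_functional a x]

lemma mem_eigenspace_iff {T : L2 →ₗ.[ℂ] L2} {μ : ℂ} {x : L2} :
    x ∈ eigenspace T μ ↔ (x, μ • x) ∈ T.graph := by
  constructor
  · rintro ⟨y, hy, rfl⟩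
    refine (LinearPMap.mem_graph_iff _).2 ⟨y, rfl, ?_⟩
    have := LinearMap.mem_ker.1 hy
    rw [LinearMap.sub_apply, sub_eq_zero] at this
    exact this
  · intro h
    obtain ⟨w, hw1, hw2⟩ := (LinearPMap.mem_graph_iff _).1 h
    refine ⟨w, ?_, hw1⟩
    have hw1' : (w : L2) = x := hw1
    refine LinearMap.mem_ker.2 ?_
    rw [LinearMap.sub_apply, sub_eq_zero]
    refine Eq.trans hw2 ?_
    rw [← hw1']
    rfl

/-- `R` is an everywhere defined bounded inverse of `H`. -/
def IsInverse (H : L2 →ₗ.[ℂ] L2) (R : L2 →L[ℂ] L2) : Prop :=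
  ∀ u f, (u, f) ∈ H.graph ↔ u = R f

lemma IsInverse.inverse_eq {H : L2 →ₗ.[ℂ] L2} {R : L2 →L[ℂ] L2} (h : IsInverse H R) :
    H.inverse = ofBounded R := by
  have hk : LinearMap.ker H.toFun = ⊥ := by
    rw [LinearMap.ker_eq_bot']
    intro x hx
    have h1 : ((x : L2), (0 : L2)) ∈ H.graph :=
      (LinearPMap.mem_graph_iff _).2 ⟨x, rfl, hx⟩
    have := (h _ _).1 h1
    rw [map_zero] at this
    exact Subtype.ext this
  refine LinearPMap.eq_of_eq_graph ?_
  rw [LinearPMap.inverse_graph hk]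
  ext ⟨x, z⟩
  rw [mem_graph_ofBounded, ← h]
  simp

lemma IsInverse.mem_eigenspace {H : L2 →ₗ.[ℂ] L2} {R : L2 →L[ℂ] L2} (h : IsInverse H R) {μ : ℂ}
    {u : L2} : u ∈ eigenspace H μ ↔ u = μ • R u := by
  rw [mem_eigenspace_iff, h, map_smul]

/-! ### Multiplication operators -/

lemma memLp_mul {a : Plane → ℂ} (ha : Continuous a) {N : ℝ} (hN : ∀ x, ‖a x‖ ≤ N) (u : L2) :
    MemLp (fun x => a x * u x) 2 volume := by
  refine MemLp.of_le_mul (c := N) (Lp.memLp u)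
    (ha.aestronglyMeasurable.mul (Lp.aestronglyMeasurable u)) (Eventually.of_forall fun x => ?_)
  rw [norm_mul]
  exact mul_le_mul_of_nonneg_right (hN x) (norm_nonneg _)

/-- Multiplication by a bounded continuous function. -/
def mulL {a : Plane → ℂ} (ha : Continuous a) {N : ℝ} (hN : ∀ x, ‖a x‖ ≤ N) : L2 →L[ℂ] L2 :=
  LinearMap.mkContinuous
    { toFun := fun u => (memLp_mul ha hN u).toLp _
      map_add' := fun u v => by
        refine Lp.ext ?_
        filter_upwards [(memLp_mul ha hN u).coeFn_toLp, (memLp_mul ha hN v).coeFn_toLp,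
          (memLp_mul ha hN (u + v)).coeFn_toLp, Lp.coeFn_add u v,
          Lp.coeFn_add ((memLp_mul ha hN u).toLp _) ((memLp_mul ha hN v).toLp _)]
          with x h1 h2 h3 h4 h5
        rw [h3, h5, Pi.add_apply, h1, h2, h4, Pi.add_apply, mul_add]
      map_smul' := fun c u => by
        refine Lp.ext ?_
        filter_upwards [(memLp_mul ha hN u).coeFn_toLp, (memLp_mul ha hN (c • u)).coeFn_toLp,
          Lp.coeFn_smul c u, Lp.coeFn_smul c ((memLp_mul ha hN u).toLp _)] with x h1 h2 h3 h4
        rw [h2, RingHom.id_apply, h4, Pi.smul_apply, h1, h3, Pi.smul_apply, mul_smul_comm] }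
    N fun u => by
      refine Lp.norm_le_mul_norm_of_ae_le_mul ?_
      filter_upwards [(memLp_mul ha hN u).coeFn_toLp] with x h1
      change ‖((memLp_mul ha hN u).toLp _ : Plane → ℂ) x‖ ≤ _
      rw [h1, norm_mul]
      exact mul_le_mul_of_nonneg_right (hN x) (norm_nonneg _)

lemma coeFn_mulL {a : Plane → ℂ} (ha : Continuous a) {N : ℝ} (hN : ∀ x, ‖a x‖ ≤ N) (u : L2) :
    (mulL ha hN u : Plane → ℂ) =ᵐ[volume] fun x => a x * u x :=
  (memLp_mul ha hN u).coeFn_toLp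

lemma mulL_toL2 {a : Plane → ℂ} (ha : HasTemperateGrowth a) {N : ℝ} (hN : ∀ x, ‖a x‖ ≤ N)
    (φ : Schw) : mulL ha.1.continuous hN (toL2 φ) = toL2 (mulS a φ) := by
  refine Lp.ext ?_
  filter_upwards [coeFn_mulL ha.1.continuous hN (toL2 φ), coeFn_toL2 φ, coeFn_toL2 (mulS a φ)]
    with x h1 h2 h3
  rw [h1, h2, h3, mulS_apply ha]

lemma mem_graph_mulOp_iff {a : Plane → ℂ} (ha : Continuous a) {N : ℝ} (hN : ∀ x, ‖a x‖ ≤ N)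
    {u f : L2} : (u, f) ∈ (mulOp a).graph ↔ f = mulL ha hN u := by
  rw [mem_graph_mulOp]
  constructor
  · intro h
    refine Lp.ext ?_
    have h' : ∀ᵐ x, f x = a x * u x := h
    filter_upwards [h', coeFn_mulL ha hN u] with x h1 h2
    rw [h1, h2]
  · rintro rfl
    exact coeFn_mulL ha hN u

/-! ### The inverse of the Landau Hamiltonian -/

variable {b : ℝ}

/-- The inverse of the Landau Hamiltonian. -/
def res0 (b : ℝ) : L2 →L[ℂ] L2 := extS b (ContinuousLinearMap.id ℂ Schw)

lemma res0_apply (hb : 0 < b) (φ : Schw) : res0 b (toL2 (hamS b φ)) = toL2 φ :=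
  extS_apply hb (hamBdd_all hb).1 φ

lemma extS_piS_apply (hb : 0 < b) (k : Fin 2) (φ : Schw) :
    extS b (piS b k) (toL2 (hamS b φ)) = toL2 (piS b k φ) :=
  extS_apply hb ((hamBdd_all hb).2.1 k) φ

lemma extS_piS_piS_apply (hb : 0 < b) (j k : Fin 2) (φ : Schw) :
    extS b (piS b j ∘L piS b k) (toL2 (hamS b φ)) = toL2 (piS b j (piS b k φ)) :=
  extS_apply hb ((hamBdd_all hb).2.2 j k) φ

lemma inner_res0 (hb : 0 < b) (f g : L2) : inner ℂ (res0 b f) g = inner ℂ f (res0 b g) := by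
  refine hamS_induction hb (p := fun f => inner ℂ (res0 b f) g = inner ℂ f (res0 b g))
    (isClosed_eq (by fun_prop) (by fun_prop)) (fun φ => ?_) f
  refine hamS_induction hb (p := fun g => inner ℂ (res0 b (toL2 (hamS b φ))) g =
    inner ℂ (toL2 (hamS b φ)) (res0 b g))
    (isClosed_eq (by fun_prop) (by fun_prop)) (fun ψ => ?_) g
  rw [res0_apply hb, res0_apply hb, inner_hamS]

lemma res0_mem_piGraph (hb : 0 < b) (k : Fin 2) (f : L2) :
    (res0 b f, extS b (piS b k) f) ∈ piGraph b k := by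
  refine hamS_induction hb (p := fun f => (res0 b f, extS b (piS b k) f) ∈ piGraph b k) ?_ ?_ f
  · exact (isClosed_piGraph k).preimage (by fun_prop : Continuous fun f =>
      (res0 b f, extS b (piS b k) f))
  · intro φ
    rw [res0_apply hb, extS_piS_apply hb]
    exact toL2_mem_piGraph k φ

lemma piS_mem_piGraph (hb : 0 < b) (j k : Fin 2) (f : L2) :
    (extS b (piS b k) f, extS b (piS b j ∘L piS b k) f) ∈ piGraph b j := by
  refine hamS_induction hb (p := fun f => (extS b (piS b k) f, extS b (piS b j ∘L piS b k) f) ∈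
    piGraph b j) ?_ ?_ f
  · exact (isClosed_piGraph j).preimage (by fun_prop : Continuous fun f =>
      (extS b (piS b k) f, extS b (piS b j ∘L piS b k) f))
  · intro φ
    rw [extS_piS_piS_apply hb, extS_piS_apply hb]
    exact toL2_mem_piGraph j _

lemma sum_extS_piS_piS (hb : 0 < b) (f : L2) :
    extS b (piS b 0 ∘L piS b 0) f + extS b (piS b 1 ∘L piS b 1) f = f := by
  refine hamS_induction hb (p := fun f => extS b (piS b 0 ∘L piS b 0) f +
    extS b (piS b 1 ∘L piS b 1) f = f) (isClosed_eq (by fun_prop) (by fun_prop)) (fun φ => ?_) f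
  rw [extS_piS_piS_apply hb, extS_piS_piS_apply hb, hamS_apply, map_add]

/-- That `res0 b f` lies in the natural domain follows by closedness of the graphs of Π_j.
Conversely, the distributional definition tested against the dense vectors H₀ φ shows that a
solution of H₀ u = f is unique. -/
theorem isInverse_H0 (hb : 0 < b) : IsInverse (H0 b) (res0 b) := by
  intro u f
  rw [H0, Fin.sum_univ_two, mem_graph_add]
  simp only [mem_graph_opComp, mem_graph_piOp]
  constructor
  · rintro ⟨y, y', ⟨v, hv, hv'⟩, ⟨w, hw, hw'⟩, rfl⟩
    rw [← sub_eq_zero]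
    refine (dense_range_hamS hb).eq_zero_of_inner_right ℂ ?_
    intro φ
    rw [inner_sub_right, ← inner_res0 hb, res0_apply hb, hamS_apply, map_add, inner_add_left,
      (mem_piGraph_iff 0 _).1 hv, (mem_piGraph_iff 0 _).1 hv', (mem_piGraph_iff 1 _).1 hw,
      (mem_piGraph_iff 1 _).1 hw', inner_add_right, sub_self]
  · rintro rfl
    exact ⟨_, _, ⟨_, res0_mem_piGraph hb 0 f, piS_mem_piGraph hb 0 0 f⟩,
      ⟨_, res0_mem_piGraph hb 1 f, piS_mem_piGraph hb 1 1 f⟩, (sum_extS_piS_piS hb f).symm⟩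

/-! ### The perturbation relative to the Landau Hamiltonian -/

/-- Coefficients which are bounded, together with their first derivatives. -/
structure IsCoeff (n : Fin 2 → Fin 2 → Plane → ℂ) (N : ℝ) : Prop where
  temperate : ∀ j k, HasTemperateGrowth (n j k)
  bound : ∀ j k x, ‖n j k x‖ ≤ N
  bound_pd : ∀ l j k x, ‖pd l (n j k) x‖ ≤ N

/-- The bounded operator `W H₀⁻¹`. -/
def pertS (b : ℝ) (n : Fin 2 → Fin 2 → Plane → ℂ) : L2 →L[ℂ] L2 := extS b (divS b n)

variable {n : Fin 2 → Fin 2 → Plane → ℂ} {N : ℝ}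

lemma IsCoeff.hamBdd_term (hn : IsCoeff n N) (hb : 0 < b) (j k : Fin 2) :
    HamBdd b (piS b j ∘L mulS (n j k) ∘L piS b k) :=
  hamBdd_piS_mulS_piS hb (hn.temperate j k) j k (hn.bound j k) (hn.bound_pd j j k)

lemma IsCoeff.hamBdd_divS (hn : IsCoeff n N) (hb : 0 < b) : HamBdd b (divS b n) := by
  simp only [divS, Fin.sum_univ_two]
  exact ((hn.hamBdd_term hb 0 0).add (hn.hamBdd_term hb 0 1)).add
    ((hn.hamBdd_term hb 1 0).add (hn.hamBdd_term hb 1 1))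

lemma IsCoeff.pertS_apply (hn : IsCoeff n N) (hb : 0 < b) (φ : Schw) :
    pertS b n (toL2 (hamS b φ)) = toL2 (divS b n φ) :=
  extS_apply hb (hn.hamBdd_divS hb) φ

lemma IsCoeff.pertS_eq_sum (hn : IsCoeff n N) (hb : 0 < b) (f : L2) :
    pertS b n f = ∑ j, ∑ k, extS b (piS b j ∘L mulS (n j k) ∘L piS b k) f := by
  refine hamS_induction hb (p := fun f => pertS b n f =
    ∑ j, ∑ k, extS b (piS b j ∘L mulS (n j k) ∘L piS b k) f)
    (isClosed_eq (by fun_prop) (by fun_prop)) (fun φ => ?_) f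
  rw [hn.pertS_apply hb, divS_apply, map_sum]
  refine Finset.sum_congr rfl fun j _ => ?_
  rw [map_sum]
  exact Finset.sum_congr rfl fun k _ => (extS_apply hb (hn.hamBdd_term hb j k) φ).symm

lemma IsCoeff.term_mem_piGraph (hn : IsCoeff n N) (hb : 0 < b) (j k : Fin 2) (f : L2) :
    (mulL (hn.temperate j k).1.continuous (hn.bound j k) (extS b (piS b k) f),
      extS b (piS b j ∘L mulS (n j k) ∘L piS b k) f) ∈ piGraph b j := by
  refine hamS_induction hb (p := fun f =>
    (mulL (hn.temperate j k).1.continuous (hn.bound j k) (extS b (piS b k) f),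
      extS b (piS b j ∘L mulS (n j k) ∘L piS b k) f) ∈ piGraph b j) ?_ ?_ f
  · exact (isClosed_piGraph j).preimage (by fun_prop : Continuous fun f =>
      (mulL (hn.temperate j k).1.continuous (hn.bound j k) (extS b (piS b k) f),
      extS b (piS b j ∘L mulS (n j k) ∘L piS b k) f))
  · intro φ
    rw [extS_apply hb (hn.hamBdd_term hb j k), extS_piS_apply hb, mulL_toL2 (hn.temperate j k)]
    exact toL2_mem_piGraph j _

lemma inner_extS_piS (hb : 0 < b) {j : Fin 2} {u v : L2} (h : (u, v) ∈ piGraph b j) (f : L2) :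
    inner ℂ (extS b (piS b j) f) u = inner ℂ (res0 b f) v := by
  refine hamS_induction hb (p := fun f => inner ℂ (extS b (piS b j) f) u =
    inner ℂ (res0 b f) v) (isClosed_eq (by fun_prop) (by fun_prop)) (fun φ => ?_) f
  rw [extS_piS_apply hb, res0_apply hb, (mem_piGraph_iff j _).1 h]

/-- The form of `H₀⁻¹ W H₀⁻¹`. -/
lemma IsCoeff.inner_res0_pertS (hn : IsCoeff n N) (hb : 0 < b) (f g : L2) :
    inner ℂ (res0 b f) (pertS b n g) = ∑ j, ∑ k, inner ℂ (extS b (piS b j) f)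
      (mulL (hn.temperate j k).1.continuous (hn.bound j k) (extS b (piS b k) g)) := by
  rw [hn.pertS_eq_sum hb, inner_sum]
  refine Finset.sum_congr rfl fun j _ => ?_
  rw [inner_sum]
  exact Finset.sum_congr rfl fun k _ => (inner_extS_piS hb (hn.term_mem_piGraph hb j k g) f).symm

end Landau

end

noncomputable section

namespace Landau

open Function (HasTemperateGrowth)

/-! ### The method of continuity -/

/-- The path 1 + tK is followed in N steps of length 1/N with N > ‖K‖/c. Each inverse on the way has
norm at most 1/c, so every step is a Neumann series. -/
lemma isUnit_one_add_of_bounded_below {E : Type*} [NormedAddCommGroup E] [NormedSpace ℂ E]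
    [CompleteSpace E] (K : E →L[ℂ] E) {c : ℝ} (hc : 0 < c)
    (h : ∀ t ∈ Icc (0 : ℝ) 1, ∀ f, c * ‖f‖ ≤ ‖f + (t : ℂ) • K f‖) : IsUnit (1 + K) := by
  obtain ⟨N, hN⟩ := exists_nat_gt (‖K‖ / c)
  have hN0 : (0 : ℝ) < N := lt_of_le_of_lt (by positivity) hN
  have hNne : (N : ℂ) ≠ 0 := by exact_mod_cast hN0.ne'
  have step : ∀ i : ℕ, i ≤ N → IsUnit (1 + ((i : ℂ) / N) • K) := by
    intro i
    induction i with
    | zero => intro _; simp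
    | succ i ih =>
      intro hi
      obtain ⟨u, hu⟩ := ih (by omega)
      have hinv : ‖(↑u⁻¹ : E →L[ℂ] E)‖ ≤ c⁻¹ := by
        refine ContinuousLinearMap.opNorm_le_bound _ (by positivity) fun g => ?_
        set f := (↑u⁻¹ : E →L[ℂ] E) g
        have h1 : (u : E →L[ℂ] E) f = g := by
          change ((u : E →L[ℂ] E) * (↑u⁻¹ : E →L[ℂ] E)) g = g
          rw [Units.mul_inv]; rfl
        have h2 := h ((i : ℝ) / N) ⟨by positivity, by
          rw [div_le_one hN0]; exact_mod_cast (by omega : i ≤ N)⟩ f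
        have h3 : f + (((i : ℝ) / N : ℝ) : ℂ) • K f = g := by
          rw [← h1, hu]; push_cast; rfl
        rw [h3] at h2
        rw [inv_mul_eq_div, le_div_iff₀ hc, mul_comm]
        exact h2
      have hfac : 1 + (((i + 1 : ℕ) : ℂ) / N) • K =
          u * (1 - (-((1 : ℂ) / N)) • ((↑u⁻¹ : E →L[ℂ] E) * K)) := by
        rw [mul_sub, mul_one, mul_smul_comm, ← mul_assoc, Units.mul_inv, one_mul, hu]
        push_cast
        rw [neg_smul, sub_neg_eq_add, add_assoc, ← add_smul, add_div]
      rw [hfac]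
      refine u.isUnit.mul (isUnit_one_sub_of_norm_lt_one ?_)
      rw [norm_smul, norm_neg, norm_div, norm_one, Complex.norm_natCast]
      have h4 : ‖(↑u⁻¹ : E →L[ℂ] E) * K‖ ≤ c⁻¹ * ‖K‖ :=
        (norm_mul_le _ _).trans (mul_le_mul_of_nonneg_right hinv (norm_nonneg _))
      calc 1 / (N : ℝ) * ‖(↑u⁻¹ : E →L[ℂ] E) * K‖ ≤ 1 / (N : ℝ) * (c⁻¹ * ‖K‖) := by gcongr
        _ = (‖K‖ / c) / N := by ring
        _ < 1 := by rwa [div_lt_one hN0]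
  have := step N le_rfl
  rwa [div_self hNne, one_smul] at this

variable {b : ℝ} {n : Fin 2 → Fin 2 → Plane → ℂ} {N : ℝ}

/-- The coefficients `δ_{jk} + s n_{jk}`. -/
def oneAdd (n : Fin 2 → Fin 2 → Plane → ℂ) (s : ℝ) (j k : Fin 2) (x : Plane) : ℂ :=
  (if j = k then 1 else 0) + (s : ℂ) * n j k x

lemma IsCoeff.oneAdd (hn : IsCoeff n N) {s : ℝ} (hs : |s| ≤ 1) :
    IsCoeff (oneAdd n s) (1 + N) where
  temperate j k := (HasTemperateGrowth.const _).add
    ((HasTemperateGrowth.const _).mul (hn.temperate j k))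
  bound j k x := by
    have hN : 0 ≤ N := (norm_nonneg _).trans (hn.bound j k x)
    refine (norm_add_le _ _).trans (add_le_add (by split_ifs <;> simp) ?_)
    rw [norm_mul, Complex.norm_real, Real.norm_eq_abs]
    calc _ ≤ 1 * N := mul_le_mul hs (hn.bound j k x) (norm_nonneg _) zero_le_one
      _ = N := one_mul N
  bound_pd l j k x := by
    have hN : 0 ≤ N := (norm_nonneg _).trans (hn.bound j k x)
    have hd : HasFDerivAt (Landau.oneAdd n s j k) ((s : ℂ) • fderiv ℝ (n j k) x) x := by
      have h1 : HasFDerivAt (n j k) (fderiv ℝ (n j k) x) x :=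
        ((hn.temperate j k).1.differentiable (by simp)).differentiableAt.hasFDerivAt
      exact (h1.const_smul (s : ℂ)).const_add _
    have e : pd l (Landau.oneAdd n s j k) x = (s : ℂ) * pd l (n j k) x := by
      rw [pd, hd.fderiv]; rfl
    rw [e, norm_mul, Complex.norm_real, Real.norm_eq_abs]
    calc _ ≤ 1 * N := mul_le_mul hs (hn.bound_pd l j k x) (norm_nonneg _) zero_le_one
      _ ≤ 1 + N := by linarith

lemma IsCoeff.divS_oneAdd (hn : IsCoeff n N) (s : ℝ) (φ : Schw) :
    divS b (Landau.oneAdd n s) φ = hamS b φ + (s : ℂ) • divS b n φ := by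
  rw [← divS_one, divS_apply, divS_apply, divS_apply, Finset.smul_sum, ← Finset.sum_add_distrib]
  refine Finset.sum_congr rfl fun j _ => ?_
  rw [Finset.smul_sum, ← Finset.sum_add_distrib]
  refine Finset.sum_congr rfl fun k _ => ?_
  rw [← map_smul, ← map_add]
  congr 1
  ext x
  have ht : HasTemperateGrowth (Landau.oneAdd n s j k) := (HasTemperateGrowth.const _).add
    ((HasTemperateGrowth.const _).mul (hn.temperate j k))
  rw [add_apply, smul_apply, mulS_apply ht, mulS_apply (hn.temperate j k),
    mulS_apply (HasTemperateGrowth.const _), smul_eq_mul, Landau.oneAdd]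
  ring

lemma oneAdd_form (s : ℝ) (x : Plane) (z : Fin 2 → ℂ) :
    (∑ j, ∑ k, conj (z j) * (oneAdd n s j k x * z k)).re =
      ∑ j, ‖z j‖ ^ 2 + s * (∑ j, ∑ k, conj (z j) * (n j k x * z k)).re := by
  have e : ∑ j, ∑ k, conj (z j) * (oneAdd n s j k x * z k) =
      ((∑ j, ‖z j‖ ^ 2 : ℝ) : ℂ) + (s : ℂ) * ∑ j, ∑ k, conj (z j) * (n j k x * z k) := by
    have h : ∀ w : ℂ, ((‖w‖ ^ 2 : ℝ) : ℂ) = conj w * w := fun w => by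
      rw [mul_comm, Complex.mul_conj, Complex.normSq_eq_norm_sq]
    push_cast at h
    push_cast
    simp only [Fin.sum_univ_two, oneAdd, h]
    simp
    ring
  rw [e, Complex.add_re, Complex.ofReal_re, Complex.re_ofReal_mul]

/-- Hermitian nonnegative coefficients. -/
structure IsHermCoeff (n : Fin 2 → Fin 2 → Plane → ℂ) (N : ℝ) : Prop extends IsCoeff n N where
  herm : ∀ j k x, conj (n j k x) = n k j x
  nonneg : ∀ x (z : Fin 2 → ℂ), 0 ≤ (∑ j, ∑ k, conj (z j) * (n j k x * z k)).re

/-- Invertibility of `1 ± W H₀⁻¹`. -/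
theorem IsCoeff.isUnit_one_add (hn : IsCoeff n N) (hb : 0 < b) {s c : ℝ} (hs : |s| ≤ 1)
    (hc : 0 < c)
    (hlow : ∀ t ∈ Icc (0 : ℝ) 1, ∀ x (z : Fin 2 → ℂ), c * ∑ j, ‖z j‖ ^ 2 ≤
      ∑ j, ‖z j‖ ^ 2 + t * s * (∑ j, ∑ k, conj (z j) * (n j k x * z k)).re) :
    IsUnit (1 + (s : ℂ) • pertS b n) := by
  obtain ⟨C, hC0, hC⟩ := second_order_bound hb hc (1 + N)
  -- ‖H₀ φ‖ ≤ ‖Π₁²φ‖ + ‖Π₂²φ‖ ≤ 2C‖(H₀ + tsW)φ‖, and the 1 keeps the constant positive. C is the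
  -- same for all t because it depends only on the ellipticity constant c and the bound 1 + N.
  refine isUnit_one_add_of_bounded_below _ (c := (2 * C + 1)⁻¹) (by positivity) fun t ht f => ?_
  have hts : |t * s| ≤ 1 := by
    rw [abs_mul, abs_of_nonneg ht.1]
    exact mul_le_one₀ ht.2 (abs_nonneg _) hs
  refine hamS_induction hb (p := fun f => (2 * C + 1)⁻¹ * ‖f‖ ≤
    ‖f + (t : ℂ) • ((s : ℂ) • pertS b n) f‖) (isClosed_le (by fun_prop) (by fun_prop))
    (fun φ => ?_) f
  have e : toL2 (hamS b φ) + (t : ℂ) • ((s : ℂ) • pertS b n) (toL2 (hamS b φ)) =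
      toL2 (divS b (Landau.oneAdd n (t * s)) φ) := by
    rw [hn.divS_oneAdd, smul_apply, hn.pertS_apply hb, map_add, map_smul, smul_smul]
    push_cast
    rfl
  rw [e, inv_mul_eq_div, div_le_iff₀ (by positivity)]
  have hell : IsElliptic (Landau.oneAdd n (t * s)) c (1 + N) := by
    refine ⟨(hn.oneAdd hts).temperate, (hn.oneAdd hts).bound, (hn.oneAdd hts).bound_pd,
      fun x z => ?_⟩
    rw [oneAdd_form]
    exact hlow t ht x z
  have h2 := (hC _ hell φ).2.2
  rw [hamS_apply, map_add]
  refine (norm_add_le _ _).trans ?_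
  have h3 := h2 0 0
  have h4 := h2 1 1
  have h5 := norm_nonneg (toL2 (divS b (Landau.oneAdd n (t * s)) φ))
  linarith

/-! ### Properties of the form of the perturbation -/

lemma IsHermCoeff.inner_divS_symm (hn : IsHermCoeff n N) (φ ψ : Schw) :
    inner ℂ (toL2 φ) (toL2 (divS b n ψ)) = inner ℂ (toL2 (divS b n φ)) (toL2 ψ) := by
  rw [← inner_conj_symm (toL2 (divS b n φ)), inner_divS, inner_divS, map_sum]
  simp only [map_sum, inner_conj_symm]
  rw [Finset.sum_comm]
  refine Finset.sum_congr rfl fun j _ => Finset.sum_congr rfl fun k _ => ?_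
  have e : (fun x => conj (n j k x)) = n k j := funext fun x => hn.herm j k x
  have h := inner_mulS (hn.temperate j k) (hasTemperateGrowth_conj (hn.temperate j k))
    (piS b k φ) (piS b j ψ)
  rw [e] at h
  exact h.symm

lemma IsHermCoeff.inner_pertS_symm (hn : IsHermCoeff n N) (hb : 0 < b) (f g : L2) :
    inner ℂ (res0 b f) (pertS b n g) = inner ℂ (pertS b n f) (res0 b g) := by
  refine hamS_induction hb (p := fun f => inner ℂ (res0 b f) (pertS b n g) =
    inner ℂ (pertS b n f) (res0 b g))
    (isClosed_eq (by fun_prop) (by fun_prop)) (fun φ => ?_) f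
  refine hamS_induction hb (p := fun g => inner ℂ (res0 b (toL2 (hamS b φ))) (pertS b n g) =
    inner ℂ (pertS b n (toL2 (hamS b φ))) (res0 b g))
    (isClosed_eq (by fun_prop) (by fun_prop)) (fun ψ => ?_) g
  rw [res0_apply hb, res0_apply hb, hn.pertS_apply hb, hn.pertS_apply hb, hn.inner_divS_symm]

lemma IsCoeff.re_inner_pertS_nonneg (hn : IsCoeff n N) (hb : 0 < b)
    (h0 : ∀ x (z : Fin 2 → ℂ), 0 ≤ (∑ j, ∑ k, conj (z j) * (n j k x * z k)).re) (f : L2) :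
    0 ≤ (inner ℂ (res0 b f) (pertS b n f)).re := by
  refine hamS_induction hb (p := fun f => 0 ≤ (inner ℂ (res0 b f) (pertS b n f)).re)
    (isClosed_le (by fun_prop) (Complex.continuous_re.comp (by fun_prop))) (fun φ => ?_) f
  rw [res0_apply hb, hn.pertS_apply hb, inner_divS]
  have := form_lower (c := 0) hn.temperate (fun x z => by rw [zero_mul]; exact h0 x z)
    (fun j => piS b j φ)
  rwa [zero_mul] at this

lemma IsCoeff.pertS_oneAdd (hn : IsCoeff n N) (hb : 0 < b) {s : ℝ} (hs : |s| ≤ 1) (f : L2) :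
    pertS b (Landau.oneAdd n s) f = f + (s : ℂ) • pertS b n f := by
  refine hamS_induction hb (p := fun f => pertS b (Landau.oneAdd n s) f = f + (s : ℂ) • pertS b n f)
    (isClosed_eq (by fun_prop) (by fun_prop)) (fun φ => ?_) f
  rw [(hn.oneAdd hs).pertS_apply hb, hn.pertS_apply hb, hn.divS_oneAdd, map_add, map_smul]

lemma re_inner_res0_eq (hb : 0 < b) (f : L2) :
    (inner ℂ (res0 b f) f).re = ∑ j, ‖extS b (piS b j) f‖ ^ 2 := by
  refine hamS_induction hb (p := fun f => (inner ℂ (res0 b f) f).re =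
    ∑ j, ‖extS b (piS b j) f‖ ^ 2)
    (isClosed_eq (Complex.continuous_re.comp (by fun_prop)) (by fun_prop)) (fun φ => ?_) f
  have e : inner ℂ (toL2 φ) (toL2 (hamS b φ)) =
      ((∑ j, ‖toL2 (piS b j φ)‖ ^ 2 : ℝ) : ℂ) := by
    rw [hamS_apply, map_add, inner_add_right, ← inner_piS b 0 φ, ← inner_piS b 1 φ,
      ← norm_sq_toL2_eq, ← norm_sq_toL2_eq, Fin.sum_univ_two, Complex.ofReal_add]
  simp only [res0_apply hb, e, Complex.ofReal_re, extS_piS_apply hb]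

lemma re_inner_res0_nonneg (hb : 0 < b) (f : L2) : 0 ≤ (inner ℂ (res0 b f) f).re := by
  rw [re_inner_res0_eq hb]
  exact Finset.sum_nonneg fun j _ => sq_nonneg _

end Landau

end

noncomputable section

namespace Landau

open Function (HasTemperateGrowth)

/-! ### The inverse of the perturbed Hamiltonians -/

/-- The inverse of `1 + s W H₀⁻¹`. -/
def invB (b : ℝ) (n : Fin 2 → Fin 2 → Plane → ℂ) (s : ℝ) : L2 →L[ℂ] L2 :=
  Ring.inverse (1 + (s : ℂ) • pertS b n)

/-- The inverse of `H₀ + s W`. -/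
def resP (b : ℝ) (n : Fin 2 → Fin 2 → Plane → ℂ) (s : ℝ) : L2 →L[ℂ] L2 :=
  res0 b ∘L invB b n s

/-- The operator `H₀⁻¹ W (H₀ + s W)⁻¹`. -/
def toepT (b : ℝ) (n : Fin 2 → Fin 2 → Plane → ℂ) (s : ℝ) : L2 →L[ℂ] L2 :=
  res0 b ∘L pertS b n ∘L invB b n s

variable {b : ℝ} {n : Fin 2 → Fin 2 → Plane → ℂ} {N s : ℝ}

lemma invB_add (hu : IsUnit (1 + (s : ℂ) • pertS b n)) (g : L2) :
    invB b n s g + (s : ℂ) • pertS b n (invB b n s g) = g :=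
  congrArg (fun A : L2 →L[ℂ] L2 => A g) (Ring.mul_inverse_cancel _ hu)

lemma invB_apply_add (hu : IsUnit (1 + (s : ℂ) • pertS b n)) (f : L2) :
    invB b n s (f + (s : ℂ) • pertS b n f) = f :=
  congrArg (fun A : L2 →L[ℂ] L2 => A f) (Ring.inverse_mul_cancel _ hu)

/-- The substitution g = (1 + sK)f with K = W H₀⁻¹ turns statements about the inverses into
statements about H₀⁻¹ and K alone: the resolvent of H₀ + sW at g becomes H₀⁻¹ f, and `toepT` becomes
H₀⁻¹ K f. -/
lemma exists_eq_add (hu : IsUnit (1 + (s : ℂ) • pertS b n)) (g : L2) :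
    ∃ f, g = f + (s : ℂ) • pertS b n f := ⟨_, (invB_add hu g).symm⟩

lemma resP_apply_add (hu : IsUnit (1 + (s : ℂ) • pertS b n)) (f : L2) :
    resP b n s (f + (s : ℂ) • pertS b n f) = res0 b f := by
  rw [resP, ContinuousLinearMap.comp_apply, invB_apply_add hu]

lemma toepT_apply_add (hu : IsUnit (1 + (s : ℂ) • pertS b n)) (f : L2) :
    toepT b n s (f + (s : ℂ) • pertS b n f) = res0 b (pertS b n f) := by
  rw [toepT, ContinuousLinearMap.comp_apply, ContinuousLinearMap.comp_apply, invB_apply_add hu]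

lemma res0_sub_resP (hu : IsUnit (1 + (s : ℂ) • pertS b n)) (g : L2) :
    res0 b g - resP b n s g = (s : ℂ) • toepT b n s g := by
  obtain ⟨f, rfl⟩ := exists_eq_add hu g
  rw [resP_apply_add hu, toepT_apply_add hu, map_add, map_smul, add_sub_cancel_left]

lemma IsHermCoeff.inner_toepT_symm (hn : IsHermCoeff n N) (hb : 0 < b)
    (hu : IsUnit (1 + (s : ℂ) • pertS b n)) (f g : L2) :
    inner ℂ (toepT b n s f) g = inner ℂ f (toepT b n s g) := by
  obtain ⟨f, rfl⟩ := exists_eq_add hu f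
  obtain ⟨g, rfl⟩ := exists_eq_add hu g
  rw [toepT_apply_add hu, toepT_apply_add hu]
  simp only [inner_add_left, inner_add_right, inner_smul_left, inner_smul_right,
    Complex.conj_ofReal]
  rw [inner_res0 hb, inner_res0 hb, ← hn.inner_pertS_symm hb f g, inner_res0 hb]

/-- With K = W H₀⁻¹ the form at f + K f is ⟨H₀⁻¹ K f, f⟩ + ⟨H₀⁻¹ K f, K f⟩. Both terms are
nonnegative, the first as the form of W and the second as that of H₀⁻¹. -/
lemma IsHermCoeff.re_inner_toepT_plus (hn : IsHermCoeff n N) (hb : 0 < b)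
    (hu : IsUnit (1 + ((1 : ℝ) : ℂ) • pertS b n)) (f : L2) :
    0 ≤ (inner ℂ (toepT b n 1 f) f).re := by
  obtain ⟨f, rfl⟩ := exists_eq_add hu f
  rw [toepT_apply_add hu, inner_add_right, Complex.ofReal_one, one_smul, Complex.add_re]
  refine add_nonneg ?_ (re_inner_res0_nonneg hb _)
  rw [inner_res0 hb, ← hn.inner_pertS_symm hb]
  exact hn.re_inner_pertS_nonneg hb hn.nonneg f

/-- The form of `W` is bounded by the one of `H₀`. -/
lemma IsCoeff.re_inner_pertS_le (hn : IsCoeff n N) (hb : 0 < b)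
    (h1 : ∀ x (z : Fin 2 → ℂ),
      (∑ j, ∑ k, conj (z j) * (n j k x * z k)).re ≤ ∑ j, ‖z j‖ ^ 2) (f : L2) :
    (inner ℂ (res0 b f) (pertS b n f)).re ≤ (inner ℂ (res0 b f) f).re := by
  have hs : |(-1 : ℝ)| ≤ 1 := by simp
  have h := (hn.oneAdd hs).re_inner_pertS_nonneg hb (fun x z => by
    rw [oneAdd_form]; linarith [h1 x z]) f
  rw [hn.pertS_oneAdd hb hs, inner_add_right, inner_smul_right, Complex.add_re,
    Complex.re_ofReal_mul] at h
  linarith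

/-- With K = W H₀⁻¹ and h = K f the claim is ⟨H₀⁻¹ h, f⟩ ≥ ⟨H₀⁻¹ h, h⟩. Nonnegativity of the form of
W at H₀⁻¹(f - h) gives ⟨H₀⁻¹ h, f⟩ - 2⟨H₀⁻¹ h, h⟩ + ⟨H₀⁻¹ h, K h⟩ ≥ 0, and W ≤ H₀ bounds the last
term by ⟨H₀⁻¹ h, h⟩. -/
lemma IsHermCoeff.re_inner_toepT_minus (hn : IsHermCoeff n N) (hb : 0 < b)
    (h1 : ∀ x (z : Fin 2 → ℂ),
      (∑ j, ∑ k, conj (z j) * (n j k x * z k)).re ≤ ∑ j, ‖z j‖ ^ 2)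
    (hu : IsUnit (1 + ((-1 : ℝ) : ℂ) • pertS b n)) (f : L2) :
    0 ≤ (inner ℂ (toepT b n (-1) f) f).re := by
  obtain ⟨f, rfl⟩ := exists_eq_add hu f
  set h := pertS b n f with hh
  have h2 := hn.re_inner_pertS_nonneg hb hn.nonneg (f - h)
  have h3 := hn.re_inner_pertS_le hb h1 h
  have e1 : inner ℂ (res0 b f) (pertS b n h) = inner ℂ h (res0 b h) :=
    hn.inner_pertS_symm hb f h
  have e2 : inner ℂ (res0 b h) (pertS b n f) = inner ℂ (res0 b h) h := rfl
  have e3 : inner ℂ h (res0 b h) = inner ℂ (res0 b h) h := (inner_res0 hb h h).symm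
  have e4 : inner ℂ (res0 b f) (pertS b n f) = inner ℂ (res0 b h) f := by
    rw [hn.inner_pertS_symm hb, inner_res0 hb]
  have e5 : pertS b n (f - h) = h - pertS b n h := map_sub _ _ _
  rw [e5, map_sub, inner_sub_left, inner_sub_right, inner_sub_right, e1, e3] at h2
  change 0 ≤ (inner ℂ (res0 b f) (pertS b n f) - inner ℂ (res0 b h) h -
    (inner ℂ (res0 b h) (pertS b n f) - inner ℂ (res0 b h) (pertS b n h))).re at h2
  rw [e4, e2] at h2
  simp only [Complex.sub_re] at h2
  rw [toepT_apply_add hu, inner_add_right, inner_smul_right, Complex.add_re,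
    Complex.re_ofReal_mul]
  change 0 ≤ (inner ℂ (res0 b h) f).re + -1 * (inner ℂ (res0 b h) h).re
  linarith

/-- Excludes nonpositive eigenvalues of H₋ from the unbounded interval below Λ₀. -/
lemma IsHermCoeff.re_inner_resP_minus (hn : IsHermCoeff n N) (hb : 0 < b)
    (h1 : ∀ x (z : Fin 2 → ℂ),
      (∑ j, ∑ k, conj (z j) * (n j k x * z k)).re ≤ ∑ j, ‖z j‖ ^ 2)
    (hu : IsUnit (1 + ((-1 : ℝ) : ℂ) • pertS b n)) (f : L2) :
    0 ≤ (inner ℂ (resP b n (-1) f) f).re := by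
  obtain ⟨f, rfl⟩ := exists_eq_add hu f
  have h3 := hn.re_inner_pertS_le hb h1 f
  rw [resP_apply_add hu, inner_add_right, inner_smul_right, Complex.add_re,
    Complex.re_ofReal_mul]
  linarith

/-! ### Graphs of `W` and `H_±` -/

variable {m : Plane → Matrix (Fin 2) (Fin 2) ℂ}

/-- Only the action of W on the range of H₀⁻¹ is needed, whatever the natural domain of W is. -/
lemma mem_graph_W (hb : 0 < b) (hm : IsCoeff (fun j k x => m x j k) N) {f w : L2} :
    (res0 b f, w) ∈ (W b m).graph ↔ w = pertS b (fun j k x => m x j k) f := by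
  have h : (res0 b f, pertS b (fun j k x => m x j k) f) ∈ (W b m).graph := by
    have ht : ∀ j k, (res0 b f, extS b (piS b j ∘L mulS (fun x => m x j k) ∘L piS b k) f) ∈
        (opComp (piOp b j) (opComp (mulOp fun x => m x j k) (piOp b k))).graph := by
      intro j k
      refine mem_graph_opComp.2 ⟨_, mem_graph_opComp.2 ⟨_, mem_graph_piOp.2 (res0_mem_piGraph hb k f),
        (mem_graph_mulOp_iff (hm.temperate j k).1.continuous (hm.bound j k)).2 rfl⟩,
        mem_graph_piOp.2 (hm.term_mem_piGraph hb j k f)⟩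
    rw [W, hm.pertS_eq_sum hb]
    simp only [Fin.sum_univ_two]
    exact mem_graph_add.2 ⟨_, _, mem_graph_add.2 ⟨_, _, ht 0 0, ht 0 1, rfl⟩,
      mem_graph_add.2 ⟨_, _, ht 1 0, ht 1 1, rfl⟩, rfl⟩
  constructor
  · intro h'
    exact LinearPMap.mem_graph_snd_inj _ h' h rfl
  · rintro rfl
    exact h

theorem isInverse_Hplus (hb : 0 < b) (hm : IsCoeff (fun j k x => m x j k) N)
    (hu : IsUnit (1 + ((1 : ℝ) : ℂ) • pertS b (fun j k x => m x j k))) :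
    IsInverse (Hplus b m) (resP b (fun j k x => m x j k) 1) := by
  intro u g
  rw [Hplus, mem_graph_add]
  constructor
  · rintro ⟨f, w, hf, hw, rfl⟩
    have hf' := (isInverse_H0 hb _ _).1 hf
    subst hf'
    have hw' := (mem_graph_W hb hm).1 hw
    subst hw'
    have := resP_apply_add hu f
    rw [Complex.ofReal_one, one_smul] at this
    exact this.symm
  · rintro rfl
    refine ⟨invB b _ 1 g, _, (isInverse_H0 hb _ _).2 rfl, (mem_graph_W hb hm).2 rfl, ?_⟩
    have := invB_add hu g
    rw [Complex.ofReal_one, one_smul] at this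
    exact this.symm

theorem isInverse_Hminus (hb : 0 < b) (hm : IsCoeff (fun j k x => m x j k) N)
    (hu : IsUnit (1 + ((-1 : ℝ) : ℂ) • pertS b (fun j k x => m x j k))) :
    IsInverse (Hminus b m) (resP b (fun j k x => m x j k) (-1)) := by
  intro u g
  rw [Hminus, mem_graph_sub]
  have hneg : ∀ v : L2, ((-1 : ℝ) : ℂ) • v = -v := fun v => by
    rw [Complex.ofReal_neg, Complex.ofReal_one, neg_one_smul]
  constructor
  · rintro ⟨f, w, hf, hw, rfl⟩
    have hf' := (isInverse_H0 hb _ _).1 hf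
    subst hf'
    have hw' := (mem_graph_W hb hm).1 hw
    subst hw'
    have := resP_apply_add hu f
    rw [hneg, ← sub_eq_add_neg] at this
    exact this.symm
  · rintro rfl
    refine ⟨invB b _ (-1) g, _, (isInverse_H0 hb _ _).2 rfl, (mem_graph_W hb hm).2 rfl, ?_⟩
    have := invB_add hu g
    rw [hneg, ← sub_eq_add_neg] at this
    exact this.symm

/-! ### The spectral decomposition of the inverse of the Landau Hamiltonian -/

lemma level_pos (hb : 0 < b) (q : ℕ) : 0 < level b q := by unfold level; positivity

lemma res0_stN (hb : 0 < b) (i : ℕ × ℕ) :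
    res0 b (stN hb i) = (((level b i.2)⁻¹ : ℝ) : ℂ) • stN hb i := by
  have hl : (level b i.2 : ℂ) ≠ 0 := Complex.ofReal_ne_zero.2 (level_pos hb _).ne'
  have h := res0_apply hb (stS hb i.1 i.2)
  rw [hamS_stS, map_smul, map_smul] at h
  have h2 : res0 b (toL2 (stS hb i.1 i.2)) = (level b i.2 : ℂ)⁻¹ • toL2 (stS hb i.1 i.2) := by
    rw [eq_inv_smul_iff₀ hl, h]
  rw [stN, map_smul, h2, smul_comm, Complex.ofReal_inv, Complex.ofReal_inv]

lemma inner_stN_res0 (hb : 0 < b) (i : ℕ × ℕ) (w : L2) :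
    inner ℂ (stN hb i) (res0 b w) = (((level b i.2)⁻¹ : ℝ) : ℂ) * inner ℂ (stN hb i) w := by
  rw [← inner_res0 hb, res0_stN, inner_smul_left, Complex.conj_ofReal]

lemma hasSum_norm_sq (hb : 0 < b) (w : L2) :
    HasSum (fun i : ℕ × ℕ => ‖inner ℂ (stN hb i) w‖ ^ 2) (‖w‖ ^ 2) := by
  have h := Complex.hasSum_re ((basis hb).hasSum_inner_mul_inner w w)
  have e : (inner ℂ w w).re = ‖w‖ ^ 2 := (norm_sq_eq_re_inner (𝕜 := ℂ) w).symm
  rw [e] at h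
  convert! h using 2 with i
  rw [basis_apply, ← inner_conj_symm w, mul_comm, Complex.mul_conj, Complex.ofReal_re,
    Complex.normSq_eq_norm_sq]

lemma hasSum_form (hb : 0 < b) (β α : ℝ) (w : L2) :
    HasSum (fun i : ℕ × ℕ => ((level b i.2)⁻¹ - β) * ((level b i.2)⁻¹ - α) *
      ‖inner ℂ (stN hb i) w‖ ^ 2)
      (inner ℂ (res0 b w - (β : ℂ) • w) (res0 b w - (α : ℂ) • w)).re := by
  have h := Complex.hasSum_re
    ((basis hb).hasSum_inner_mul_inner (res0 b w - (β : ℂ) • w) (res0 b w - (α : ℂ) • w))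
  convert! h using 2 with i
  have e : ∀ t : ℝ, inner ℂ (stN hb i) (res0 b w - (t : ℂ) • w) =
      (((level b i.2)⁻¹ - t : ℝ) : ℂ) * inner ℂ (stN hb i) w := fun t => by
    rw [inner_sub_right, inner_stN_res0, inner_smul_right, Complex.ofReal_sub, sub_mul]
  rw [basis_apply, ← inner_conj_symm _ (stN hb i), e, e, map_mul, Complex.conj_ofReal,
    mul_mul_mul_comm, ← Complex.ofReal_mul, Complex.re_ofReal_mul, mul_comm (conj _),
    Complex.mul_conj, Complex.ofReal_re, Complex.normSq_eq_norm_sq]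

/-- Parseval in the Landau basis: a lower bound for the product on the levels that w actually meets
suffices. -/
lemma form_ge (hb : 0 < b) {β α γ : ℝ} {w : L2}
    (h : ∀ i : ℕ × ℕ, inner ℂ (stN hb i) w = 0 ∨
      γ ≤ ((level b i.2)⁻¹ - β) * ((level b i.2)⁻¹ - α)) :
    γ * ‖w‖ ^ 2 ≤ (inner ℂ (res0 b w - (β : ℂ) • w) (res0 b w - (α : ℂ) • w)).re := by
  refine hasSum_le (fun i => ?_) ((hasSum_norm_sq hb w).mul_left γ) (hasSum_form hb β α w)
  rcases h i with h0 | h0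
  · simp [h0]
  · exact mul_le_mul_of_nonneg_right h0 (sq_nonneg _)

/-! ### The spectral projections -/

lemma mem_eigenspace_H0 (hb : 0 < b) (q : ℕ) {u : L2} :
    u ∈ eigenspace (H0 b) (level b q : ℂ) ↔ res0 b u = (((level b q)⁻¹ : ℝ) : ℂ) • u := by
  have hl : (level b q : ℂ) ≠ 0 := Complex.ofReal_ne_zero.2 (level_pos hb _).ne'
  rw [(isInverse_H0 hb).mem_eigenspace, Complex.ofReal_inv, eq_inv_smul_iff₀ hl, eq_comm]

lemma mem_topologicalClosure_eigenspace_H0 (hb : 0 < b) (q : ℕ) {u : L2} :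
    u ∈ (eigenspace (H0 b) (level b q : ℂ)).topologicalClosure ↔
      res0 b u = (((level b q)⁻¹ : ℝ) : ℂ) • u := by
  have hc : IsClosed (eigenspace (H0 b) (level b q : ℂ) : Set L2) := by
    have : (eigenspace (H0 b) (level b q : ℂ) : Set L2) =
        {u | res0 b u = (((level b q)⁻¹ : ℝ) : ℂ) • u} := by
      ext u; exact mem_eigenspace_H0 hb q
    rw [this]
    exact isClosed_eq (by fun_prop) (by fun_prop)
  rw [hc.submodule_topologicalClosure_eq, mem_eigenspace_H0 hb]

theorem isSpecProj_P (hb : 0 < b) (q : ℕ) : IsSpecProj (res0 b) (P b q) (level b q)⁻¹ where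
  symm u v := Submodule.inner_starProjection_left_eq_right _ u v
  map u := (mem_topologicalClosure_eigenspace_H0 hb q).1 (Submodule.starProjection_apply_mem _ u)
  fix _ hu := Submodule.starProjection_eq_self_iff.2
    ((mem_topologicalClosure_eigenspace_H0 hb q).2 hu)

lemma P_stN (hb : 0 < b) (k q : ℕ) : P b q (stN hb (k, q)) = stN hb (k, q) :=
  (isSpecProj_P hb q).fix _ (res0_stN hb (k, q))

lemma inner_stN_of_P_eq_zero (hb : 0 < b) {k q : ℕ} {w : L2} (h : P b q w = 0) :
    inner ℂ (stN hb (k, q)) w = 0 := by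
  rw [← P_stN, (isSpecProj_P hb q).symm, h, inner_zero_right]

lemma P_res0 (hb : 0 < b) (q : ℕ) (f : L2) :
    P b q (res0 b f) = (((level b q)⁻¹ : ℝ) : ℂ) • P b q f := by
  refine ext_inner_left ℂ fun v => ?_
  rw [← (isSpecProj_P hb q).symm, ← inner_res0 hb, (isSpecProj_P hb q).map, inner_smul_left,
    Complex.conj_ofReal, inner_smul_right, (isSpecProj_P hb q).symm]

end Landau

end

noncomputable section

namespace Landau

open Function (HasTemperateGrowth)

/-! ### Compactness criteria -/

lemma isCompactOperator_of_approx {T : L2 →L[ℂ] L2}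
    (h : ∀ δ > 0, ∃ S : L2 →L[ℂ] L2, IsCompactOperator S ∧ ‖T - S‖ ≤ δ) :
    IsCompactOperator T := by
  have hc : IsClosed {f : L2 →L[ℂ] L2 | IsCompactOperator f} := isClosed_setOfPred_isCompactOperator
  refine hc.closure_subset (Metric.mem_closure_iff.2 fun δ hδ => ?_)
  obtain ⟨S, hS, hTS⟩ := h (δ / 2) (by positivity)
  refine ⟨S, hS, ?_⟩
  rw [dist_eq_norm]
  linarith

/-- Hilbert–Schmidt operators are compact. -/
lemma isCompactOperator_of_summable {ι : Type*} (e : HilbertBasis ι ℂ L2) {T : L2 →L[ℂ] L2}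
    (h : Summable fun i => ‖T (e i)‖ ^ 2) : IsCompactOperator T := by
  refine IsCompactOperator.of_exists_small fun δ hδ => ?_
  -- Orthogonally to the basis vectors in s only the tail of the sum, of size less than δ², acts,
  -- and Cauchy–Schwarz gives ‖T w‖ ≤ δ‖w‖.
  obtain ⟨s, hs⟩ := summable_iff_vanishing_norm.1 h (δ ^ 2) (by positivity)
  refine ⟨Submodule.span ℂ (e '' s), FiniteDimensional.span_of_finite ℂ (s.finite_toSet.image e),
    fun w hw => ?_⟩
  have h0 : ∀ i ∈ s, inner ℂ (e i) w = 0 := fun i hi =>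
    (Submodule.mem_orthogonal _ _).1 hw _ (Submodule.subset_span ⟨i, hi, rfl⟩)
  have hsum : HasSum (fun i => inner ℂ (e i) w • T (e i)) (T w) := by
    have := (e.hasSum_repr w).mapL T
    simpa only [map_smul, e.repr_apply_apply] using this
  refine le_of_tendsto hsum.norm (Eventually.of_forall fun t => ?_)
  classical
  have e1 : ∑ i ∈ t, inner ℂ (e i) w • T (e i) = ∑ i ∈ t \ s, inner ℂ (e i) w • T (e i) := by
    refine (Finset.sum_subset Finset.sdiff_subset fun i hi hi' => ?_).symm
    have his : i ∈ s := by
      by_contra his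
      exact hi' (Finset.mem_sdiff.2 ⟨hi, his⟩)
    rw [h0 i his, zero_smul]
  rw [e1]
  refine (norm_sum_le _ _).trans ?_
  simp only [norm_smul]
  refine (Real.sum_mul_le_sqrt_mul_sqrt _ _ _).trans ?_
  rw [mul_comm]
  refine mul_le_mul ?_ ?_ (Real.sqrt_nonneg _) hδ.le
  · rw [Real.sqrt_le_left hδ.le]
    have h2 := hs (t \ s) Finset.sdiff_disjoint
    exact (le_abs_self _).trans h2.le
  · rw [Real.sqrt_le_left (norm_nonneg _)]
    exact e.orthonormal.sum_inner_products_le w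

/-! ### Local decay of the Landau states -/

lemma IsTest.hasTemperateGrowth {χ : Plane → ℂ} (h : IsTest χ) : HasTemperateGrowth χ :=
  h.compact.hasTemperateGrowth h.smooth

lemma IsTest.pd {χ : Plane → ℂ} (h : IsTest χ) (j : Fin 2) : IsTest (Landau.pd j χ) := by
  refine ⟨(hasTemperateGrowth_pd h.hasTemperateGrowth j).1, ?_⟩
  exact h.compact.fderiv_apply ℝ _

variable {b : ℝ}

lemma stS_succ_zero (hb : 0 < b) (k : ℕ) :
    stS hb (k + 1) 0 = (Complex.I * b) • mulS zf (stS hb k 0) := by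
  rw [← cocS_stS, cocS_apply, annS_stS_zero, zero_add]

lemma norm_mulS_stS_succ_zero_le (hb : 0 < b) {χ : Plane → ℂ} (h : IsTest χ) {R : ℝ}
    (hR : ∀ x, χ x ≠ 0 → ‖x‖ ≤ R) (k : ℕ) :
    ‖toL2 (mulS χ (stS hb (k + 1) 0))‖ ≤ b * R * ‖toL2 (mulS χ (stS hb k 0))‖ := by
  refine Lp.norm_le_mul_norm_of_ae_le_mul ?_
  filter_upwards [coeFn_toL2 (mulS χ (stS hb (k + 1) 0)), coeFn_toL2 (mulS χ (stS hb k 0))]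
    with x h1 h2
  rw [h1, h2, mulS_apply h.hasTemperateGrowth, mulS_apply h.hasTemperateGrowth, stS_succ_zero,
    smul_apply, mulS_apply hasTemperateGrowth_zf, smul_eq_mul, norm_mul, norm_mul, norm_mul,
    norm_mul, norm_mul, norm_zf, Complex.norm_I, Complex.norm_real, Real.norm_eq_abs,
    abs_of_pos hb, one_mul]
  by_cases hx : χ x = 0
  · simp [hx]
  · have := hR x hx
    calc ‖χ x‖ * (b * (‖x‖ * ‖stS hb k 0 x‖)) ≤ ‖χ x‖ * (b * (R * ‖stS hb k 0 x‖)) := by gcongr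
      _ = _ := by ring

/-- The relative weight of the state `(k, q)` on the function `χ`. -/
def locW (hb : 0 < b) (χ : Plane → ℂ) (q k : ℕ) : ℝ :=
  ‖toL2 (mulS χ (stS hb k q))‖ ^ 2 / ‖toL2 (stS hb k 0)‖ ^ 2

lemma locW_nonneg (hb : 0 < b) (χ : Plane → ℂ) (q k : ℕ) : 0 ≤ locW hb χ q k := by
  unfold locW; positivity

/-- In the lowest level c† is multiplication by i b z. On |x| ≤ R it multiplies the squared local
norm by at most (bR)², while the full squared norm grows by 2b(k + 1). The weights are thus
dominated by Cᵏ/k! with C = bR²/2. -/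
lemma summable_locW_zero (hb : 0 < b) {χ : Plane → ℂ} (h : IsTest χ) :
    Summable (locW hb χ 0) := by
  obtain ⟨R, hR⟩ := h.compact.isCompact.isBounded.exists_norm_le
  have hR' : ∀ x, χ x ≠ 0 → ‖x‖ ≤ R := fun x hx => hR x (subset_tsupport _ hx)
  set C := b * R ^ 2 / 2
  have hC : 0 ≤ C := by positivity
  refine Summable.of_nonneg_of_le (locW_nonneg hb χ 0) (fun k => ?_)
    ((Real.summable_pow_div_factorial C).mul_right (locW hb χ 0 0))
  induction k with
  | zero => simp
  | succ k ih =>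
    have h1 := norm_mulS_stS_succ_zero_le hb h hR' k
    have h2 : ‖toL2 (mulS χ (stS hb (k + 1) 0))‖ ^ 2 ≤
        (b * R) ^ 2 * ‖toL2 (mulS χ (stS hb k 0))‖ ^ 2 := by
      rw [← mul_pow]
      exact pow_le_pow_left₀ (norm_nonneg _) h1 2
    have h3 : locW hb χ 0 (k + 1) ≤ C / (k + 1) * locW hb χ 0 k := by
      have hp := norm_stS_pos hb k 0
      rw [locW, norm_sq_stS_succ_left, div_le_iff₀ (by positivity)]
      refine h2.trans (le_of_eq ?_)
      simp only [locW, C]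
      field_simp
    refine h3.trans ?_
    calc C / (k + 1) * locW hb χ 0 k
        ≤ C / (k + 1) * (C ^ k / (k.factorial : ℝ) * locW hb χ 0 0) := by gcongr
      _ = _ := by
        rw [pow_succ, Nat.factorial_succ]
        push_cast
        field_simp

lemma norm_creS_le (hb : 0 < b) (φ : Schw) :
    ‖toL2 (creS b φ)‖ ≤ ‖toL2 (annS b φ)‖ + √(2 * b) * ‖toL2 φ‖ := by
  have e : ‖toL2 (creS b φ)‖ ^ 2 = ‖toL2 (annS b φ)‖ ^ 2 + 2 * b * ‖toL2 φ‖ ^ 2 := by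
    apply Complex.ofReal_injective
    rw [norm_sq_toL2_eq, inner_creS, annS_creS, map_add, inner_add_right, ← inner_annS, map_smul,
      inner_smul_right, ← norm_sq_toL2_eq, ← norm_sq_toL2_eq]
    push_cast
    ring
  refine abs_le_of_sq_le_sq' ?_ (by positivity) |>.2
  rw [e]
  have h2 : √(2 * b) ^ 2 = 2 * b := Real.sq_sqrt (by positivity)
  have h3 : 0 ≤ ‖toL2 (annS b φ)‖ * (√(2 * b) * ‖toL2 φ‖) := by positivity
  have h4 : (‖toL2 (annS b φ)‖ + √(2 * b) * ‖toL2 φ‖) ^ 2 = ‖toL2 (annS b φ)‖ ^ 2 +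
      √(2 * b) ^ 2 * ‖toL2 φ‖ ^ 2 + 2 * (‖toL2 (annS b φ)‖ * (√(2 * b) * ‖toL2 φ‖)) := by ring
  rw [h4, h2]
  linarith

lemma mulS_creS {χ : Plane → ℂ} (h : HasTemperateGrowth χ) (φ : Schw) :
    mulS χ (creS b φ) = creS b (mulS χ φ) + Complex.I • mulS (pd 0 χ) φ + mulS (pd 1 χ) φ := by
  have hI : Complex.I • Complex.I • mulS (pd 1 χ) φ = -mulS (pd 1 χ) φ := by
    rw [smul_smul, Complex.I_mul_I, neg_one_smul]
  rw [creS_apply, creS_apply, piS_mulS h, piS_mulS h, map_sub, map_smul, smul_sub, hI]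
  abel

lemma annS_mulS {χ : Plane → ℂ} (h : HasTemperateGrowth χ) (φ : Schw) :
    annS b (mulS χ φ) = mulS χ (annS b φ) - Complex.I • mulS (pd 0 χ) φ + mulS (pd 1 χ) φ := by
  have hI : Complex.I • Complex.I • mulS (pd 1 χ) φ = -mulS (pd 1 χ) φ := by
    rw [smul_smul, Complex.I_mul_I, neg_one_smul]
  rw [annS_apply, annS_apply, piS_mulS h, piS_mulS h, map_add, map_smul, smul_sub, hI]
  abel

/-- Commute χ past a†, replace a† by a at the cost of √(2b), and commute back. The derivatives of χ
that appear are again test functions whenever χ is one, which lets an induction over the levels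
close. -/
lemma norm_mulS_creS_le (hb : 0 < b) {χ : Plane → ℂ} (h : HasTemperateGrowth χ) (φ : Schw) :
    ‖toL2 (mulS χ (creS b φ))‖ ≤ ‖toL2 (mulS χ (annS b φ))‖ + √(2 * b) * ‖toL2 (mulS χ φ)‖ +
      2 * ‖toL2 (mulS (pd 0 χ) φ)‖ + 2 * ‖toL2 (mulS (pd 1 χ) φ)‖ := by
  have h1 := norm_creS_le hb (mulS χ φ)
  rw [annS_mulS h] at h1
  rw [mulS_creS h]
  simp only [map_add, map_sub, map_smul] at h1 ⊢
  have hI : ∀ v : L2, ‖Complex.I • v‖ = ‖v‖ := fun v => by rw [norm_smul, Complex.norm_I, one_mul]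
  have h2 := norm_add₃_le (a := toL2 (creS b (mulS χ φ))) (b := Complex.I • toL2 (mulS (pd 0 χ) φ))
    (c := toL2 (mulS (pd 1 χ) φ))
  have h3 := norm_add_le (toL2 (mulS χ (annS b φ)) - Complex.I • toL2 (mulS (pd 0 χ) φ))
    (toL2 (mulS (pd 1 χ) φ))
  have h4 := norm_sub_le (toL2 (mulS χ (annS b φ))) (Complex.I • toL2 (mulS (pd 0 χ) φ))
  rw [hI] at h2 h4
  linarith

lemma sq_sum_four_le (x y z w : ℝ) : (x + y + z + w) ^ 2 ≤ 4 * (x ^ 2 + y ^ 2 + z ^ 2 + w ^ 2) := by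
  nlinarith [sq_nonneg (x - y), sq_nonneg (x - z), sq_nonneg (x - w), sq_nonneg (y - z),
    sq_nonneg (y - w), sq_nonneg (z - w)]

/-- The summability of the local weights passes through one creation operator. -/
lemma summable_mulS_creS (hb : 0 < b) {χ : Plane → ℂ} (h : IsTest χ) {φ : ℕ → Schw} {d : ℕ → ℝ}
    (hd : ∀ k, 0 ≤ d k)
    (h1 : Summable fun k => ‖toL2 (mulS χ (annS b (φ k)))‖ ^ 2 / d k)
    (h2 : ∀ χ, IsTest χ → Summable fun k => ‖toL2 (mulS χ (φ k))‖ ^ 2 / d k) :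
    Summable fun k => ‖toL2 (mulS χ (creS b (φ k)))‖ ^ 2 / d k := by
  have hs := (((h1.add ((h2 χ h).mul_left (2 * b))).add ((h2 _ (h.pd 0)).mul_left 4)).add
    ((h2 _ (h.pd 1)).mul_left 4)).mul_left 4
  refine Summable.of_nonneg_of_le (fun k => div_nonneg (sq_nonneg _) (hd k)) (fun k => ?_) hs
  have h3 := pow_le_pow_left₀ (norm_nonneg _) (norm_mulS_creS_le hb h.hasTemperateGrowth (φ k)) 2
  have h4 := h3.trans (sq_sum_four_le _ _ _ _)
  rw [mul_pow, mul_pow, mul_pow, Real.sq_sqrt (by positivity)] at h4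
  have h5 := div_le_div_of_nonneg_right h4 (hd k)
  refine h5.trans (le_of_eq ?_)
  ring

theorem summable_locW (hb : 0 < b) (q : ℕ) :
    ∀ χ : Plane → ℂ, IsTest χ → Summable (locW hb χ q) := by
  -- Two consecutive levels are carried along: reaching level q + 2 requires level q + 1 and,
  -- through a, level q.
  have key : ∀ q, (∀ χ : Plane → ℂ, IsTest χ → Summable (locW hb χ q)) ∧
      ∀ χ : Plane → ℂ, IsTest χ → Summable (locW hb χ (q + 1)) := by
    intro q
    induction q with
    | zero =>
      refine ⟨fun χ h => summable_locW_zero hb h, fun χ h => ?_⟩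
      have := summable_mulS_creS hb h (φ := fun k => stS hb k 0)
        (d := fun k => ‖toL2 (stS hb k 0)‖ ^ 2) (fun k => sq_nonneg _)
        (by simp [annS_stS_zero, summable_zero]) (fun χ h => summable_locW_zero hb h)
      exact this.congr fun k => by rw [creS_stS, locW]
    | succ q ih =>
      refine ⟨ih.2, fun χ h => ?_⟩
      have := summable_mulS_creS hb h (φ := fun k => stS hb k (q + 1))
        (d := fun k => ‖toL2 (stS hb k 0)‖ ^ 2) (fun k => sq_nonneg _)
        (by
          refine ((ih.1 χ h).mul_left (‖(2 * b * (q + 1) : ℂ)‖ ^ 2)).congr fun k => ?_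
          rw [annS_stS_succ, map_smul, map_smul, norm_smul, locW, mul_pow, mul_div_assoc])
        (fun χ h => ih.2 χ h)
      exact this.congr fun k => by rw [creS_stS, locW]
  exact (key q).1

lemma summable_mulS_piS (hb : 0 < b) {χ : Plane → ℂ} (h : IsTest χ) (j : Fin 2) (q : ℕ) :
    Summable fun k => ‖toL2 (mulS χ (piS b j (stS hb k q)))‖ ^ 2 / ‖toL2 (stS hb k 0)‖ ^ 2 := by
  have h1 : Summable fun k =>
      ‖toL2 (mulS χ (annS b (stS hb k q)))‖ ^ 2 / ‖toL2 (stS hb k 0)‖ ^ 2 := by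
    rcases q with _ | q
    · simp [annS_stS_zero, summable_zero]
    · refine ((summable_locW hb q χ h).mul_left (‖(2 * b * (q + 1) : ℂ)‖ ^ 2)).congr fun k => ?_
      rw [annS_stS_succ, map_smul, map_smul, norm_smul, locW, mul_pow, mul_div_assoc]
  have h2 := summable_locW hb (q + 1) χ h
  refine Summable.of_nonneg_of_le (fun k => div_nonneg (sq_nonneg _) (sq_nonneg _)) (fun k => ?_)
    (h1.add h2)
  rw [locW, ← add_div, ← creS_stS]
  refine div_le_div_of_nonneg_right ?_ (sq_nonneg _)
  have key : ∀ (c : ℂ) (u v : L2), ‖c‖ = 1 / 2 → ‖c • (u + v)‖ ^ 2 ≤ ‖u‖ ^ 2 + ‖v‖ ^ 2 := by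
    intro c u v hc
    rw [norm_smul, hc]
    have h3 : ‖u + v‖ ^ 2 ≤ (‖u‖ + ‖v‖) ^ 2 := pow_le_pow_left₀ (norm_nonneg _) (norm_add_le _ _) 2
    nlinarith [sq_nonneg (‖u‖ - ‖v‖)]
  fin_cases j
  · simp only [Fin.zero_eta, piS_zero_eq, map_smul, map_add]
    exact key _ _ _ (by simp)
  · simp only [Fin.mk_one, piS_one_eq, map_smul, map_sub]
    have := key (-Complex.I / 2) (toL2 (mulS χ (annS b (stS hb k q))))
      (-toL2 (mulS χ (creS b (stS hb k q)))) (by simp)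
    rwa [norm_neg, ← sub_eq_add_neg] at this

end Landau

end

noncomputable section

namespace Landau

open Function (HasTemperateGrowth)

/-! ### Compactness of the perturbation -/

variable {b : ℝ}

lemma P_stN_of_ne (hb : 0 < b) {q q' : ℕ} (h : q ≠ q') (k : ℕ) : P b q (stN hb (k, q')) = 0 := by
  have h1 := P_res0 hb q (stN hb (k, q'))
  rw [res0_stN, map_smul] at h1
  rw [← sub_eq_zero, ← sub_smul, ← Complex.ofReal_sub] at h1
  rcases smul_eq_zero.1 h1 with h2 | h2
  · exfalso
    have h3 := sub_eq_zero.1 (Complex.ofReal_eq_zero.1 h2)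
    exact h ((level_strictMono hb).injective (inv_injective h3)).symm
  · exact h2

lemma extS_piS_stN (hb : 0 < b) (j : Fin 2) (i : ℕ × ℕ) :
    extS b (piS b j) (stN hb i) = (((level b i.2)⁻¹ : ℝ) : ℂ) •
      ((‖toL2 (stS hb i.1 i.2)‖⁻¹ : ℝ) : ℂ) • toL2 (piS b j (stS hb i.1 i.2)) := by
  have hl : (level b i.2 : ℂ) ≠ 0 := Complex.ofReal_ne_zero.2 (level_pos hb _).ne'
  have h := extS_piS_apply hb j (stS hb i.1 i.2)
  rw [hamS_stS, map_smul, map_smul] at h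
  have h2 : extS b (piS b j) (toL2 (stS hb i.1 i.2)) =
      (level b i.2 : ℂ)⁻¹ • toL2 (piS b j (stS hb i.1 i.2)) := by
    rw [eq_inv_smul_iff₀ hl, h]
  rw [stN, map_smul, h2, smul_comm, Complex.ofReal_inv (level b i.2)]

lemma norm_sq_stS (hb : 0 < b) (q : ℕ) :
    ∃ c > 0, ∀ k, ‖toL2 (stS hb k q)‖ ^ 2 = c * ‖toL2 (stS hb k 0)‖ ^ 2 := by
  induction q with
  | zero => exact ⟨1, one_pos, fun k => (one_mul _).symm⟩
  | succ q ih =>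
    obtain ⟨c, hc, h⟩ := ih
    exact ⟨2 * b * (q + 1) * c, by positivity, fun k => by rw [norm_sq_stS_succ, h]; ring⟩

/-- Only the basis vectors of level q contribute to the Hilbert–Schmidt sum, and the local weights
of their images under Π_j are summable. -/
lemma isCompactOperator_level (hb : 0 < b) {χ : Plane → ℂ} (h : IsTest χ) {N : ℝ}
    (hN : ∀ x, ‖χ x‖ ≤ N) (j : Fin 2) (q : ℕ) :
    IsCompactOperator (mulL h.smooth.continuous hN ∘L extS b (piS b j) ∘L P b q) := by
  refine isCompactOperator_of_summable (basis hb) ?_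
  set f : ℕ × ℕ → ℝ := fun i =>
    ‖(mulL h.smooth.continuous hN ∘L extS b (piS b j) ∘L P b q) (basis hb i)‖ ^ 2 with hf
  have hinj : Function.Injective fun k : ℕ => (k, q) := fun _ _ h => congrArg Prod.fst h
  have hsupp : ∀ i ∉ range fun k : ℕ => (k, q), f i = 0 := by
    rintro ⟨k, q'⟩ hi
    have hq : q ≠ q' := by rintro rfl; exact hi ⟨k, rfl⟩
    simp only [hf, ContinuousLinearMap.comp_apply, basis_apply, P_stN_of_ne hb hq, map_zero,
      norm_zero]
    norm_num
  refine (hinj.summable_iff hsupp).1 ?_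
  obtain ⟨c, hc, hcn⟩ := norm_sq_stS hb q
  refine ((summable_mulS_piS hb h j q).mul_left ((level b q)⁻¹ ^ 2 * c⁻¹)).congr fun k => ?_
  simp only [hf, Function.comp_apply, ContinuousLinearMap.comp_apply, basis_apply, P_stN,
    extS_piS_stN, map_smul, mulL_toL2 h.hasTemperateGrowth]
  rw [norm_smul, norm_smul, mul_pow, mul_pow, Complex.norm_real, Complex.norm_real,
    Real.norm_eq_abs, Real.norm_eq_abs, sq_abs, sq_abs, inv_pow, inv_pow (‖_‖), hcn]
  have := norm_stS_pos hb k 0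
  field_simp

lemma hasSum_inner_res0 (hb : 0 < b) (w : L2) :
    HasSum (fun i : ℕ × ℕ => (level b i.2)⁻¹ * ‖inner ℂ (stN hb i) w‖ ^ 2)
      (inner ℂ (res0 b w) w).re := by
  have h := Complex.hasSum_re ((basis hb).hasSum_inner_mul_inner (res0 b w) w)
  convert! h using 2 with i
  rw [basis_apply, ← inner_conj_symm _ (stN hb i), inner_stN_res0, map_mul, Complex.conj_ofReal,
    mul_assoc, Complex.re_ofReal_mul, mul_comm (conj _), Complex.mul_conj, Complex.ofReal_re,
    Complex.normSq_eq_norm_sq]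

lemma inner_stN_sub_sum (hb : 0 < b) (n k q : ℕ) (w : L2) :
    inner ℂ (stN hb (k, q)) (w - ∑ p ∈ Finset.range n, P b p w) =
      if q < n then 0 else inner ℂ (stN hb (k, q)) w := by
  have e : ∀ p, inner ℂ (stN hb (k, q)) (P b p w) =
      if p = q then inner ℂ (stN hb (k, q)) w else 0 := by
    intro p
    rw [← (isSpecProj_P hb p).symm]
    split_ifs with hp
    · rw [hp, P_stN]
    · rw [P_stN_of_ne hb hp, inner_zero_left]
  rw [inner_sub_right, inner_sum]
  simp only [e, Finset.sum_ite_eq', Finset.mem_range]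
  split_ifs <;> simp

/-- The squared norm is at most the form of H₀⁻¹ on a vector supported in the levels from n on,
where H₀⁻¹ ≤ Λ_n⁻¹. Truncation to finitely many levels is thus a norm approximation. -/
lemma norm_extS_piS_sub_le (hb : 0 < b) (j : Fin 2) (n : ℕ) (w : L2) :
    ‖extS b (piS b j) (w - ∑ p ∈ Finset.range n, P b p w)‖ ^ 2 ≤ (level b n)⁻¹ * ‖w‖ ^ 2 := by
  set w' := w - ∑ p ∈ Finset.range n, P b p w
  have h1 : ‖extS b (piS b j) w'‖ ^ 2 ≤ (inner ℂ (res0 b w') w').re := by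
    rw [re_inner_res0_eq hb]
    exact Finset.single_le_sum (f := fun j => ‖extS b (piS b j) w'‖ ^ 2)
      (fun _ _ => sq_nonneg _) (Finset.mem_univ j)
  refine h1.trans (hasSum_le (fun i => ?_) (hasSum_inner_res0 hb w')
    ((hasSum_norm_sq hb w).mul_left _))
  obtain ⟨k, q⟩ := i
  have hp : 0 ≤ (level b n)⁻¹ * ‖inner ℂ (stN hb (k, q)) w‖ ^ 2 := by
    have := level_pos hb n
    positivity
  simp only [w', inner_stN_sub_sum]
  split_ifs with h
  · simpa using hp
  · have h2 : level b n ≤ level b q := (level_strictMono hb).monotone (not_lt.1 h)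
    have := level_pos hb n
    gcongr

/-- Compactness of `χ Π_j H₀⁻¹` for compactly supported `χ`. -/
lemma isCompactOperator_test (hb : 0 < b) {χ : Plane → ℂ} (h : IsTest χ) {N : ℝ}
    (hN : ∀ x, ‖χ x‖ ≤ N) (j : Fin 2) :
    IsCompactOperator (mulL h.smooth.continuous hN ∘L extS b (piS b j)) := by
  have hN0 : 0 ≤ N := (norm_nonneg _).trans (hN 0)
  refine isCompactOperator_of_approx fun δ hδ => ?_
  have hlim : Tendsto (fun n : ℕ => (level b n)⁻¹) atTop (𝓝 0) := by
    refine tendsto_inv_atTop_zero.comp ?_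
    have h1 : Tendsto (fun n : ℕ => (n : ℝ)) atTop atTop := tendsto_natCast_atTop_atTop
    exact Tendsto.const_mul_atTop hb
      (tendsto_atTop_add_const_right _ _ (h1.const_mul_atTop two_pos))
  have hδN : 0 < (δ / (N + 1)) ^ 2 := by positivity
  obtain ⟨n, hn⟩ := (hlim.eventually_lt_const hδN).exists
  refine ⟨∑ q ∈ Finset.range n, mulL h.smooth.continuous hN ∘L extS b (piS b j) ∘L P b q, ?_, ?_⟩
  · have hs : ∀ s : Finset ℕ, IsCompactOperator
        (∑ q ∈ s, mulL h.smooth.continuous hN ∘L extS b (piS b j) ∘L P b q : L2 →L[ℂ] L2) := by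
      intro s
      classical
      induction s using Finset.induction_on with
      | empty => simpa using isCompactOperator_zero
      | insert q s hq ih =>
        rw [Finset.sum_insert hq]
        exact (isCompactOperator_level hb h hN j q).add ih
    exact hs _
  · refine ContinuousLinearMap.opNorm_le_bound _ hδ.le fun w => ?_
    have e : (mulL h.smooth.continuous hN ∘L extS b (piS b j) -
        ∑ q ∈ Finset.range n, mulL h.smooth.continuous hN ∘L extS b (piS b j) ∘L P b q) w =
        mulL h.smooth.continuous hN
          (extS b (piS b j) (w - ∑ p ∈ Finset.range n, P b p w)) := by
      rw [sub_apply, map_sub, map_sub, map_sum, map_sum, sum_apply]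
      rfl
    rw [e]
    have h1 := norm_extS_piS_sub_le hb j n w
    set v := extS b (piS b j) (w - ∑ p ∈ Finset.range n, P b p w)
    have h2 : ‖mulL h.smooth.continuous hN v‖ ≤ N * ‖v‖ := by
      refine Lp.norm_le_mul_norm_of_ae_le_mul ?_
      filter_upwards [coeFn_mulL h.smooth.continuous hN v] with x hx
      rw [hx, norm_mul]
      exact mul_le_mul_of_nonneg_right (hN x) (norm_nonneg _)
    have h3 : ‖v‖ ≤ δ / (N + 1) * ‖w‖ := by
      refine abs_le_of_sq_le_sq' ?_ (by positivity) |>.2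
      rw [mul_pow]
      exact h1.trans (mul_le_mul_of_nonneg_right hn.le (sq_nonneg _))
    calc _ ≤ N * ‖v‖ := h2
      _ ≤ (N + 1) * (δ / (N + 1) * ‖w‖) := by gcongr; linarith
      _ = δ * ‖w‖ := by field_simp

/-- Compactness of `a Π_j H₀⁻¹` for smooth `a` vanishing at infinity. -/
lemma isCompactOperator_mulL_extS (hb : 0 < b) {a : Plane → ℂ} (ha : ContDiff ℝ ∞ a) {N : ℝ}
    (hN : ∀ x, ‖a x‖ ≤ N) (hlim : Tendsto a (cocompact Plane) (𝓝 0)) (j : Fin 2) :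
    IsCompactOperator (mulL ha.continuous hN ∘L extS b (piS b j)) := by
  set M := ‖extS b (piS b j)‖
  have hM : 0 ≤ M := norm_nonneg _
  refine isCompactOperator_of_approx fun δ hδ => ?_
  have hη : 0 < δ / (M + 1) := by positivity
  have hev : ∀ᶠ x in cocompact Plane, ‖a x‖ < δ / (M + 1) := by
    have := hlim.norm
    rw [norm_zero] at this
    exact this.eventually_lt_const hη
  obtain ⟨R, hR⟩ : ∃ R : ℝ, ∀ x, R < ‖x‖ → ‖a x‖ < δ / (M + 1) := by
    rw [← Metric.cobounded_eq_cocompact, ← comap_norm_atTop, eventually_comap] at hev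
    obtain ⟨R, hR⟩ := eventually_atTop.1 hev
    exact ⟨R, fun x hx => hR _ hx.le x rfl⟩
  obtain ⟨n, hn⟩ := exists_nat_ge R
  have hc1 : ∀ x, ‖cutoff n x‖ ≤ 1 := fun x => by
    rw [cutoff, Complex.norm_real, Real.norm_eq_abs, abs_of_nonneg bump.nonneg]
    exact bump.le_one
  have hone : ∀ x, ‖x‖ ≤ n → cutoff n x = 1 := fun x hx => by
    have hp : (0 : ℝ) < n + 1 := by positivity
    rw [cutoff, bump.one_of_mem_closedBall, Complex.ofReal_one]
    rw [mem_closedBall_zero_iff, norm_smul, norm_inv, Real.norm_eq_abs, abs_of_pos hp,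
      inv_mul_eq_div]
    change _ ≤ (1 : ℝ)
    rw [div_le_one hp]
    linarith
  -- The cutoff equals 1 for |x| ≤ n, and beyond n ≥ R the function a is already small, so the
  -- truncated multiplier is uniformly close to a.
  have ht : IsTest fun x => cutoff n x * a x :=
    ⟨(contDiff_cutoff n).mul ha, (hasCompactSupport_cutoff n).mul_right⟩
  have hN' : ∀ x, ‖cutoff n x * a x‖ ≤ N := fun x => by
    rw [norm_mul]
    calc _ ≤ 1 * N := mul_le_mul (hc1 x) (hN x) (norm_nonneg _) zero_le_one
      _ = N := one_mul N
  refine ⟨_, isCompactOperator_test hb ht hN' j, ?_⟩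
  refine ContinuousLinearMap.opNorm_le_bound _ hδ.le fun w => ?_
  set v := extS b (piS b j) w with hv
  have h1 : ‖mulL ha.continuous hN v - mulL ht.smooth.continuous hN' v‖ ≤ δ / (M + 1) * ‖v‖ := by
    refine Lp.norm_le_mul_norm_of_ae_le_mul ?_
    filter_upwards [coeFn_mulL ha.continuous hN v, coeFn_mulL ht.smooth.continuous hN' v,
      Lp.coeFn_sub (mulL ha.continuous hN v) (mulL ht.smooth.continuous hN' v)] with x h1 h2 h3
    rw [h3, Pi.sub_apply, h1, h2, ← sub_mul, norm_mul]
    refine mul_le_mul_of_nonneg_right ?_ (norm_nonneg _)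
    by_cases hx : ‖x‖ ≤ n
    · rw [hone x hx, one_mul, sub_self, norm_zero]; exact hη.le
    · have h4 := hR x (lt_of_le_of_lt hn (not_le.1 hx))
      have h5 : a x - cutoff n x * a x = ((1 - bump ((n + 1 : ℝ)⁻¹ • x) : ℝ) : ℂ) * a x := by
        rw [cutoff]; push_cast; ring
      rw [h5, norm_mul, Complex.norm_real, Real.norm_eq_abs,
        abs_of_nonneg (sub_nonneg.2 bump.le_one)]
      have h6 : 1 - bump ((n + 1 : ℝ)⁻¹ • x) ≤ 1 := sub_le_self _ bump.nonneg
      calc _ ≤ 1 * ‖a x‖ := mul_le_mul_of_nonneg_right h6 (norm_nonneg _)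
        _ ≤ _ := by rw [one_mul]; exact h4.le
  have h2 : ‖v‖ ≤ M * ‖w‖ := (extS b (piS b j)).le_opNorm w
  change ‖mulL ha.continuous hN v - mulL ht.smooth.continuous hN' v‖ ≤ δ * ‖w‖
  calc _ ≤ δ / (M + 1) * ‖v‖ := h1
    _ ≤ δ / (M + 1) * ((M + 1) * ‖w‖) := by
      refine mul_le_mul_of_nonneg_left (h2.trans ?_) hη.le
      exact mul_le_mul_of_nonneg_right (by linarith) (norm_nonneg _)
    _ = δ * ‖w‖ := by field_simp

/-- Compactness of `H₀⁻¹ W H₀⁻¹`. -/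
theorem IsCoeff.isCompactOperator_res0_pertS {n : Fin 2 → Fin 2 → Plane → ℂ} {N : ℝ}
    (hn : IsCoeff n N) (hb : 0 < b) (hlim : ∀ j k, Tendsto (n j k) (cocompact Plane) (𝓝 0)) :
    IsCompactOperator (res0 b ∘L pertS b n) := by
  -- H₀⁻¹ W H₀⁻¹ = ∑ (Π_j H₀⁻¹)* n_{jk} Π_k H₀⁻¹: a bounded factor times a compact one in each term.
  have e : res0 b ∘L pertS b n = ∑ j, ∑ k, ContinuousLinearMap.adjoint (extS b (piS b j)) ∘L
      (mulL (hn.temperate j k).1.continuous (hn.bound j k) ∘L extS b (piS b k)) := by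
    ext1 g
    refine ext_inner_left ℂ fun f => ?_
    rw [ContinuousLinearMap.comp_apply, ← inner_res0 hb, hn.inner_res0_pertS hb,
      sum_apply, inner_sum]
    refine Finset.sum_congr rfl fun j _ => ?_
    rw [sum_apply, inner_sum]
    refine Finset.sum_congr rfl fun k _ => ?_
    rw [ContinuousLinearMap.comp_apply, ContinuousLinearMap.adjoint_inner_right]
    rfl
  have hc : ∀ j k, IsCompactOperator (ContinuousLinearMap.adjoint (extS b (piS b j)) ∘L
      (mulL (hn.temperate j k).1.continuous (hn.bound j k) ∘L extS b (piS b k))) := fun j k =>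
    (isCompactOperator_mulL_extS hb (hn.temperate j k).1 (hn.bound j k) (hlim j k) k).clm_comp
      (ContinuousLinearMap.adjoint (extS b (piS b j)))
  rw [e]
  simp only [Fin.sum_univ_two]
  exact ((hc 0 0).add (hc 0 1)).add ((hc 1 0).add (hc 1 1))

end Landau

end

noncomputable section

namespace Landau

open Function (HasTemperateGrowth)

/-! ### The Toeplitz operators -/

variable {b : ℝ} {m : Plane → Matrix (Fin 2) (Fin 2) ℂ} {N : ℝ}

/-- Puts P_q x in the form H₀⁻¹ f on which `mem_graph_W` describes W. -/
lemma P_eq_res0 (hb : 0 < b) (q : ℕ) (x : L2) :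
    P b q x = res0 b ((level b q : ℂ) • P b q x) := by
  have hl : (level b q : ℂ) ≠ 0 := Complex.ofReal_ne_zero.2 (level_pos hb _).ne'
  rw [map_smul, (isSpecProj_P hb q).map, smul_smul, Complex.ofReal_inv, mul_inv_cancel₀ hl,
    one_smul]

lemma mem_graph_W_P (hb : 0 < b) (hm : IsCoeff (fun j k x => m x j k) N) (q : ℕ) {x w : L2} :
    (x, w) ∈ (opComp (W b m) (ofBounded (P b q))).graph ↔
      w = (level b q : ℂ) • pertS b (fun j k x => m x j k) (P b q x) := by
  rw [mem_graph_opComp]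
  simp only [mem_graph_ofBounded, exists_eq_left]
  nth_rewrite 1 [P_eq_res0 hb]
  rw [mem_graph_W hb hm, map_smul]

lemma PWP_eq (hb : 0 < b) (hm : IsCoeff (fun j k x => m x j k) N) (q : ℕ) :
    PWP b m q = ofBounded ((level b q : ℂ) •
      (P b q ∘L pertS b (fun j k x => m x j k) ∘L P b q)) := by
  refine LinearPMap.eq_of_eq_graph ?_
  ext ⟨x, z⟩
  rw [PWP, mem_graph_opComp]
  simp only [mem_graph_W_P hb hm, mem_graph_ofBounded, exists_eq_left, map_smul]
  rfl

lemma PWinvWP_eq (hb : 0 < b) (hm : IsCoeff (fun j k x => m x j k) N) (q : ℕ) {s : ℝ}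
    {H : L2 →ₗ.[ℂ] L2} (hH : IsInverse H (resP b (fun j k x => m x j k) s)) :
    PWinvWP b m q H = ofBounded ((level b q : ℂ) •
      (P b q ∘L pertS b (fun j k x => m x j k) ∘L invB b (fun j k x => m x j k) s ∘L
        pertS b (fun j k x => m x j k) ∘L P b q)) := by
  refine LinearPMap.eq_of_eq_graph ?_
  ext ⟨x, z⟩
  rw [PWinvWP, mem_graph_opComp, hH.inverse_eq]
  have key : ∀ y : L2, (x, y) ∈ (opComp (W b m) (opComp (ofBounded
      (resP b (fun j k x => m x j k) s)) (opComp (W b m) (ofBounded (P b q))))).graph ↔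
      y = (level b q : ℂ) • pertS b (fun j k x => m x j k) (invB b (fun j k x => m x j k) s
        (pertS b (fun j k x => m x j k) (P b q x))) := by
    intro y
    rw [mem_graph_opComp]
    simp only [mem_graph_opComp (f := opComp (W b m) (ofBounded (P b q))), mem_graph_W_P hb hm,
      mem_graph_ofBounded, exists_eq_left]
    rw [resP, ContinuousLinearMap.comp_apply, mem_graph_W hb hm, map_smul, map_smul]
  simp only [key, mem_graph_ofBounded, exists_eq_left, map_smul]
  rfl

lemma ofBounded_add (S T : L2 →L[ℂ] L2) : ofBounded S + ofBounded T = ofBounded (S + T) := by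
  refine LinearPMap.eq_of_eq_graph ?_
  ext ⟨x, z⟩
  simp only [mem_graph_add, mem_graph_ofBounded]
  constructor
  · rintro ⟨_, _, rfl, rfl, rfl⟩; rfl
  · rintro rfl; exact ⟨_, _, rfl, rfl, rfl⟩

lemma ofBounded_sub (S T : L2 →L[ℂ] L2) : ofBounded S - ofBounded T = ofBounded (S - T) := by
  refine LinearPMap.eq_of_eq_graph ?_
  ext ⟨x, z⟩
  simp only [mem_graph_sub, mem_graph_ofBounded]
  constructor
  · rintro ⟨_, _, rfl, rfl, rfl⟩; rfl
  · rintro rfl; exact ⟨_, _, rfl, rfl, rfl⟩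

/-- The bounded operator realizing the Toeplitz operators. -/
def toepS (b : ℝ) (n : Fin 2 → Fin 2 → Plane → ℂ) (q : ℕ) (s : ℝ) : L2 →L[ℂ] L2 :=
  ((level b q ^ 2 : ℝ) : ℂ) • (P b q ∘L toepT b n s ∘L P b q)

/-- Write K = W H₀⁻¹ and P_q x = f + sK f. On the left H₀⁻¹ becomes Λ_q⁻¹ against P_q; on the right
K f = K P_q x - sK(K f), and K f = (1 + sK)⁻¹ K P_q x because K commutes with (1 + sK)⁻¹. -/
lemma toepS_apply (hb : 0 < b) {n : Fin 2 → Fin 2 → Plane → ℂ} (q : ℕ) {s : ℝ}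
    (hu : IsUnit (1 + (s : ℂ) • pertS b n)) (x : L2) :
    toepS b n q s x = (level b q : ℂ) • (P b q (pertS b n (P b q x)) -
      (s : ℂ) • P b q (pertS b n (invB b n s (pertS b n (P b q x))))) := by
  obtain ⟨f, hf⟩ := exists_eq_add hu (P b q x)
  have hl : (level b q : ℂ) ≠ 0 := Complex.ofReal_ne_zero.2 (level_pos hb _).ne'
  have hcomm : invB b n s (pertS b n (f + (s : ℂ) • pertS b n f)) = pertS b n f := by
    rw [map_add, map_smul, invB_apply_add hu]
  change ((level b q ^ 2 : ℝ) : ℂ) • P b q (toepT b n s (P b q x)) = _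
  rw [hf, toepT_apply_add hu, P_res0 hb, hcomm, smul_smul, map_add, map_add, map_smul, map_smul,
    add_sub_cancel_right]
  congr 1
  push_cast
  field_simp

theorem toeplitzPlus_eq (hb : 0 < b) (hm : IsCoeff (fun j k x => m x j k) N) (q : ℕ)
    (hu : IsUnit (1 + ((1 : ℝ) : ℂ) • pertS b (fun j k x => m x j k))) :
    toeplitzPlus b m q = ofBounded (toepS b (fun j k x => m x j k) q 1) := by
  rw [toeplitzPlus, PWP_eq hb hm, PWinvWP_eq hb hm q (isInverse_Hplus hb hm hu), ofBounded_sub]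
  congr 1
  ext1 x
  rw [toepS_apply hb q hu, Complex.ofReal_one, one_smul, smul_sub]
  rfl

theorem toeplitzMinus_eq (hb : 0 < b) (hm : IsCoeff (fun j k x => m x j k) N) (q : ℕ)
    (hu : IsUnit (1 + ((-1 : ℝ) : ℂ) • pertS b (fun j k x => m x j k))) :
    toeplitzMinus b m q = ofBounded (toepS b (fun j k x => m x j k) q (-1)) := by
  rw [toeplitzMinus, PWP_eq hb hm, PWinvWP_eq hb hm q (isInverse_Hminus hb hm hu), ofBounded_add]
  congr 1
  ext1 x
  rw [toepS_apply hb q hu, Complex.ofReal_neg, Complex.ofReal_one, neg_one_smul, sub_neg_eq_add,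
    smul_add]
  rfl

lemma IsHermCoeff.isCompactSelfAdjoint_toepS {n : Fin 2 → Fin 2 → Plane → ℂ}
    (hn : IsHermCoeff n N) (hb : 0 < b) (hlim : ∀ j k, Tendsto (n j k) (cocompact Plane) (𝓝 0))
    (q : ℕ) {s : ℝ} (hu : IsUnit (1 + (s : ℂ) • pertS b n)) :
    IsCompactSelfAdjoint (ofBounded (toepS b n q s)) := by
  refine ⟨_, rfl, ?_, ?_⟩
  · rw [ContinuousLinearMap.isSelfAdjoint_iff_isSymmetric]
    intro x y
    change inner ℂ (((level b q ^ 2 : ℝ) : ℂ) • P b q (toepT b n s (P b q x))) y =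
      inner ℂ x (((level b q ^ 2 : ℝ) : ℂ) • P b q (toepT b n s (P b q y)))
    rw [inner_smul_left, inner_smul_right, Complex.conj_ofReal, (isSpecProj_P hb q).symm,
      hn.inner_toepT_symm hb hu, (isSpecProj_P hb q).symm]
  · have h1 := hn.isCompactOperator_res0_pertS hb hlim
    have h2 : IsCompactOperator (toepT b n s) := h1.comp_clm (invB b n s)
    exact ((h2.comp_clm (P b q)).clm_comp (P b q)).smul ((level b q ^ 2 : ℝ) : ℂ)

/-! ### Counting functions in terms of bounded operators -/

/-- Both counts are ranks of spans of eigenvectors, so it suffices to match the eigenvectors. Only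
nonzero vectors are asked for, which allows arguments about the sign of μ. -/
lemma eigenCount_eq_of {H : L2 →ₗ.[ℂ] L2} {B : L2 →L[ℂ] L2} {I J : Set ℝ}
    (h1 : ∀ μ ∈ I, ∀ u, u ≠ 0 → u ∈ eigenspace H (μ : ℂ) → ∃ ν ∈ J, B u = (ν : ℂ) • u)
    (h2 : ∀ ν ∈ J, ∀ u, u ≠ 0 → B u = (ν : ℂ) • u → ∃ μ ∈ I, u ∈ eigenspace H (μ : ℂ)) :
    eigenCount H I = specCount B J := by
  have : (⨆ μ ∈ I, eigenspace H (μ : ℂ)) = specSpan B J := by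
    refine le_antisymm (iSup₂_le fun μ hμ u hu => ?_) (specSpan_le fun ν hν u hu => ?_)
    · rcases eq_or_ne u 0 with rfl | hu0
      · exact zero_mem _
      obtain ⟨ν, hν, h⟩ := h1 μ hμ u hu0 hu
      exact mem_specSpan hν h
    · rcases eq_or_ne u 0 with rfl | hu0
      · exact zero_mem _
      obtain ⟨μ, hμ, h⟩ := h2 ν hν u hu0 hu
      exact Submodule.mem_iSup_of_mem μ (Submodule.mem_iSup_of_mem hμ h)
  rw [eigenCount, specCount, this]

lemma nPlus_toepS (hb : 0 < b) (n : Fin 2 → Fin 2 → Plane → ℂ) (q : ℕ) (s t : ℝ) :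
    nPlus t (ofBounded (toepS b n q s)) =
      specCount (P b q ∘L toepT b n s ∘L P b q) (Ioi (t / level b q ^ 2)) := by
  have hl := level_pos hb q
  have hl2 : ((level b q ^ 2 : ℝ) : ℂ) ≠ 0 := Complex.ofReal_ne_zero.2 (by positivity)
  refine eigenCount_eq_of (fun μ hμ u _ hu => ?_) fun ν hν u _ hu => ?_
  · rw [mem_eigenspace_iff, mem_graph_ofBounded] at hu
    have hμ' : t < μ := hμ
    refine ⟨μ / level b q ^ 2, (div_lt_div_iff_of_pos_right (by positivity)).2 hμ', ?_⟩
    have hu' : (μ : ℂ) • u = ((level b q ^ 2 : ℝ) : ℂ) • (P b q ∘L toepT b n s ∘L P b q) u := hu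
    rw [Complex.ofReal_div, div_eq_inv_mul, mul_smul, hu', inv_smul_smul₀ hl2]
  · refine ⟨ν * level b q ^ 2, ?_, ?_⟩
    · have h1 : t / level b q ^ 2 < ν := hν
      rwa [div_lt_iff₀ (by positivity)] at h1
    · rw [mem_eigenspace_iff, mem_graph_ofBounded]
      change _ = ((level b q ^ 2 : ℝ) : ℂ) • (P b q ∘L toepT b n s ∘L P b q) u
      rw [hu, smul_smul, Complex.ofReal_mul, mul_comm]

end Landau

end

noncomputable section

namespace Landau

open Function (HasTemperateGrowth)

/-! ### Admissible coefficients -/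

variable {b : ℝ} {m : Plane → Matrix (Fin 2) (Fin 2) ℂ}

lemma matrix_form_eq (M : Matrix (Fin 2) (Fin 2) ℂ) (z : Fin 2 → ℂ) :
    ∑ j, ∑ k, conj (z j) * (M j k * z k) = star z ⬝ᵥ (M.mulVec z) := by
  simp [dotProduct, Matrix.mulVec]
  ring

lemma Admissible.exists_isHermCoeff (hm : Admissible m) :
    ∃ N, IsHermCoeff (fun j k x => m x j k) N := by
  choose C hC using hm.bounded
  have hle : ∀ j k i, i < 2 → |C j k i| ≤ ∑ j, ∑ k, ∑ i ∈ Finset.range 2, |C j k i| := by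
    intro j k i hi
    refine le_trans ?_ (Finset.single_le_sum
      (f := fun j => ∑ k, ∑ i ∈ Finset.range 2, |C j k i|)
      (fun j _ => Finset.sum_nonneg fun k _ => Finset.sum_nonneg fun i _ => abs_nonneg _)
      (Finset.mem_univ j))
    refine le_trans ?_ (Finset.single_le_sum (f := fun k => ∑ i ∈ Finset.range 2, |C j k i|)
      (fun k _ => Finset.sum_nonneg fun i _ => abs_nonneg _) (Finset.mem_univ k))
    exact Finset.single_le_sum (f := fun i => |C j k i|) (fun i _ => abs_nonneg _)
      (Finset.mem_range.2 hi)
  refine ⟨∑ j, ∑ k, ∑ i ∈ Finset.range 2, |C j k i|, ⟨⟨fun j k => ⟨hm.smooth j k, fun i =>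
    ⟨0, C j k i, fun x => by simpa using hC j k i x⟩⟩, fun j k x => ?_, fun l j k x => ?_⟩,
    fun j k x => ?_, fun x z => ?_⟩⟩
  · have h := hC j k 0 x
    rw [norm_iteratedFDeriv_zero] at h
    exact (h.trans (le_abs_self _)).trans (hle j k 0 two_pos)
  · have h := hC j k 1 x
    rw [norm_iteratedFDeriv_one] at h
    have h2 := (fderiv ℝ (fun x => m x j k) x).le_opNorm (dir l)
    have h3 : ‖dir l‖ = 1 := by simp
    rw [h3, mul_one] at h2
    exact ((h2.trans h).trans (le_abs_self _)).trans (hle j k 1 one_lt_two)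
  · exact (hm.posSemidef x).isHermitian.apply k j
  · rw [matrix_form_eq (m x) z]
    exact (Complex.le_def.1 ((hm.posSemidef x).dotProduct_mulVec_nonneg z)).1

lemma re_form_le {M : Matrix (Fin 2) (Fin 2) ℂ} {δ : ℝ}
    (h : ‖Matrix.toEuclideanCLM (n := Fin 2) (𝕜 := ℂ) M‖ ≤ δ) (z : Fin 2 → ℂ) :
    (∑ j, ∑ k, conj (z j) * (M j k * z k)).re ≤ δ * ∑ j, ‖z j‖ ^ 2 := by
  set v : EuclideanSpace ℂ (Fin 2) := WithLp.toLp 2 z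
  have e : ∑ j, ∑ k, conj (z j) * (M j k * z k) =
      inner ℂ v (Matrix.toEuclideanCLM (n := Fin 2) (𝕜 := ℂ) M v) := by
    rw [matrix_form_eq, Matrix.toEuclideanCLM_toLp, PiLp.inner_apply]
    simp [dotProduct, mul_comm, v]
  have hv : ‖v‖ ^ 2 = ∑ j, ‖z j‖ ^ 2 := EuclideanSpace.norm_sq_eq v
  rw [e, ← hv]
  refine (re_inner_le_norm (𝕜 := ℂ) v _).trans ?_
  have h2 := (Matrix.toEuclideanCLM (n := Fin 2) (𝕜 := ℂ) M).le_of_opNorm_le h v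
  calc ‖v‖ * _ ≤ ‖v‖ * (δ * ‖v‖) := mul_le_mul_of_nonneg_left h2 (norm_nonneg _)
    _ = _ := by ring

lemma IsHermCoeff.isUnit_plus {n : Fin 2 → Fin 2 → Plane → ℂ} {N : ℝ} (hn : IsHermCoeff n N)
    (hb : 0 < b) : IsUnit (1 + ((1 : ℝ) : ℂ) • pertS b n) := by
  refine hn.toIsCoeff.isUnit_one_add hb (c := 1) (by simp) one_pos fun t ht x z => ?_
  have := mul_nonneg ht.1 (hn.nonneg x z)
  linarith

/-- The ellipticity constant of 1 - tm is at least 1 - δ, uniformly in t; this is where the strict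
bound on sup |m| is needed. -/
lemma IsHermCoeff.isUnit_minus {n : Fin 2 → Fin 2 → Plane → ℂ} {N δ : ℝ} (hn : IsHermCoeff n N)
    (hb : 0 < b) (hδ : δ < 1) (h : ∀ x (z : Fin 2 → ℂ),
      (∑ j, ∑ k, conj (z j) * (n j k x * z k)).re ≤ δ * ∑ j, ‖z j‖ ^ 2) :
    IsUnit (1 + ((-1 : ℝ) : ℂ) • pertS b n) := by
  refine hn.toIsCoeff.isUnit_one_add hb (c := 1 - δ) (by simp) (by linarith) fun t ht x z => ?_
  have h1 := mul_le_mul_of_nonneg_right ht.2 (hn.nonneg x z)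
  have h2 := h x z
  linarith

/-! ### Spectral gaps -/

lemma IsSpecProj.neg {A P : L2 →L[ℂ] L2} {α : ℝ} (h : IsSpecProj A P α) :
    IsSpecProj (-A) P (-α) where
  symm := h.symm
  map u := by rw [neg_apply, h.map, Complex.ofReal_neg, neg_smul]
  fix u hu := h.fix u (by
    rw [neg_apply, Complex.ofReal_neg, neg_smul, neg_inj] at hu
    exact hu)

lemma inv_level_strictAnti (hb : 0 < b) : StrictAnti fun q => (level b q)⁻¹ := fun p q h =>
  (inv_lt_inv₀ (level_pos hb q) (level_pos hb p)).2 (level_strictMono hb h)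

/-- Below q both factors are positive and at least Λ_{q-1}⁻¹ - Λ_q⁻¹; above q + 1 both are negative
and at least Λ_{q+1}⁻¹ - Λ_{q+2}⁻¹ in modulus. -/
lemma exists_level_gap (hb : 0 < b) (q : ℕ) : ∃ γ > 0, ∀ p, p ≠ q → p ≠ q + 1 →
    γ ≤ ((level b p)⁻¹ - (level b (q + 1))⁻¹) * ((level b p)⁻¹ - (level b q)⁻¹) := by
  set a : ℕ → ℝ := fun q => (level b q)⁻¹ with ha
  have hanti : StrictAnti a := inv_level_strictAnti hb
  have h1 : 0 < a (q + 1) - a (q + 2) := sub_pos.2 (hanti (by omega))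
  -- For q = 0 no level lies below q and the value 1 is arbitrary.
  set d : ℝ := if q = 0 then 1 else a (q - 1) - a q with hd
  have h2 : 0 < d := by
    rw [hd]
    split_ifs with h
    · exact one_pos
    · exact sub_pos.2 (hanti (by omega))
  refine ⟨min ((a (q + 1) - a (q + 2)) ^ 2) (d ^ 2), by positivity, fun p hp hp' => ?_⟩
  change _ ≤ (a p - a (q + 1)) * (a p - a q)
  have h3 : a (q + 1) < a q := hanti (by omega)
  rcases lt_or_ge p q with hpq | hpq
  · refine (min_le_right _ _).trans ?_
    have hd' : d = a (q - 1) - a q := by rw [hd, if_neg (by omega)]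
    have h4 : a (q - 1) ≤ a p := hanti.antitone (by omega)
    have h5 : d ≤ a p - a q := by linarith
    have h6 : d ≤ a p - a (q + 1) := by linarith
    rw [sq]
    exact mul_le_mul h6 h5 h2.le (by linarith)
  · refine (min_le_left _ _).trans ?_
    have h4 : a p ≤ a (q + 2) := hanti.antitone (by omega)
    have h5 : a (q + 1) - a (q + 2) ≤ a (q + 1) - a p := by linarith
    have h6 : a (q + 1) - a (q + 2) ≤ a q - a p := by linarith
    have h7 := mul_le_mul h5 h6 h1.le (by linarith)
    calc _ = (a (q + 1) - a (q + 2)) * (a (q + 1) - a (q + 2)) := sq _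
      _ ≤ _ := h7
      _ = _ := by ring

lemma exists_gap (hb : 0 < b) (q : ℕ) : ∃ γ > 0, ∀ w : L2, P b q w = 0 → P b (q + 1) w = 0 →
    γ * ‖w‖ ^ 2 ≤ (inner ℂ (res0 b w - (((level b (q + 1))⁻¹ : ℝ) : ℂ) • w)
      (res0 b w - (((level b q)⁻¹ : ℝ) : ℂ) • w)).re := by
  obtain ⟨γ, hγ, h⟩ := exists_level_gap hb q
  refine ⟨γ, hγ, fun w h1 h2 => form_ge hb fun i => ?_⟩
  obtain ⟨k, p⟩ := i
  by_cases hp : p = q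
  · left; rw [hp]; exact inner_stN_of_P_eq_zero hb h1
  by_cases hp' : p = q + 1
  · left; rw [hp']; exact inner_stN_of_P_eq_zero hb h2
  exact Or.inr (h p hp hp')

lemma exists_gap_bottom (hb : 0 < b) {B : ℝ} (hB : (level b 0)⁻¹ < B) :
    ∃ γ > 0, ∀ w : L2, P b 0 w = 0 →
    γ * ‖w‖ ^ 2 ≤ (inner ℂ (res0 b w - (B : ℂ) • w)
      (res0 b w - (((level b 0)⁻¹ : ℝ) : ℂ) • w)).re := by
  have h1 : (level b 1)⁻¹ < (level b 0)⁻¹ := inv_level_strictAnti hb one_pos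
  refine ⟨(B - (level b 0)⁻¹) * ((level b 0)⁻¹ - (level b 1)⁻¹),
    mul_pos (by linarith) (by linarith), fun w hw => form_ge hb fun i => ?_⟩
  obtain ⟨k, p⟩ := i
  by_cases hp : p = 0
  · left; rw [hp]; exact inner_stN_of_P_eq_zero hb hw
  right
  have h2 : (level b p)⁻¹ ≤ (level b 1)⁻¹ := (inv_level_strictAnti hb).antitone (by omega)
  have h3 := mul_le_mul (a := B - (level b 0)⁻¹) (b := B - (level b p)⁻¹)
    (c := (level b 0)⁻¹ - (level b 1)⁻¹) (d := (level b 0)⁻¹ - (level b p)⁻¹)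
    (by linarith) (by linarith) (by linarith) (by linarith)
  exact h3.trans (le_of_eq (by ring))

lemma re_inner_res0_le (hb : 0 < b) (w : L2) :
    (inner ℂ (res0 b w) w).re ≤ (level b 0)⁻¹ * ‖w‖ ^ 2 := by
  refine hasSum_le (fun i => ?_) (hasSum_inner_res0 hb w) ((hasSum_norm_sq hb w).mul_left _)
  exact mul_le_mul_of_nonneg_right ((inv_level_strictAnti hb).antitone (Nat.zero_le _))
    (sq_nonneg _)

/-! ### Transfer of the abstract counting estimates -/

/-- The abstract bounds are used with ε/2. The shift σ(t) agrees with t/L² only to first order, and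
the other half of ε absorbs the difference. -/
theorem GapData.asymptotics {A T P Q : L2 →L[ℂ] L2} {α β γ : ℝ} (h : GapData A T P Q α β γ)
    {ε L r : ℝ} (hε : ε ∈ Ioo (0 : ℝ) 1) (hL : 0 < L) (hr : 0 < r) {ν n : ℝ → ℕ∞} {σ : ℝ → ℝ}
    (hν : ∀ t ∈ Ioo 0 r, ν t = specCount (A - T) (Ioo β (α - σ t)))
    (hσ : ∀ t ∈ Ioo 0 r, 0 < σ t ∧ σ t ≤ 2 * t / L ^ 2 ∧
      (1 - ε) * t / L ^ 2 ≤ (1 - ε / 2) * σ t ∧ (1 + ε / 2) * σ t ≤ (1 + ε) * t / L ^ 2)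
    (hn : ∀ t, n t = specCount (P ∘L T ∘L P) (Ioi (t / L ^ 2))) :
    ∃ C : ℕ, ∃ t₀ : ℝ, 0 < t₀ ∧ ∀ t ∈ Ioo 0 t₀,
      n ((1 + ε) * t) ≤ ν t + C ∧ ν t ≤ n ((1 - ε) * t) + C := by
  obtain ⟨C₁, s₁, hs₁, h1⟩ := h.specCount_le_upper (ε := ε / 2) (by linarith [hε.1])
    (by linarith [hε.2])
  obtain ⟨C₂, s₂, hs₂, h2⟩ := h.specCount_le_lower (ε := ε / 2) (by linarith [hε.1])
    (by linarith [hε.2])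
  -- Since σ(t) ≤ 2t/L², this bound on t puts σ(t) below both s₁ and s₂.
  refine ⟨max C₁ C₂, min r (min s₁ s₂ * L ^ 2 / 2), by positivity, fun t ht => ?_⟩
  have htr : t ∈ Ioo 0 r := ⟨ht.1, ht.2.trans_le (min_le_left _ _)⟩
  obtain ⟨g1, g2, g3, g4⟩ := hσ t htr
  have hts : σ t < min s₁ s₂ := by
    have h3 := ht.2.trans_le (min_le_right _ _)
    refine g2.trans_lt ?_
    rw [div_lt_iff₀ (by positivity)]
    linarith
  have hC₁ : (C₁ : ℕ∞) ≤ ((max C₁ C₂ : ℕ) : ℕ∞) := by exact_mod_cast le_max_left _ _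
  have hC₂ : (C₂ : ℕ∞) ≤ ((max C₁ C₂ : ℕ) : ℕ∞) := by exact_mod_cast le_max_right _ _
  rw [hν t htr, hn, hn]
  constructor
  · refine (specCount_mono _ (Ioi_subset_Ioi g4)).trans ?_
    exact (h2 _ ⟨g1, hts.trans_le (min_le_right _ _)⟩).trans (by gcongr)
  · refine (h1 _ ⟨g1, hts.trans_le (min_le_left _ _)⟩).trans ?_
    exact add_le_add (specCount_mono _ (Ioi_subset_Ioi g3)) hC₁

end Landau

end

noncomputable section

namespace Landau

open Function (HasTemperateGrowth)

/-! ### The counting functions of `H_±` -/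

variable {b : ℝ} {m : Plane → Matrix (Fin 2) (Fin 2) ℂ} {N : ℝ}

lemma toepT_add_resP {n : Fin 2 → Fin 2 → Plane → ℂ}
    (hu : IsUnit (1 + ((1 : ℝ) : ℂ) • pertS b n)) : res0 b - toepT b n 1 = resP b n 1 := by
  ext1 g
  have h := res0_sub_resP hu g
  rw [Complex.ofReal_one, one_smul] at h
  rw [sub_apply, ← h, sub_sub_cancel]

lemma neg_res0_sub_toepT {n : Fin 2 → Fin 2 → Plane → ℂ}
    (hu : IsUnit (1 + ((-1 : ℝ) : ℂ) • pertS b n)) :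
    -res0 b - toepT b n (-1) = -resP b n (-1) := by
  ext1 g
  have h := res0_sub_resP hu g
  rw [Complex.ofReal_neg, Complex.ofReal_one, neg_one_smul] at h
  rw [sub_apply, neg_apply, neg_apply, ← neg_neg (toepT b n (-1) g), ← h]
  abel

lemma IsInverse.eq_inv_smul {H : L2 →ₗ.[ℂ] L2} {R : L2 →L[ℂ] L2} (h : IsInverse H R) {μ : ℝ}
    (hμ : μ ≠ 0) {u : L2} : u ∈ eigenspace H (μ : ℂ) ↔ R u = ((μ⁻¹ : ℝ) : ℂ) • u := by
  rw [h.mem_eigenspace, Complex.ofReal_inv, eq_inv_smul_iff₀ (Complex.ofReal_ne_zero.2 hμ), eq_comm]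

/-- Inversion reverses order: (Λ_q + t, Λ_{q+1}) becomes (Λ_{q+1}⁻¹, (Λ_q + t)⁻¹). -/
lemma Nplus_eq (hb : 0 < b) (hm : IsCoeff (fun j k x => m x j k) N)
    (hu : IsUnit (1 + ((1 : ℝ) : ℂ) • pertS b (fun j k x => m x j k))) (q : ℕ) {t : ℝ}
    (ht : 0 < t) :
    Nplus b m q t = specCount (res0 b - toepT b (fun j k x => m x j k) 1)
      (Ioo (level b (q + 1))⁻¹ ((level b q)⁻¹ - ((level b q)⁻¹ - (level b q + t)⁻¹))) := by
  have hl := level_pos hb q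
  have hl' := level_pos hb (q + 1)
  have hI := isInverse_Hplus hb hm hu
  rw [toepT_add_resP hu, sub_sub_cancel]
  refine eigenCount_eq_of (fun μ hμ u _ h => ?_) fun ν hν u _ h => ?_
  · obtain ⟨⟨h1, h2⟩, h3⟩ := hμ
    have hμ0 : 0 < μ := hl.trans h1
    refine ⟨μ⁻¹, ⟨(inv_lt_inv₀ hl' hμ0).2 h2, (inv_lt_inv₀ hμ0 (by linarith)).2 (by linarith)⟩, ?_⟩
    exact (hI.eq_inv_smul hμ0.ne').1 h
  · have hν0 : 0 < ν := (inv_pos.2 hl').trans hν.1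
    have h3 : level b q + t < ν⁻¹ := (lt_inv_comm₀ (by linarith) hν0).2 hν.2
    refine ⟨ν⁻¹, ⟨⟨by linarith, inv_lt_of_inv_lt₀ hl' hν.1⟩, by linarith⟩, ?_⟩
    rw [hI.eq_inv_smul (inv_pos.2 hν0).ne', inv_inv]
    exact h

/-- Here μ ↦ -1/μ, which preserves order on μ > 0; t < Λ_{q+1} keeps the upper end Λ_{q+1} - t
positive. -/
lemma Nminus_succ_eq (hb : 0 < b) (hm : IsCoeff (fun j k x => m x j k) N)
    (hu : IsUnit (1 + ((-1 : ℝ) : ℂ) • pertS b (fun j k x => m x j k))) (q : ℕ) {t : ℝ}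
    (ht0 : 0 < t) (ht : t < level b (q + 1)) :
    Nminus b m (q + 1) t = specCount (-res0 b - toepT b (fun j k x => m x j k) (-1))
      (Ioo (-(level b q)⁻¹)
        (-(level b (q + 1))⁻¹ - ((level b (q + 1) - t)⁻¹ - (level b (q + 1))⁻¹))) := by
  have hl := level_pos hb q
  have hI := isInverse_Hminus hb hm hu
  have hlt : 0 < level b (q + 1) - t := by linarith
  have e : -(level b (q + 1))⁻¹ - ((level b (q + 1) - t)⁻¹ - (level b (q + 1))⁻¹) =
      -(level b (q + 1) - t)⁻¹ := by ring
  rw [neg_res0_sub_toepT hu, e]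
  refine eigenCount_eq_of (fun μ hμ u _ h => ?_) fun ν hν u _ h => ?_
  · obtain ⟨⟨h1, h2⟩, h3⟩ := hμ
    have hμ0 : 0 < μ := hl.trans h1
    refine ⟨-μ⁻¹, ⟨neg_lt_neg ((inv_lt_inv₀ hμ0 hl).2 h1),
      neg_lt_neg ((inv_lt_inv₀ hlt hμ0).2 (by linarith))⟩, ?_⟩
    rw [neg_apply, (hI.eq_inv_smul hμ0.ne').1 h, Complex.ofReal_neg, neg_smul]
  · have hν1 : (level b (q + 1) - t)⁻¹ < -ν := by linarith [hν.2]
    have hν2 : -ν < (level b q)⁻¹ := by linarith [hν.1]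
    have hν0 : 0 < -ν := (inv_pos.2 hlt).trans hν1
    have h3 := inv_lt_of_inv_lt₀ hlt hν1
    refine ⟨(-ν)⁻¹, ⟨⟨(lt_inv_comm₀ hl hν0).2 hν2, by linarith⟩, by linarith⟩, ?_⟩
    rw [hI.eq_inv_smul (inv_pos.2 hν0).ne', inv_inv, Complex.ofReal_neg, neg_smul, ← h, neg_apply,
      neg_neg]

/-- The interval below Λ₀ is unbounded, but H₋ has only positive eigenvalues μ, and 1/μ ≤ ‖H₋⁻¹‖ <
B. Hence -B is an artificial lower end that loses nothing. -/
lemma Nminus_zero_eq (hb : 0 < b) (hm : IsHermCoeff (fun j k x => m x j k) N)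
    (h1 : ∀ x (z : Fin 2 → ℂ),
      (∑ j, ∑ k, conj (z j) * (m x j k * z k)).re ≤ ∑ j, ‖z j‖ ^ 2)
    (hu : IsUnit (1 + ((-1 : ℝ) : ℂ) • pertS b (fun j k x => m x j k))) {B : ℝ}
    (hB : ‖resP b (fun j k x => m x j k) (-1)‖ < B) {t : ℝ} (ht0 : 0 < t) (ht : t < level b 0) :
    Nminus b m 0 t = specCount (-res0 b - toepT b (fun j k x => m x j k) (-1))
      (Ioo (-B) (-(level b 0)⁻¹ - ((level b 0 - t)⁻¹ - (level b 0)⁻¹))) := by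
  have hI := isInverse_Hminus hb hm.toIsCoeff hu
  have hlt : 0 < level b 0 - t := by linarith
  have e : -(level b 0)⁻¹ - ((level b 0 - t)⁻¹ - (level b 0)⁻¹) = -(level b 0 - t)⁻¹ := by ring
  rw [neg_res0_sub_toepT hu, e]
  refine eigenCount_eq_of (fun μ hμ u hu0 h => ?_) fun ν hν u _ h => ?_
  · obtain ⟨h2, h3⟩ := hμ
    have hup : 0 < ‖u‖ := norm_pos_iff.2 hu0
    have hμ0 : 0 < μ := by
      by_contra hcon
      have h4 := hI.mem_eigenspace.1 h
      have h5 := hm.re_inner_resP_minus hb h1 hu u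
      have h6 : (inner ℂ u u).re = μ * (inner ℂ (resP b (fun j k x => m x j k) (-1) u) u).re := by
        nth_rewrite 1 [h4]
        rw [inner_smul_left, Complex.conj_ofReal, Complex.re_ofReal_mul]
      rw [re_inner_self] at h6
      have h7 := mul_nonpos_of_nonpos_of_nonneg (not_lt.1 hcon) h5
      have h8 : 0 < ‖u‖ ^ 2 := by positivity
      linarith
    have h4 := (hI.eq_inv_smul hμ0.ne').1 h
    refine ⟨-μ⁻¹, ⟨neg_lt_neg ?_, neg_lt_neg ((inv_lt_inv₀ hlt hμ0).2 (by linarith))⟩, ?_⟩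
    · have h5 := (resP b (fun j k x => m x j k) (-1)).le_opNorm u
      rw [h4, norm_smul, Complex.norm_real, Real.norm_eq_abs, abs_of_pos (inv_pos.2 hμ0)] at h5
      exact (le_of_mul_le_mul_right h5 hup).trans_lt hB
    · rw [neg_apply, h4, Complex.ofReal_neg, neg_smul]
  · have hν1 : (level b 0 - t)⁻¹ < -ν := by linarith [hν.2]
    have hν0 : 0 < -ν := (inv_pos.2 hlt).trans hν1
    have h3 := inv_lt_of_inv_lt₀ hlt hν1
    refine ⟨(-ν)⁻¹, ⟨?_, by linarith⟩, ?_⟩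
    · change (-ν)⁻¹ < level b 0
      linarith
    rw [hI.eq_inv_smul (inv_pos.2 hν0).ne', inv_inv, Complex.ofReal_neg, neg_smul, ← h, neg_apply,
      neg_neg]

/-- The shift is t/L² times L/(L + t), a factor close enough to 1 once t < εL/4. -/
lemma shift_plus {ε L : ℝ} (hε : ε ∈ Ioo (0 : ℝ) 1) (hL : 0 < L) :
    ∀ t ∈ Ioo 0 (ε * L / 4), 0 < L⁻¹ - (L + t)⁻¹ ∧ L⁻¹ - (L + t)⁻¹ ≤ 2 * t / L ^ 2 ∧
      (1 - ε) * t / L ^ 2 ≤ (1 - ε / 2) * (L⁻¹ - (L + t)⁻¹) ∧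
      (1 + ε / 2) * (L⁻¹ - (L + t)⁻¹) ≤ (1 + ε) * t / L ^ 2 := by
  rintro t ⟨ht, htε⟩
  obtain ⟨hε0, hε1⟩ := hε
  have hLt : 0 < L + t := by linarith
  have e : L⁻¹ - (L + t)⁻¹ = t / L ^ 2 * (L / (L + t)) := by field_simp; ring
  have hX : 0 < t / L ^ 2 := by positivity
  have hY1 : L / (L + t) ≤ 1 := (div_le_one hLt).2 (by linarith)
  have hY0 : 0 < L / (L + t) := by positivity
  have hY2 : 1 - ε ≤ (1 - ε / 2) * (L / (L + t)) := by
    rw [mul_div_assoc', le_div_iff₀ hLt]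
    nlinarith
  rw [e]
  refine ⟨by positivity, ?_, ?_, ?_⟩
  · calc _ ≤ t / L ^ 2 * 1 := mul_le_mul_of_nonneg_left hY1 hX.le
      _ ≤ 2 * t / L ^ 2 := by rw [mul_div_assoc]; linarith
  · calc _ = t / L ^ 2 * (1 - ε) := by ring
      _ ≤ t / L ^ 2 * ((1 - ε / 2) * (L / (L + t))) := mul_le_mul_of_nonneg_left hY2 hX.le
      _ = _ := by ring
  · calc _ = (1 + ε / 2) * (t / L ^ 2) * (L / (L + t)) := by ring
      _ ≤ (1 + ε) * (t / L ^ 2) * 1 := by gcongr; linarith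
      _ = _ := by ring

lemma shift_minus {ε L : ℝ} (hε : ε ∈ Ioo (0 : ℝ) 1) (hL : 0 < L) :
    ∀ t ∈ Ioo 0 (ε * L / 4), 0 < (L - t)⁻¹ - L⁻¹ ∧ (L - t)⁻¹ - L⁻¹ ≤ 2 * t / L ^ 2 ∧
      (1 - ε) * t / L ^ 2 ≤ (1 - ε / 2) * ((L - t)⁻¹ - L⁻¹) ∧
      (1 + ε / 2) * ((L - t)⁻¹ - L⁻¹) ≤ (1 + ε) * t / L ^ 2 := by
  rintro t ⟨ht, htε⟩
  obtain ⟨hε0, hε1⟩ := hε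
  have htL : ε * L < L := by nlinarith
  have hLt : 0 < L - t := by linarith
  have e : (L - t)⁻¹ - L⁻¹ = t / L ^ 2 * (L / (L - t)) := by field_simp; ring
  have hX : 0 < t / L ^ 2 := by positivity
  have hY0 : 1 ≤ L / (L - t) := (one_le_div hLt).2 (by linarith)
  have hY1 : L / (L - t) ≤ 2 := by rw [div_le_iff₀ hLt]; linarith
  have hY2 : (1 + ε / 2) * (L / (L - t)) ≤ 1 + ε := by
    rw [mul_div_assoc', div_le_iff₀ hLt]
    nlinarith
  rw [e]
  refine ⟨by positivity, ?_, ?_, ?_⟩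
  · calc _ ≤ t / L ^ 2 * 2 := mul_le_mul_of_nonneg_left hY1 hX.le
      _ = 2 * t / L ^ 2 := by ring
  · calc _ = (1 - ε) * (t / L ^ 2) * 1 := by ring
      _ ≤ (1 - ε / 2) * (t / L ^ 2) * (L / (L - t)) := by
        have h1 : 0 ≤ 1 - ε / 2 := by linarith
        gcongr
        linarith
      _ = _ := by ring
  · calc _ = t / L ^ 2 * ((1 + ε / 2) * (L / (L - t))) := by ring
      _ ≤ t / L ^ 2 * (1 + ε) := mul_le_mul_of_nonneg_left hY2 hX.le
      _ = _ := by ring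

/-! ### Verification of the gap hypotheses for ±H₀⁻¹ -/

lemma IsHermCoeff.gapData_plus {n : Fin 2 → Fin 2 → Plane → ℂ} (hn : IsHermCoeff n N) (hb : 0 < b)
    (hlim : ∀ j k, Tendsto (n j k) (cocompact Plane) (𝓝 0))
    (hu : IsUnit (1 + ((1 : ℝ) : ℂ) • pertS b n)) (q : ℕ) :
    ∃ γ, GapData (res0 b) (toepT b n 1) (P b q) (P b (q + 1)) (level b q)⁻¹
      (level b (q + 1))⁻¹ γ := by
  obtain ⟨γ, hγ, h⟩ := exists_gap hb q
  exact ⟨γ, inner_res0 hb, hn.inner_toepT_symm hb hu, hn.re_inner_toepT_plus hb hu,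
    (hn.isCompactOperator_res0_pertS hb hlim).comp_clm (invB b n 1),
    inv_level_strictAnti hb (Nat.lt_succ_self q), hγ, isSpecProj_P hb q, isSpecProj_P hb (q + 1), h⟩

lemma neg_form (β α : ℝ) (w : L2) :
    inner ℂ ((-res0 b) w - ((-β : ℝ) : ℂ) • w) ((-res0 b) w - ((-α : ℝ) : ℂ) • w) =
      inner ℂ (res0 b w - (β : ℂ) • w) (res0 b w - (α : ℂ) • w) := by
  have e : ∀ t : ℝ, (-res0 b) w - ((-t : ℝ) : ℂ) • w = -(res0 b w - (t : ℂ) • w) := fun t => by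
    rw [neg_apply, Complex.ofReal_neg, neg_smul]; abel
  rw [e, e, inner_neg_neg]

/-- Negation turns the gap around, so P_{q+1} and P_q exchange roles. The gap product is unchanged,
and the inequality of `exists_gap` applies with its factors swapped. -/
lemma IsHermCoeff.gapData_minus_succ {n : Fin 2 → Fin 2 → Plane → ℂ} (hn : IsHermCoeff n N)
    (hb : 0 < b) (hlim : ∀ j k, Tendsto (n j k) (cocompact Plane) (𝓝 0))
    (h1 : ∀ x (z : Fin 2 → ℂ),
      (∑ j, ∑ k, conj (z j) * (n j k x * z k)).re ≤ ∑ j, ‖z j‖ ^ 2)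
    (hu : IsUnit (1 + ((-1 : ℝ) : ℂ) • pertS b n)) (q : ℕ) :
    ∃ γ, GapData (-res0 b) (toepT b n (-1)) (P b (q + 1)) (P b q) (-(level b (q + 1))⁻¹)
      (-(level b q)⁻¹) γ := by
  obtain ⟨γ, hγ, h⟩ := exists_gap hb q
  refine ⟨γ, fun u v => ?_, hn.inner_toepT_symm hb hu, hn.re_inner_toepT_minus hb h1 hu,
    (hn.isCompactOperator_res0_pertS hb hlim).comp_clm (invB b n (-1)),
    neg_lt_neg (inv_level_strictAnti hb (Nat.lt_succ_self q)), hγ, (isSpecProj_P hb (q + 1)).neg,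
    (isSpecProj_P hb q).neg, fun w hw hw' => ?_⟩
  · rw [neg_apply, neg_apply, inner_neg_left, inner_neg_right, inner_res0 hb]
  · rw [neg_form]
    refine (h w hw' hw).trans (le_of_eq ?_)
    exact re_inner_comm _ _

/-- The lower end -B is not an eigenvalue of -H₀⁻¹, because H₀⁻¹ ≤ Λ₀⁻¹ < B; the projection onto its
eigenspace is therefore 0. -/
lemma IsHermCoeff.gapData_minus_zero {n : Fin 2 → Fin 2 → Plane → ℂ} (hn : IsHermCoeff n N)
    (hb : 0 < b) (hlim : ∀ j k, Tendsto (n j k) (cocompact Plane) (𝓝 0))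
    (h1 : ∀ x (z : Fin 2 → ℂ),
      (∑ j, ∑ k, conj (z j) * (n j k x * z k)).re ≤ ∑ j, ‖z j‖ ^ 2)
    (hu : IsUnit (1 + ((-1 : ℝ) : ℂ) • pertS b n)) {B : ℝ} (hB : (level b 0)⁻¹ < B) :
    ∃ γ, GapData (-res0 b) (toepT b n (-1)) (P b 0) 0 (-(level b 0)⁻¹) (-B) γ := by
  obtain ⟨γ, hγ, h⟩ := exists_gap_bottom hb hB
  refine ⟨γ, fun u v => ?_, hn.inner_toepT_symm hb hu, hn.re_inner_toepT_minus hb h1 hu,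
    (hn.isCompactOperator_res0_pertS hb hlim).comp_clm (invB b n (-1)),
    neg_lt_neg hB, hγ, (isSpecProj_P hb 0).neg, ⟨fun u v => by simp, fun u => by simp,
      fun u hu => ?_⟩, fun w hw _ => ?_⟩
  · rw [neg_apply, inner_neg_left, inner_res0 hb, neg_apply, inner_neg_right]
  · have h2 : res0 b u = (B : ℂ) • u := by
      rw [neg_apply, Complex.ofReal_neg, neg_smul, neg_inj] at hu
      exact hu
    have h3 := re_inner_res0_le hb u
    rw [h2, inner_smul_left, Complex.conj_ofReal, Complex.re_ofReal_mul, re_inner_self] at h3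
    by_contra hne
    have hu0 : 0 < ‖u‖ := norm_pos_iff.2 fun h0 => hne (by rw [h0, map_zero])
    have h4 : (level b 0)⁻¹ * ‖u‖ ^ 2 < B * ‖u‖ ^ 2 :=
      mul_lt_mul_of_pos_right hB (by positivity)
    linarith
  · rw [neg_form]
    exact h w hw

end Landau

end

/-! ### Assembly of the theorem -/

theorem proposition3p1 (b : ℝ) (hb : 0 < b)
    (m : Landau.Plane → Matrix (Fin 2) (Fin 2) ℂ) (hm : Landau.Admissible m)
    (q : ℕ) (ε : ℝ) (hε : ε ∈ Set.Ioo (0 : ℝ) 1) :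
    (Landau.IsCompactSelfAdjoint (Landau.toeplitzPlus b m q) ∧
      ∃ C : ℕ, ∃ lam₀ : ℝ, 0 < lam₀ ∧ ∀ lam ∈ Set.Ioo 0 lam₀,
        Landau.nPlus ((1 + ε) * lam) (Landau.toeplitzPlus b m q)
            ≤ Landau.Nplus b m q lam + C ∧
        Landau.Nplus b m q lam
            ≤ Landau.nPlus ((1 - ε) * lam) (Landau.toeplitzPlus b m q) + C) ∧
    ((∃ δ < (1 : ℝ), ∀ x, ‖Matrix.toEuclideanCLM (n := Fin 2) (𝕜 := ℂ) (m x)‖ ≤ δ) →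
      Landau.IsCompactSelfAdjoint (Landau.toeplitzMinus b m q) ∧
      ∃ C : ℕ, ∃ lam₀ : ℝ, 0 < lam₀ ∧ ∀ lam ∈ Set.Ioo 0 lam₀,
        Landau.nPlus ((1 + ε) * lam) (Landau.toeplitzMinus b m q)
            ≤ Landau.Nminus b m q lam + C ∧
        Landau.Nminus b m q lam
            ≤ Landau.nPlus ((1 - ε) * lam) (Landau.toeplitzMinus b m q) + C) := by
  open Landau in
  obtain ⟨N, hN⟩ := hm.exists_isHermCoeff
  have hL := level_pos hb q
  have hr : 0 < ε * level b q / 4 := by have := hε.1; positivity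
  refine ⟨?_, ?_⟩
  · have hu := hN.isUnit_plus hb
    rw [toeplitzPlus_eq hb hN.toIsCoeff q hu]
    refine ⟨hN.isCompactSelfAdjoint_toepS hb hm.decay q hu, ?_⟩
    obtain ⟨γ, hG⟩ := hN.gapData_plus hb hm.decay hu q
    exact hG.asymptotics hε hL hr (fun t ht => Nplus_eq hb hN.toIsCoeff hu q ht.1)
      (shift_plus hε hL) (nPlus_toepS hb _ q 1)
  · rintro ⟨δ, hδ1, hδ⟩
    have hform : ∀ x (z : Fin 2 → ℂ),
        (∑ j, ∑ k, (starRingEnd ℂ) (z j) * (m x j k * z k)).re ≤ δ * ∑ j, ‖z j‖ ^ 2 :=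
      fun x z => re_form_le (hδ x) z
    have hform' : ∀ x (z : Fin 2 → ℂ),
        (∑ j, ∑ k, (starRingEnd ℂ) (z j) * (m x j k * z k)).re ≤ ∑ j, ‖z j‖ ^ 2 := by
      intro x z
      refine (hform x z).trans ?_
      have : 0 ≤ ∑ j, ‖z j‖ ^ 2 := Finset.sum_nonneg fun j _ => sq_nonneg _
      exact mul_le_of_le_one_left this hδ1.le
    have hu := hN.isUnit_minus hb hδ1 hform
    rw [toeplitzMinus_eq hb hN.toIsCoeff q hu]
    refine ⟨hN.isCompactSelfAdjoint_toepS hb hm.decay q hu, ?_⟩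
    have hrL : ε * level b q / 4 < level b q := by nlinarith [hε.1, hε.2]
    rcases q with _ | q
    -- B must exceed Λ₀⁻¹, for the gap, and ‖H₋⁻¹‖, so that no eigenvalue is lost.
    · set B : ℝ := (level b 0)⁻¹ + ‖resP b (fun j k x => m x j k) (-1)‖ + 1
      have hB1 : (level b 0)⁻¹ < B := by
        have := norm_nonneg (resP b (fun j k x => m x j k) (-1))
        simp only [B]; linarith
      have hB2 : ‖resP b (fun j k x => m x j k) (-1)‖ < B := by
        have := inv_pos.2 hL
        simp only [B]; linarith
      obtain ⟨γ, hG⟩ := hN.gapData_minus_zero hb hm.decay hform' hu hB1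
      exact hG.asymptotics hε hL hr
        (fun t ht => Nminus_zero_eq hb hN hform' hu hB2 ht.1 (ht.2.trans hrL))
        (shift_minus hε hL) (nPlus_toepS hb _ 0 (-1))
    · obtain ⟨γ, hG⟩ := hN.gapData_minus_succ hb hm.decay hform' hu q
      exact hG.asymptotics hε hL hr
        (fun t ht => Nminus_succ_eq hb hN.toIsCoeff hu q ht.1 (ht.2.trans hrL))
        (shift_minus hε hL) (nPlus_toepS hb _ (q + 1) (-1))
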